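/- Let $T$ be a locally finite simplicial tree, and let $\Gamma$ be a geometrically finite group of automorphisms of $T$ acting without inversion. That is: $\Gamma$ is discrete (finite vertex stabilizers) and non-elementary (it preserves no point and no pair of points of $T\cup\partial T$), and, $T_{\min}$ being its smallest nonempty invariant subtree, the quotient graph of groups $\Gamma\backslash\!\backslash T_{\min}$ is the union of a finite graph of finite groups and of finitely many cuspidal rays of finite groups, which are glued to it at their origins and otherwise disjoint from it and from each other. A ray of groups with consecutive edges $e_0,e_1,\dots$ (oriented towards the end) is cuspidal if $G_{e_n}\to G_{o(e_n)}$ is onto for all $n\ge 1$. Such a presentation is called a cuspidal decomposition; the open cuspidal rays are its rays without their origins and open initial edges. For a tree $T$, let $\mathcal G T$ be the space of geodesics $\ell:\mathbb Z\to T$ (injective edge paths) with the compact-open topology; the geodesic transformation of $\Gamma\backslash\mathcal G T$ is the map induced by $\ell\mapsto\ell(\cdot+1)$. Then there are a cuspidal decomposition, a tree $T'$, an action without inversion of $\Gamma$ on $T'$, and a $\Gamma$-equivariant simplicial map $f:T\to T'$ (possibly collapsing edges), whose restriction to $T_{\min}$ is the quotient map collapsing to a point each connected component of the preimage of the open cuspidal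 rays, such that 1. $\Gamma\backslash T'$ is a finite graph, the edge stabilizers of $T'$ are finite, and the vertex stabilizers of $T'$ are locally finite groups. 2. There is a dense $G_\delta$ subset $\Omega$ of $\Gamma\backslash\mathcal G T_{\min}$, invariant under the geodesic transformation, such that the restriction of the geodesic transformation to $\Omega$ is topologically conjugate to a suspension of the geodesic transformation $\varphi'$ of $\Gamma\backslash\mathcal G T'$: there is a continuous roof function $r:\Gamma\backslash\mathcal G T'\to\mathbb N\setminus\{0\}$ and a homeomorphism from $\Omega$ to $\{(y,k): 0\le k<r(y)\}$ conjugating it with $(y,k)\mapsto(y,k+1)$ if $k+1<r(y)$, and $(y,k)\mapsto(\varphi'(y),0)$ otherwise. If moreover $\Gamma$ is of divergence type with finite nonzero critical exponent (so that Bowen–Margulis measures are defined), then the complement of $\Omega$ in $\Gamma\backslash\mathcal G T$ has measure $0$ for every Bowen–Margulis measure. 3. If $\Gamma$ has the Selberg property, then some finite index subgroup of $\Gamma$ acts acylindrically on $T'$ (for some $k\ge1$, only the identity fixes pointwise an injective path of $k$ edges). Here the Selberg property means: there are a cuspidal decomposition and a finite index subgroup $\Gamma_0$ of $\Gamma$ such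 that every vertex of $T_{\min}$ fixed by a nontrivial torsion element of $\Gamma_0$ projects into an open cuspidal ray. -/

import Mathlib

open Set Filter Topology MeasureTheory
open scoped ENNReal

universe u w

/-! ### Groups acting on a graph by automorphisms, quotient graphs, stabilizers -/

section Actions

variable {V : Type u} {G : SimpleGraph V} {Γ : Type w} [Group Γ]

/-- The action `ρ` is without inversion: no element exchanges the endpoints of an edge. -/
def NoInversion (ρ : Γ →* (G ≃g G)) : Prop :=
  ∀ (γ : Γ) (a b : V), G.Adj a b → ¬ (ρ γ a = b ∧ ρ γ b = a)

/-- The stabilizer of a vertex. -/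
def vertexStab (ρ : Γ →* (G ≃g G)) (v : V) : Subgroup Γ where
  carrier := {γ | ρ γ v = v}
  one_mem' := by simp
  mul_mem' := by
    intro a b ha hb
    simp only [mem_ofPred_eq, map_mul, RelIso.mul_apply] at *
    rw [hb, ha]
  inv_mem' := by
    intro a ha
    simp only [mem_ofPred_eq] at *
    have h : (ρ a⁻¹ * ρ a) v = v := by rw [← map_mul]; simp
    rwa [RelIso.mul_apply, ha] at h

/-- A group is locally finite if its finitely generated subgroups are finite;
here for a subgroup `K`. -/
def IsLocallyFiniteSubgroup (K : Subgroup Γ) : Prop :=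
  ∀ H : Subgroup Γ, H ≤ K → H.FG → Finite H

/-- Two vertices are equivalent if they are in the same orbit. -/
def vertexSetoid (ρ : Γ →* (G ≃g G)) : Setoid V where
  r a b := ∃ γ, ρ γ a = b
  iseqv :=
    { refl := fun a => ⟨1, by simp⟩
      symm := by
        rintro a b ⟨γ, rfl⟩
        refine ⟨γ⁻¹, ?_⟩
        rw [← RelIso.mul_apply, ← map_mul]; simp
      trans := by
        rintro a b c ⟨γ, rfl⟩ ⟨η, rfl⟩
        exact ⟨η * γ, by rw [map_mul, RelIso.mul_apply]⟩ }

/-- Two oriented edges are equivalent if they are in the same orbit. -/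
def edgeSetoid (ρ : Γ →* (G ≃g G)) : Setoid G.Dart where
  r d e := ∃ γ, ρ γ d.fst = e.fst ∧ ρ γ d.snd = e.snd
  iseqv :=
    { refl := fun a => ⟨1, by simp⟩
      symm := by
        rintro a b ⟨γ, h1, h2⟩
        refine ⟨γ⁻¹, ?_, ?_⟩
        · rw [← h1, ← RelIso.mul_apply, ← map_mul]; simp
        · rw [← h2, ← RelIso.mul_apply, ← map_mul]; simp
      trans := by
        rintro a b c ⟨γ, h1, h2⟩ ⟨η, h3, h4⟩
        refine ⟨η * γ, ?_, ?_⟩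
        · rw [map_mul, RelIso.mul_apply, h1, h3]
        · rw [map_mul, RelIso.mul_apply, h2, h4] }

/-- The vertices of the quotient graph `Γ \ G`. -/
def QuotVertex (ρ : Γ →* (G ≃g G)) : Type u := Quotient (vertexSetoid ρ)

/-- The oriented edges of the quotient graph `Γ \ G`. -/
def QuotEdge (ρ : Γ →* (G ≃g G)) : Type u := Quotient (edgeSetoid ρ)

/-- Projection of vertices to the quotient graph. -/
def projVertex (ρ : Γ →* (G ≃g G)) (v : V) : QuotVertex ρ := Quotient.mk (vertexSetoid ρ) v

/-- Projection of oriented edges to the quotient graph. -/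
def projEdge (ρ : Γ →* (G ≃g G)) (d : G.Dart) : QuotEdge ρ := Quotient.mk (edgeSetoid ρ) d

/-- The origin of an edge of the quotient graph. -/
def QuotEdge.origin {ρ : Γ →* (G ≃g G)} : QuotEdge ρ → QuotVertex ρ :=
  Quotient.map' (s₁ := edgeSetoid ρ) (s₂ := vertexSetoid ρ) (fun d => d.fst)
    (fun _ _ ⟨γ, h, _⟩ => ⟨γ, h⟩)

/-- The terminal vertex of an edge of the quotient graph. -/
def QuotEdge.target {ρ : Γ →* (G ≃g G)} : QuotEdge ρ → QuotVertex ρ :=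
  Quotient.map' (s₁ := edgeSetoid ρ) (s₂ := vertexSetoid ρ) (fun d => d.snd)
    (fun _ _ ⟨γ, _, h⟩ => ⟨γ, h⟩)

/-- The opposite of an edge of the quotient graph. -/
def QuotEdge.bar {ρ : Γ →* (G ≃g G)} : QuotEdge ρ → QuotEdge ρ :=
  Quotient.map' (s₁ := edgeSetoid ρ) (s₂ := edgeSetoid ρ) (fun d => d.symm)
    (fun _ _ ⟨γ, h, h'⟩ => ⟨γ, h', h⟩)

/-- The smallest nonempty invariant subtree, given by its set of vertices: the intersection of all
nonempty invariant subtrees. -/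
def minSubtree (ρ : Γ →* (G ≃g G)) : Set V :=
  ⋂₀ {S : Set V | (∀ γ, ∀ v ∈ S, ρ γ v ∈ S) ∧ (G.induce S).Connected}

/-- The vertices of `Γ \ T_min`. -/
def minQuotVertex (ρ : Γ →* (G ≃g G)) : Set (QuotVertex ρ) := projVertex ρ '' minSubtree ρ

/-- The oriented edges of `Γ \ T_min`. -/
def minQuotEdge (ρ : Γ →* (G ≃g G)) : Set (QuotEdge ρ) :=
  projEdge ρ '' {d | d.fst ∈ minSubtree ρ ∧ d.snd ∈ minSubtree ρ}

/-- The action is acylindrical: it is without inversion and, for some `k ≥ 1`, only the identity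
fixes an injective path of `k` edges pointwise. -/
def IsAcylindrical (ρ : Γ →* (G ≃g G)) : Prop :=
  NoInversion ρ ∧ ∃ k : ℕ, 1 ≤ k ∧ ∀ (a b : V) (p : G.Walk a b), p.IsPath → p.length = k →
    ∀ γ : Γ, (∀ v ∈ p.support, ρ γ v = v) → γ = 1

end Actions

/-! ### The boundary of a tree, geodesics and the geodesic transformation -/

section Boundary

variable {V : Type u}

/-- Geodesic rays (injective edge paths indexed by `ℕ`). -/
structure GeodRay (G : SimpleGraph V) where
  /-- the consecutive vertices -/
  vert : ℕ → V
  adj : ∀ n, G.Adj (vert n) (vert (n + 1))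
  inj : Function.Injective vert

/-- The compact-open topology, i.e. pointwise convergence with `V` discrete. -/
instance (G : SimpleGraph V) : TopologicalSpace (GeodRay G) :=
  TopologicalSpace.induced GeodRay.vert (@Pi.topologicalSpace ℕ (fun _ => V) (fun _ => ⊥))

/-- Two rays are equivalent if they eventually coincide, up to a shift of the parameter. -/
def raySetoid (G : SimpleGraph V) : Setoid (GeodRay G) where
  r a b := ∃ m n, ∀ k, a.vert (m + k) = b.vert (n + k)
  iseqv :=
    { refl := fun a => ⟨0, 0, fun _ => rfl⟩
      symm := fun ⟨m, n, h⟩ => ⟨n, m, fun k => (h k).symm⟩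
      trans := by
        rintro a b c ⟨m, n, h⟩ ⟨m', n', h'⟩
        refine ⟨m + m', n' + n, fun k => ?_⟩
        have e1 := h (m' + k)
        have e2 := h' (n + k)
        rw [show m + m' + k = m + (m' + k) by ring, e1,
          show n + (m' + k) = m' + (n + k) by ring, e2,
          show n' + (n + k) = n' + n + k by ring] }

/-- The boundary at infinity (space of ends) `∂G` of a tree `G`, with the quotient topology
(shadows of vertices form a basis of it) and its Borel sets. -/
def Bdry (G : SimpleGraph V) : Type u := Quotient (raySetoid G)

/-- The point at infinity of a ray. -/
def GeodRay.endpoint {G : SimpleGraph V} (r : GeodRay G) : Bdry G := Quotient.mk (raySetoid G) r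

instance (G : SimpleGraph V) : TopologicalSpace (Bdry G) :=
  inferInstanceAs (TopologicalSpace (Quotient (raySetoid G)))

instance (G : SimpleGraph V) : MeasurableSpace (Bdry G) := borel _

/-- The image of a ray by an automorphism. -/
def GeodRay.map {G : SimpleGraph V} (g : G ≃g G) (r : GeodRay G) : GeodRay G where
  vert n := g (r.vert n)
  adj n := g.map_rel_iff.2 (r.adj n)
  inj := g.injective.comp r.inj

/-- The action of an automorphism on the boundary. -/
def Bdry.map {G : SimpleGraph V} (g : G ≃g G) : Bdry G → Bdry G :=
  Quotient.map' (s₁ := raySetoid G) (s₂ := raySetoid G) (GeodRay.map g)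
    (fun _ _ ⟨m, n, h⟩ => ⟨m, n, fun k => congrArg g (h k)⟩)

/-- The boundary of a subtree. -/
def bdryOf (G : SimpleGraph V) (S : Set V) : Set (Bdry G) :=
  {ξ | ∃ r : GeodRay G, r.endpoint = ξ ∧ ∀ n, r.vert n ∈ S}

/-- The vertex `v` is on the geodesic ray from `x` to `ξ`. -/
def OnRay {G : SimpleGraph V} (x : V) (ξ : Bdry G) (v : V) : Prop :=
  ∃ r : GeodRay G, r.endpoint = ξ ∧ r.vert 0 = x ∧ ∃ n, r.vert n = v

/-- The length of the intersection of the geodesic rays from `x` to `ξ` and from `x` to `η`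
(meaningful for `ξ ≠ η`). -/
noncomputable def commonLength {G : SimpleGraph V} (x : V) (ξ η : Bdry G) : ℕ :=
  sSup {n | ∃ v, OnRay x ξ v ∧ OnRay x η v ∧ G.dist x v = n}

/-- The Busemann cocycle `β_ξ(x, y)`: the (eventually constant) value of `d(x, z) - d(z, y)` as the
vertex `z` tends to `ξ` along a ray. -/
noncomputable def busemann {G : SimpleGraph V} (ξ : Bdry G) (x y : V) : ℝ :=
  limUnder atTop (fun n : ℕ =>
    (G.dist x ((Quotient.out (s := raySetoid G) ξ).vert n) : ℝ)
      - (G.dist ((Quotient.out (s := raySetoid G) ξ).vert n) y : ℝ))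

/-- The space of geodesics `𝒢G`: injective simplicial maps from the line to `G`, given by their
restriction to the vertices `ℤ` of the line. -/
@[ext] structure Geod (G : SimpleGraph V) where
  /-- the consecutive vertices -/
  vert : ℤ → V
  adj : ∀ n, G.Adj (vert n) (vert (n + 1))
  inj : Function.Injective vert

/-- The compact-open topology, i.e. pointwise convergence with `V` discrete. -/
instance (G : SimpleGraph V) : TopologicalSpace (Geod G) :=
  TopologicalSpace.induced Geod.vert (@Pi.topologicalSpace ℤ (fun _ => V) (fun _ => ⊥))

instance (G : SimpleGraph V) : MeasurableSpace (Geod G) := borel _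

/-- The geodesic transformation `l ↦ (t ↦ l (t + 1))`. -/
def Geod.shift {G : SimpleGraph V} (l : Geod G) : Geod G where
  vert n := l.vert (n + 1)
  adj n := l.adj (n + 1)
  inj a b h := by
    have := l.inj h
    omega

/-- The terminal ray `n ↦ l n` of a geodesic. -/
def Geod.rayPos {G : SimpleGraph V} (l : Geod G) : GeodRay G where
  vert n := l.vert n
  adj n := by simpa using l.adj n
  inj a b h := by
    have := l.inj h
    omega

/-- The initial ray `n ↦ l (-n)` of a geodesic. -/
def Geod.rayNeg {G : SimpleGraph V} (l : Geod G) : GeodRay G where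
  vert n := l.vert (-(n : ℤ))
  adj n := by
    have h := l.adj (-(n : ℤ) - 1)
    rw [sub_add_cancel] at h
    have e : (-((n + 1 : ℕ) : ℤ)) = -(n : ℤ) - 1 := by push_cast; ring
    rw [e]
    exact h.symm
  inj a b h := by
    have := l.inj h
    omega

/-- The image of a geodesic by an automorphism. -/
def Geod.map {G : SimpleGraph V} (g : G ≃g G) (l : Geod G) : Geod G where
  vert n := g (l.vert n)
  adj n := g.map_rel_iff.2 (l.adj n)
  inj := g.injective.comp l.inj

/-- The algebraic distance along `l` from `l 0` to the point of `l` closest to `x`. -/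
noncomputable def Geod.time {G : SimpleGraph V} (x : V) (l : Geod G) : ℤ :=
  Function.argmin (fun n : ℤ => G.dist x (l.vert n))

/-- The parametrization `l ↦ (l₋, l₊, t)` of the space of geodesics, with base point `x`. -/
noncomputable def Geod.param {G : SimpleGraph V} (x : V) (l : Geod G) : Bdry G × Bdry G × ℤ :=
  (l.rayNeg.endpoint, l.rayPos.endpoint, l.time x)

variable {G : SimpleGraph V} {Γ : Type w} [Group Γ]

/-- Two geodesics are equivalent if they are in the same orbit. -/
def geodSetoid (ρ : Γ →* (G ≃g G)) : Setoid (Geod G) where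
  r a b := ∃ γ, a.map (ρ γ) = b
  iseqv :=
    { refl := fun a => ⟨1, Geod.ext (funext fun n => by simp [Geod.map])⟩
      symm := by
        rintro a b ⟨γ, rfl⟩
        refine ⟨γ⁻¹, Geod.ext (funext fun n => ?_)⟩
        change (ρ γ⁻¹) ((ρ γ) (a.vert n)) = a.vert n
        rw [← RelIso.mul_apply, ← map_mul]; simp
      trans := by
        rintro a b c ⟨γ, rfl⟩ ⟨η, rfl⟩
        refine ⟨η * γ, Geod.ext (funext fun n => ?_)⟩
        change (ρ (η * γ)) (a.vert n) = (ρ η) ((ρ γ) (a.vert n))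
        rw [map_mul, RelIso.mul_apply] }

/-- The quotient `Γ \ 𝒢G` of the space of geodesics. -/
def QuotGeod (ρ : Γ →* (G ≃g G)) : Type u := Quotient (geodSetoid ρ)

instance (ρ : Γ →* (G ≃g G)) : TopologicalSpace (QuotGeod ρ) :=
  inferInstanceAs (TopologicalSpace (Quotient (geodSetoid ρ)))

instance (ρ : Γ →* (G ≃g G)) : MeasurableSpace (QuotGeod ρ) := borel _

/-- The projection of `𝒢G` to `Γ \ 𝒢G`. -/
def projGeod (ρ : Γ →* (G ≃g G)) (l : Geod G) : QuotGeod ρ := Quotient.mk (geodSetoid ρ) l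

/-- The geodesic transformation of `Γ \ 𝒢G`. -/
def QuotGeod.shift (ρ : Γ →* (G ≃g G)) : QuotGeod ρ → QuotGeod ρ :=
  Quotient.map' (s₁ := geodSetoid ρ) (s₂ := geodSetoid ρ) Geod.shift (by
    rintro a b ⟨γ, rfl⟩
    exact ⟨γ, rfl⟩)

/-- The subspace `Γ \ 𝒢T_min` of `Γ \ 𝒢T`. -/
def minQuotGeod (ρ : Γ →* (G ≃g G)) : Set (QuotGeod ρ) :=
  projGeod ρ '' {l | ∀ n, l.vert n ∈ minSubtree ρ}

end Boundary

/-! ### Geometrically finite groups -/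

section GeometricallyFinite

variable {V : Type u} {G : SimpleGraph V} {Γ : Type w} [Group Γ]

/-- The group preserves no point and no pair of points of `T ∪ ∂T`. (An action without inversion
that preserves a point of the geometric realization fixes a vertex.) -/
def IsNonElementary (ρ : Γ →* (G ≃g G)) : Prop :=
  ∀ p q : V ⊕ Bdry G, ∃ γ, Sum.map (ρ γ) (Bdry.map (ρ γ)) '' {p, q} ≠ {p, q}

/-- A presentation of the quotient graph of groups of `Γ` acting on `T_min` as the union of a finite
subgraph and of finitely many cuspidal rays, glued at their origins. The vertex and edge groups of
the quotient graph of groups are the stabilizers of lifts. -/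
structure CuspidalDecomposition (ρ : Γ →* (G ≃g G)) where
  /-- vertices of the finite subgraph -/
  finV : Set (QuotVertex ρ)
  /-- edges of the finite subgraph -/
  finE : Set (QuotEdge ρ)
  finite_finV : finV.Finite
  finite_finE : finE.Finite
  finV_subset : finV ⊆ minQuotVertex ρ
  finE_subset : finE ⊆ minQuotEdge ρ
  origin_mem : ∀ e ∈ finE, e.origin ∈ finV
  bar_mem : ∀ e ∈ finE, e.bar ∈ finE
  /-- the number of rays -/
  numRays : ℕ
  /-- the consecutive edges of the rays, oriented towards the ends -/
  ray : Fin numRays → ℕ → QuotEdge ρ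
  ray_subset : ∀ i n, ray i n ∈ minQuotEdge ρ
  consecutive : ∀ i n, (ray i n).target = (ray i (n + 1)).origin
  /-- the rays are glued at their origins -/
  origin_ray : ∀ i, (ray i 0).origin ∈ finV
  /-- the other vertices of the rays are pairwise distinct and not in the finite subgraph -/
  interior_not_mem : ∀ i n, (ray i n).target ∉ finV
  interior_injective : Function.Injective fun p : Fin numRays × ℕ => (ray p.1 p.2).target
  /-- `Γ \ T_min` is the union of the finite subgraph and the rays -/
  cover_vertex : ∀ x ∈ minQuotVertex ρ, x ∈ finV ∨ ∃ i n, x = (ray i n).target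
  cover_edge : ∀ e ∈ minQuotEdge ρ, e ∈ finE ∨ ∃ i n, e = ray i n ∨ e = (ray i n).bar
  /-- for `n ≥ 1`, the inclusion of the group of the `n`-th edge in that of its origin is onto -/
  cuspidal : ∀ i n, 1 ≤ n → ∀ d : G.Dart, projEdge ρ d = ray i n →
    ∀ γ, ρ γ d.fst = d.fst → ρ γ d.snd = d.snd

/-- The vertices of `T_min` that project to a vertex, other than the origin, of one of the cuspidal
rays. Their connected components are the sets of vertices of the horoballs over the cuspidal
rays. -/
def CuspidalDecomposition.horo {ρ : Γ →* (G ≃g G)} (D : CuspidalDecomposition ρ) : Set V :=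
  {v | v ∈ minSubtree ρ ∧ ∃ i n, projVertex ρ v = (D.ray i n).target}

/-- `Γ` is geometrically finite: non-elementary, discrete (vertex stabilizers are finite), and the
quotient graph of groups of `T_min` is a finite graph of finite groups with finitely many cuspidal
rays of finite groups glued to it. -/
def IsGeometricallyFinite (ρ : Γ →* (G ≃g G)) : Prop :=
  IsNonElementary ρ ∧ (∀ v, Finite (vertexStab ρ v)) ∧ Nonempty (CuspidalDecomposition ρ)

/-- The Selberg property: some finite index subgroup has all the fixed vertices in `T_min` of its
nontrivial torsion elements over interior vertices of the cuspidal rays. -/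
def HasSelbergProperty (ρ : Γ →* (G ≃g G)) : Prop :=
  ∃ (D : CuspidalDecomposition ρ) (Γ' : Subgroup Γ), Γ'.FiniteIndex ∧
    ∀ γ ∈ Γ', IsOfFinOrder γ → γ ≠ 1 → ∀ v ∈ minSubtree ρ, ρ γ v = v → v ∈ D.horo

/-- The map `f` restricted to `T_min` is the quotient map of graphs collapsing to a point each
connected component of the preimage of the cuspidal rays (without their origins and open initial
edges). -/
def IsHoroballCollapse {ρ : Γ →* (G ≃g G)} (D : CuspidalDecomposition ρ) {V' : Type u}
    (G' : SimpleGraph V') (f : V → V') : Prop :=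
  f '' minSubtree ρ = univ ∧
  (∀ a ∈ minSubtree ρ, ∀ b ∈ minSubtree ρ,
    f a = f b ↔ a = b ∨ ∃ p : G.Walk a b, ∀ v ∈ p.support, v ∈ D.horo) ∧
  ∀ x y : V', G'.Adj x y ↔
    x ≠ y ∧ ∃ a ∈ minSubtree ρ, ∃ b ∈ minSubtree ρ, G.Adj a b ∧ f a = x ∧ f b = y

end GeometricallyFinite

/-! ### Patterson-Sullivan and Bowen-Margulis measures -/

section Measures

variable {V : Type u} {G : SimpleGraph V} {Γ : Type w} [Group Γ]

/-- Convergence of the Poincaré series with base point `x` at `s`. -/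
def PoincareConverges (ρ : Γ →* (G ≃g G)) (x : V) (s : ℝ) : Prop :=
  Summable fun γ : Γ => Real.exp (-s * G.dist x (ρ γ x))

/-- The critical exponent in `[0, ∞]`. -/
noncomputable def criticalExponent (ρ : Γ →* (G ≃g G)) (x : V) : ℝ≥0∞ :=
  sInf {s | s ≠ ⊤ ∧ PoincareConverges ρ x s.toReal}

/-- A Patterson-Sullivan measure of dimension `δ`. -/
structure IsPattersonSullivan (ρ : Γ →* (G ≃g G)) (δ : ℝ) (μ : V → Measure (Bdry G)) : Prop where
  finite : ∀ x, IsFiniteMeasure (μ x)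
  support_eq : ∀ x, (μ x).support = bdryOf G (minSubtree ρ)
  map_eq : ∀ γ x, (μ x).map (Bdry.map (ρ γ)) = μ (ρ γ x)
  density_eq : ∀ x y,
    μ x = (μ y).withDensity fun ξ => ENNReal.ofReal (Real.exp (-δ * busemann ξ x y))

/-- The Bowen-Margulis measure on `𝒢T`: in the parametrization `l ↦ (l₋, l₊, t)` with base point
`x`, it is `dμ_x(l₋) dμ_x(l₊) dt / d_x(l₋, l₊) ^ (2 δ)`, where `d_x = exp (- commonLength x)`. -/
noncomputable def bowenMargulis (δ : ℝ) (μ : V → Measure (Bdry G)) (x : V) : Measure (Geod G) :=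
  Measure.comap (Geod.param x)
    (((μ x).prod ((μ x).prod (Measure.count : Measure ℤ))).withDensity fun p =>
      ENNReal.ofReal (Real.exp (2 * δ * commonLength x p.1 p.2.1)))

/-- The measure induced on `Γ \ 𝒢T` by an invariant measure on `𝒢T`: choosing a vertex `v` in each
orbit of vertices, it is the sum over these `v` of the image, divided by the order of the stabilizer
of `v`, of the restriction of the measure to the geodesics with origin `v`. -/
noncomputable def inducedMeasure (ρ : Γ →* (G ≃g G)) (m : Measure (Geod G)) :
    Measure (QuotGeod ρ) :=
  Measure.sum fun q : QuotVertex ρ =>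
    (Nat.card (vertexStab ρ (Quotient.out (s := vertexSetoid ρ) q)) : ℝ≥0∞)⁻¹ •
      (m.restrict {l | l.vert 0 = Quotient.out (s := vertexSetoid ρ) q}).map (projGeod ρ)

end Measures

/-! ### Topological suspensions -/

section Suspensions

/-- The (discrete time) suspension space with roof function `r`, a subspace of `Y × ℕ`. -/
abbrev SuspSpace {Y : Type*} (r : Y → ℕ) : Type _ := {p : Y × ℕ // p.2 < r p.1}

/-- The suspension of the transformation `S` with positive roof function `r`. -/
def suspMap {Y : Type*} (S : Y → Y) (r : Y → ℕ) (hr : ∀ y, 0 < r y) (p : SuspSpace r) :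
    SuspSpace r :=
  if h : p.1.2 + 1 < r p.1.1 then ⟨(p.1.1, p.1.2 + 1), h⟩ else ⟨(S p.1.1, 0), hr _⟩

/-- The set `Ω` is invariant under `φ`, and the restriction of `φ` to `Ω` is topologically conjugate
to a suspension of `S` with continuous roof function. -/
def IsSuspensionOf {X Y : Type*} [TopologicalSpace X] [TopologicalSpace Y] (φ : X → X) (Ω : Set X)
    (S : Y → Y) : Prop :=
  ∃ (hΩ : MapsTo φ Ω Ω) (r : Y → ℕ) (hr : ∀ y, 0 < r y), Continuous r ∧
    ∃ h : Ω ≃ₜ SuspSpace r, ∀ ω : Ω, h (hΩ.restrict φ Ω Ω ω) = suspMap S r hr (h ω)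

end Suspensions

/-! Over a cuspidal ray, the minimal subtree looks like a union of horoballs. Cuspidality leaves
exactly one ascending edge at each of their vertices and all the other edges descend
(`AtLevel.adj_cases`), so the ascending rays of two vertices of one horoball merge
(`HConn.exists_up_eq`) and the horoball has a single point at infinity, its cusp. The tree `T'` is
the minimal subtree with every horoball collapsed, and `f` is the nearest point projection to the
minimal subtree followed by the collapse. Horoballs are convex, so the edges of `T'` lift uniquely
(`lift_unique`) and the two sides of a lifted edge have disjoint images (`same_side`). Hence `T'` is
a tree, an element fixing an edge of `T'` fixes its lift, and an inversion would lift. An element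
preserving a horoball fixes all far vertices of an ascending ray, so the stabilizer of a horoball is
an increasing union of finite groups.

For the dynamics, `Ω` consists of the classes of the geodesics of the minimal subtree that traverse
non-collapsed edges infinitely often in both directions. Recording these edges gives a geodesic of
`T'` (`collGeod`). Conversely, the lifts of the successive edges of a geodesic of `T'` lie on a
unique geodesic of `T` (`liftPts_isChainPts`, `IsChainPts.line_unique`). The two constructions are
inverse, continuous and equivariant, and they exchange the shift of `T'` with the first return to
the clopen set of geodesics crossing at time 0; `exists_suspension` then applies to the quotient.
`Ω` is dense because the minimal subtree has no leaf and each of its half-trees contains a translate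
of a vertex outside the horoballs, so that every segment extends to a recurrent geodesic
(`exists_recSet_through`).

For the measure, a geodesic fails to be recurrent only if one of its ends is outside the limit set
or is a cusp (`endpoint_mem_nonRecEnds`). The first set of ends is null since the limit set is the
support of the Patterson-Sullivan measures. Cusps are countably many, and an atom at one of them
would make the Poincaré series converge (`poincareConverges_of_atom`), against divergence type. -/

namespace GFTree

/-! ### Metric geometry of trees -/

section TreeMetric

variable {V : Type u} {T : SimpleGraph V}

/-- The vertex `z` lies on a geodesic segment from `x` to `y`. -/
def Between (T : SimpleGraph V) (x z y : V) : Prop := T.dist x z + T.dist z y = T.dist x y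

lemma Between.symm {x z y : V} (h : Between T x z y) : Between T y z x := by
  unfold Between at *
  rw [T.dist_comm (u := y) (v := z), T.dist_comm (u := z) (v := x), T.dist_comm (u := y)]
  omega

lemma between_left (x y : V) : Between T x x y := by simp [Between]

lemma between_right (x y : V) : Between T x y y := by simp [Between]

lemma dist_map (g : T ≃g T) (x y : V) : T.dist (g x) (g y) = T.dist x y := by
  have key : ∀ (g : T ≃g T) (x y : V), T.Reachable x y → T.dist (g x) (g y) ≤ T.dist x y := by
    intro g x y h
    obtain ⟨p, hp⟩ := h.exists_walk_length_eq_dist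
    rw [← hp, ← SimpleGraph.Walk.length_map g.toHom p]
    exact SimpleGraph.dist_le _
  by_cases h : T.Reachable x y
  · refine le_antisymm (key g x y h) ?_
    have := key g.symm (g x) (g y) (h.map g.toHom)
    simpa using this
  · rw [SimpleGraph.dist_eq_zero_of_not_reachable h,
      SimpleGraph.dist_eq_zero_of_not_reachable (fun h' => h (by simpa using h'.map g.symm.toHom))]

lemma Between.map {x z y : V} (h : Between T x z y) (g : T ≃g T) : Between T (g x) (g z) (g y) := by
  unfold Between at *; simpa [dist_map] using h

variable (hT : T.IsTree)
include hT

lemma tdist_eq_zero {x y : V} : T.dist x y = 0 ↔ x = y := hT.connected.dist_eq_zero_iff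

lemma dist_tri (x y z : V) : T.dist x z ≤ T.dist x y + T.dist y z := hT.connected.dist_triangle

lemma exists_btw (x y : V) {k : ℕ} (hk : k ≤ T.dist x y) : ∃ z, T.dist x z = k ∧ Between T x z y := by
  obtain ⟨p, hp⟩ := hT.connected.exists_walk_length_eq_dist x y
  refine ⟨p.getVert k, ?_⟩
  have h1 : T.dist x (p.getVert k) ≤ k := by
    have := SimpleGraph.dist_le (p.take k)
    rw [SimpleGraph.Walk.take_length] at this
    omega
  have h2 : T.dist (p.getVert k) y ≤ T.dist x y - k := by
    have := SimpleGraph.dist_le (p.drop k)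
    rwa [SimpleGraph.Walk.drop_length, hp] at this
  have h3 := dist_tri hT x (p.getVert k) y
  unfold Between
  omega

lemma exists_adj_btw {x y : V} (h : x ≠ y) : ∃ z, T.Adj x z ∧ Between T x z y := by
  have := hT.connected.pos_dist_of_ne h
  obtain ⟨z, h1, h2⟩ := exists_btw hT x y (k := 1) this
  exact ⟨z, SimpleGraph.dist_eq_one_iff_adj.1 h1, h2⟩

lemma dist_adj_cases {u v : V} (h : T.Adj u v) (z : V) :
    T.dist z u = T.dist z v + 1 ∨ T.dist z v = T.dist z u + 1 :=
  hT.dist_eq_dist_add_one_of_adj z h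

/-- Removing an edge separates the vertices closer to one end from those closer to the other. -/
lemma dist_across {u v z w : V} (h : T.Adj u v) (hz : T.dist z u < T.dist z v)
    (hw : T.dist w v < T.dist w u) : T.dist z w = T.dist z u + 1 + T.dist v w := by
  obtain ⟨p, hp⟩ := hT.connected.exists_walk_length_eq_dist z u
  obtain ⟨q, hq⟩ := hT.connected.exists_walk_length_eq_dist v w
  obtain ⟨r, hr⟩ := hT.connected.exists_walk_length_eq_dist z w
  have pp := p.isPath_of_length_eq_dist hp
  have qp := q.isPath_of_length_eq_dist hq
  have rp := r.isPath_of_length_eq_dist hr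
  have side1 : ∀ y ∈ p.support, T.dist y u < T.dist y v := by
    intro y hy
    obtain ⟨k, rfl, hk⟩ := SimpleGraph.Walk.mem_support_iff_exists_getVert.1 hy
    have h1 := SimpleGraph.dist_le (p.take k)
    have h2 := SimpleGraph.dist_le (p.drop k)
    rw [SimpleGraph.Walk.take_length] at h1
    rw [SimpleGraph.Walk.drop_length] at h2
    have h3 := dist_tri hT z (p.getVert k) v
    rcases dist_adj_cases hT h (p.getVert k) with h4 | h4 <;> omega
  have side2 : ∀ y ∈ q.support, T.dist y v < T.dist y u := by
    intro y hy
    obtain ⟨k, rfl, hk⟩ := SimpleGraph.Walk.mem_support_iff_exists_getVert.1 hy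
    have h1 := SimpleGraph.dist_le (q.take k)
    have h2 := SimpleGraph.dist_le (q.drop k)
    rw [SimpleGraph.Walk.take_length] at h1
    rw [SimpleGraph.Walk.drop_length] at h2
    have h3 := dist_tri hT w (q.getVert k) u
    rw [T.dist_comm (u := q.getVert k) (v := w)] at h2
    rw [T.dist_comm (u := w) (v := v)] at hw
    rw [T.dist_comm (u := v) (v := q.getVert k)] at h1
    rcases dist_adj_cases hT h (q.getVert k) with h4 | h4 <;> omega
  -- `p` stays on the side of `u` and `q` on the side of `v`, so the concatenation repeats no
  -- vertex. Paths in a tree being unique, it is the geodesic `r`.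
  have hpath : (p.append (SimpleGraph.Walk.cons h q)).IsPath := by
    rw [SimpleGraph.Walk.isPath_def, SimpleGraph.Walk.support_append,
      SimpleGraph.Walk.support_cons, List.tail_cons]
    refine List.Nodup.append pp.support_nodup qp.support_nodup ?_
    intro y h1 h2
    have := side1 y h1
    have := side2 y h2
    omega
  have := congrArg Subtype.val ((hT.isAcyclic.subsingleton_path _ _).elim ⟨r, rp⟩ ⟨_, hpath⟩)
  have h5 : r.length = p.length + (q.length + 1) := by
    simp only at this
    rw [this]; simp
  omega

/-- The sides of an edge are convex. -/
lemma halfspace_convex {u v a b c : V} (h : T.Adj u v) (ha : T.dist a u < T.dist a v)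
    (hb : T.dist b u < T.dist b v) (hc : Between T a c b) : T.dist c u < T.dist c v := by
  by_contra hcon
  have hc' : T.dist c v < T.dist c u := by
    rcases dist_adj_cases hT h c with h4 | h4 <;> omega
  -- From `c`, both `a` and `b` would be reached through `u`, and the detour by `c` would be at
  -- least 2 longer than the way from `a` to `b` through `u`.
  have h1 := dist_across hT h ha hc'
  have h2 := dist_across hT h hb hc'
  have h3 := dist_tri hT a u b
  unfold Between at hc
  rw [T.dist_comm (u := b) (v := c)] at h2
  rw [T.dist_comm (u := u) (v := b)] at h3
  omega

/-- A point of a segment is determined by its distance to the origin. -/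
lemma btw_unique {x y z z' : V} (h : Between T x z y) (h' : Between T x z' y)
    (hd : T.dist x z = T.dist x z') : z = z' := by
  by_contra hne
  obtain ⟨c, hc, hcb⟩ := exists_adj_btw hT hne
  have hz' : T.dist z' c < T.dist z' z := by
    unfold Between at hcb
    rw [T.dist_comm (u := z') (v := c), T.dist_comm (u := z') (v := z)]
    have := SimpleGraph.dist_eq_one_iff_adj.2 hc
    omega
  unfold Between at h h'
  have e1 := T.dist_comm (u := z) (v := y)
  have e2 := T.dist_comm (u := z') (v := y)
  have e3 := dist_tri hT x c y
  have e4 := T.dist_comm (u := y) (v := c)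
  -- The first step from `z` towards `z'` brings closer any vertex equidistant from both. Applied to
  -- `x` and `y`, it shortens the geodesic from `x` to `y`.
  have aux : ∀ w, T.dist w z = T.dist w z' → T.dist w c < T.dist w z := by
    intro w hw
    rcases dist_adj_cases hT hc w with h4 | h4
    · omega
    · have h5 := dist_across hT hc (z := w) (w := z') (by omega) hz'
      omega
  have := aux x hd
  have := aux y (by omega)
  omega

/-- Local geodesics are geodesics. -/
lemma Between.concat {x y z w : V} (h1 : Between T x y z) (h2 : Between T y z w) (hne : y ≠ z) :
    Between T x z w := by
  obtain ⟨c, hc, hcb⟩ := exists_adj_btw hT hne.symm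
  unfold Between at *
  have d1 := SimpleGraph.dist_eq_one_iff_adj.2 hc
  have hx : T.dist x c < T.dist x z := by
    have := dist_tri hT x y c
    have e1 := T.dist_comm (u := y) (v := c)
    have e2 := T.dist_comm (u := y) (v := z)
    omega
  have hw : T.dist w z < T.dist w c := by
    rcases dist_adj_cases hT hc w with h4 | h4
    · have := dist_tri hT y c w
      have e1 := T.dist_comm (u := y) (v := c)
      have e2 := T.dist_comm (u := y) (v := z)
      have e3 := T.dist_comm (u := w) (v := c)
      have e4 := T.dist_comm (u := w) (v := z)
      omega
    · omega
  have h5 := dist_across hT hc.symm hx hw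
  rcases dist_adj_cases hT hc x with h4 | h4 <;> omega

lemma Between.concat' {x y z w : V} (h1 : Between T x y z) (h2 : Between T y z w) (hne : y ≠ z) :
    Between T x y w := by
  have h3 := h1.concat hT h2 hne
  unfold Between at *
  omega

lemma Between.trans_left {x y z w : V} (h1 : Between T x z w) (h2 : Between T x y z) : Between T x y w := by
  unfold Between at *
  have := dist_tri hT x y w
  have := dist_tri hT y z w
  omega

lemma Between.trans_right {x y z w : V} (h1 : Between T x z w) (h2 : Between T x y z) : Between T y z w := by
  unfold Between at *
  have := dist_tri hT x y w
  have := dist_tri hT y z w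
  omega

/-- Points of a segment are ordered by their distance to the origin. -/
lemma Between.of_le {x y z w : V} (h1 : Between T x y w) (h2 : Between T x z w)
    (h : T.dist x y ≤ T.dist x z) : Between T x y z := by
  obtain ⟨y', hy', hb⟩ := exists_btw hT x z h
  rwa [btw_unique hT h1 (h2.trans_left hT hb) hy'.symm]

lemma Between.mid {x y z w : V} (h1 : Between T x y w) (h2 : Between T x z w)
    (h : T.dist x y ≤ T.dist x z) : Between T y z w :=
  h2.trans_right hT (h1.of_le hT h2 h)

lemma btw_of_adj_adj {x y z : V} (h : T.Adj x y) (h' : T.Adj y z) (hne : x ≠ z) :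
    Between T x y z := by
  have e1 := SimpleGraph.dist_eq_one_iff_adj.2 h
  have e2 := SimpleGraph.dist_eq_one_iff_adj.2 h'
  have e3 := hT.connected.pos_dist_of_ne hne
  have e4 := hT.dist_ne_of_adj x h'
  have e5 := dist_tri hT x y z
  unfold Between
  omega

lemma btw_of_adj_of_lt {u v z : V} (h : T.Adj u v) (hz : T.dist z v < T.dist z u) :
    Between T u v z := by
  have e1 := SimpleGraph.dist_eq_one_iff_adj.2 h
  unfold Between
  rcases dist_adj_cases hT h z with h4 | h4
  · rw [T.dist_comm (u := v), T.dist_comm (u := u) (v := z)]; omega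
  · omega

omit hT in
lemma lt_of_btw_adj {u v z : V} (h : T.Adj u v) (hz : Between T u v z) :
    T.dist z v < T.dist z u := by
  have e1 := SimpleGraph.dist_eq_one_iff_adj.2 h
  unfold Between at hz
  rw [T.dist_comm (u := z) (v := v), T.dist_comm (u := z) (v := u)]; omega

/-! #### Convex sets, gates -/

omit hT in
/-- Convex sets of vertices. -/
def TConvex (T : SimpleGraph V) (S : Set V) : Prop := ∀ a ∈ S, ∀ b ∈ S, ∀ c, Between T a c b → c ∈ S

omit hT in
lemma TConvex.inter {S S' : Set V} (h : TConvex T S) (h' : TConvex T S') : TConvex T (S ∩ S') :=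
  fun a ha b hb c hc => ⟨h a ha.1 b hb.1 c hc, h' a ha.2 b hb.2 c hc⟩

/-- A walk between points separated by `c` meets `c`. -/
lemma mem_support_of_btw {a b c : V} (p : T.Walk a b) (hc : Between T a c b) : c ∈ p.support := by
  by_cases hac : a = c
  · subst hac; simp
  by_contra hcon
  obtain ⟨u, hu, hub⟩ := exists_adj_btw hT (Ne.symm hac)
  have ha := lt_of_btw_adj hu hub
  have hb : T.dist b c < T.dist b u := by
    refine lt_of_btw_adj hu.symm ?_
    exact hc.trans_right hT hub.symm
  -- `a` and `b` are on opposite sides of the edge between `c` and `u`, and a walk can only change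
  -- side by traversing this edge, hence by visiting `c`.
  have key : ∀ (x y : V) (q : T.Walk x y), c ∉ q.support → T.dist y c < T.dist y u →
      ¬ T.dist x u < T.dist x c := by
    intro x y q
    induction q with
    | nil => intro _ h h'; omega
    | @cons x y z h q ih =>
      intro hq hz hx
      rw [SimpleGraph.Walk.support_cons, List.mem_cons, not_or] at hq
      refine ih hq.2 hz ?_
      by_contra hy
      have hy' : T.dist y c < T.dist y u := by
        rcases dist_adj_cases hT hu y with h4 | h4 <;> omega
      have h5 := dist_across hT hu.symm hx hy'
      rw [SimpleGraph.dist_eq_one_iff_adj.2 h] at h5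
      have h6 : c = y := (tdist_eq_zero hT).1 (by omega)
      exact hq.2 (h6 ▸ q.start_mem_support)
  exact key a b p hcon hb ha

lemma convex_of_connected {S : Set V} (h : (T.induce S).Connected) : TConvex T S := by
  intro a ha b hb c hc
  obtain ⟨p⟩ := h.preconnected ⟨a, ha⟩ ⟨b, hb⟩
  have := mem_support_of_btw hT (p.map (SimpleGraph.Embedding.induce S).toHom) hc
  rw [SimpleGraph.Walk.support_map, List.mem_map] at this
  obtain ⟨x, -, rfl⟩ := this
  exact x.2

lemma connected_of_convex {S : Set V} (hS : S.Nonempty) (h : TConvex T S) :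
    (T.induce S).Connected := by
  have key : ∀ n (a b : S), T.dist a.1 b.1 = n → (T.induce S).Reachable a b := by
    intro n
    induction n with
    | zero =>
      intro a b hab
      rw [Subtype.ext ((tdist_eq_zero hT).1 hab)]
    | succ n ih =>
      intro a b hab
      have hne : a.1 ≠ b.1 := by
        intro h'; rw [(tdist_eq_zero hT).2 h'] at hab; omega
      obtain ⟨c, hc, hcb⟩ := exists_adj_btw hT hne
      have hcS := h _ a.2 _ b.2 _ hcb
      have hac : (T.induce S).Adj a ⟨c, hcS⟩ := hc
      refine hac.reachable.trans (ih ⟨c, hcS⟩ b ?_)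
      have := SimpleGraph.dist_eq_one_iff_adj.2 hc
      unfold Between at hcb
      simp only
      omega
  have : Nonempty S := hS.to_subtype
  exact ⟨fun a b => key _ a b rfl⟩

/-- The gate of `x` in the convex set `S`. -/
lemma exists_gate {S : Set V} (hS : S.Nonempty) (h : TConvex T S) (x : V) :
    ∃ g ∈ S, ∀ w ∈ S, Between T x g w := by
  obtain ⟨g, hg, hmin⟩ : ∃ g ∈ S, ∀ w ∈ S, T.dist x g ≤ T.dist x w := by
    obtain ⟨s, hs⟩ := hS
    have hne : ∃ n, ∃ g ∈ S, T.dist x g = n := ⟨_, s, hs, rfl⟩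
    classical
    obtain ⟨g, hg, hgn⟩ := Nat.find_spec hne
    exact ⟨g, hg, fun w hw => hgn ▸ Nat.find_min' hne ⟨w, hw, rfl⟩⟩
  refine ⟨g, hg, fun w hw => ?_⟩
  by_cases hgw : g = w
  · subst hgw; exact between_right _ _
  obtain ⟨c, hc, hcb⟩ := exists_adj_btw hT hgw
  -- The first step `c` from the nearest point `g` towards `w` remains in `S`, so it cannot be
  -- closer to `x`: the edge from `g` to `c` separates `x` from `w`.
  have hcS := h _ hg _ hw _ hcb
  have h1 := hmin c hcS
  have h2 : T.dist x g < T.dist x c := by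
    rcases dist_adj_cases hT hc x with h4 | h4 <;> omega
  have h3 := dist_across hT hc h2 (lt_of_btw_adj hc hcb)
  unfold Between at *
  have := SimpleGraph.dist_eq_one_iff_adj.2 hc
  omega

lemma gate_unique {S : Set V} {x g g' : V} (hg : g ∈ S) (h : ∀ w ∈ S, Between T x g w)
    (hg' : g' ∈ S) (h' : ∀ w ∈ S, Between T x g' w) : g = g' := by
  have h1 := h _ hg'
  have h2 := h' _ hg
  unfold Between at *
  exact (tdist_eq_zero hT).1 (by omega)

/-! #### Locally injective paths -/

/-- Without backtracking, three consecutive vertices are aligned, and `Between.concat` propagates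
alignment along the path. The induction carries two consecutive distances because the last edge is
needed for the next step. -/
lemma dist_of_locally_injective {p : ℕ → V} (hadj : ∀ n, T.Adj (p n) (p (n + 1)))
    (hinj : ∀ n, p n ≠ p (n + 2)) (n : ℕ) : T.dist (p 0) (p n) = n := by
  have key : ∀ n, T.dist (p 0) (p n) = n ∧ T.dist (p 0) (p (n + 1)) = n + 1 := by
    intro n
    induction n with
    | zero =>
      have := SimpleGraph.dist_eq_one_iff_adj.2 (hadj 0)
      simpa using this
    | succ n ih =>
      refine ⟨ih.2, ?_⟩
      have h1 := SimpleGraph.dist_eq_one_iff_adj.2 (hadj n)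
      have h2 := SimpleGraph.dist_eq_one_iff_adj.2 (hadj (n + 1))
      have h3 : Between T (p 0) (p n) (p (n + 1)) := by unfold Between; omega
      have h4 := h3.concat hT (btw_of_adj_adj hT (hadj n) (hadj (n + 1)) (hinj n)) (hadj n).ne
      unfold Between at h4
      omega
  exact (key n).1

lemma dist_of_locally_injective_int {p : ℤ → V} (hadj : ∀ n, T.Adj (p n) (p (n + 1)))
    (hinj : ∀ n, p n ≠ p (n + 2)) (m : ℤ) (n : ℕ) : T.dist (p m) (p (m + n)) = n := by
  have := dist_of_locally_injective hT (p := fun k : ℕ => p (m + k))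
    (fun k => by simpa [add_assoc] using hadj (m + k))
    (fun k => by simpa [add_assoc] using hinj (m + k)) n
  simpa using this

lemma injective_of_locally_injective_int {p : ℤ → V} (hadj : ∀ n, T.Adj (p n) (p (n + 1)))
    (hinj : ∀ n, p n ≠ p (n + 2)) : Function.Injective p := by
  intro a b hab
  wlog hle : a ≤ b generalizing a b
  · exact (this hab.symm (by omega)).symm
  have := dist_of_locally_injective_int hT hadj hinj a (b - a).toNat
  rw [Int.toNat_of_nonneg (by omega), add_sub_cancel, (tdist_eq_zero hT).2 hab] at this
  omega

lemma Geod.dist_eq (l : Geod T) (m : ℤ) (n : ℕ) : T.dist (l.vert m) (l.vert (m + n)) = n :=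
  dist_of_locally_injective_int hT l.adj (fun n h => by have := l.inj h; omega) m n

lemma Geod.dist_eq' (l : Geod T) {m n : ℤ} (h : m ≤ n) :
    (T.dist (l.vert m) (l.vert n) : ℤ) = n - m := by
  have := Geod.dist_eq hT l m (n - m).toNat
  rw [Int.toNat_of_nonneg (by omega), add_sub_cancel] at this
  omega

lemma Geod.btw (l : Geod T) {i j k : ℤ} (h : i ≤ j) (h' : j ≤ k) :
    Between T (l.vert i) (l.vert j) (l.vert k) := by
  have h1 := Geod.dist_eq' hT l h
  have h2 := Geod.dist_eq' hT l h'
  have h3 := Geod.dist_eq' hT l (h.trans h')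
  unfold Between
  omega

lemma GeodRay.dist_eq (r : GeodRay T) (m n : ℕ) : T.dist (r.vert m) (r.vert (m + n)) = n := by
  have := dist_of_locally_injective hT (p := fun k => r.vert (m + k)) (fun k => r.adj (m + k))
    (fun k h => by have := r.inj h; omega) n
  simpa using this

lemma GeodRay.btw (r : GeodRay T) {i j k : ℕ} (h : i ≤ j) (h' : j ≤ k) :
    Between T (r.vert i) (r.vert j) (r.vert k) := by
  obtain ⟨a, rfl⟩ := Nat.exists_eq_add_of_le h
  obtain ⟨b, rfl⟩ := Nat.exists_eq_add_of_le h'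
  unfold Between
  have := GeodRay.dist_eq hT r i (a + b)
  rw [GeodRay.dist_eq hT, GeodRay.dist_eq hT, add_assoc, this]

/-! #### Bi-infinite geodesics through a sequence of points -/

omit hT in
open Classical in
/-- The point at distance `k` from `x` on the segment from `x` to `y`. -/
noncomputable def segPoint (T : SimpleGraph V) (x y : V) (k : ℕ) : V :=
  if h : ∃ z, T.dist x z = k ∧ Between T x z y then h.choose else x

lemma segPoint_spec {x y : V} {k : ℕ} (hk : k ≤ T.dist x y) :
    T.dist x (segPoint T x y k) = k ∧ Between T x (segPoint T x y k) y := by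
  have h := exists_btw hT x y hk
  rw [segPoint, dif_pos h]
  exact h.choose_spec

lemma segPoint_eq {x y z : V} (h : Between T x z y) : segPoint T x y (T.dist x z) = z := by
  have := segPoint_spec hT (x := x) (y := y) (k := T.dist x z) (by unfold Between at h; omega)
  exact btw_unique hT this.2 h this.1

omit hT in
/-- A sequence of points every one of which separates its neighbors. -/
def IsChainPts (T : SimpleGraph V) (p : ℤ → V) : Prop :=
  ∀ j, p j ≠ p (j + 1) ∧ Between T (p j) (p (j + 1)) (p (j + 2))

lemma IsChainPts.btw_succ {p : ℤ → V} (h : IsChainPts T p) (i : ℤ) (n : ℕ) :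
    Between T (p i) (p (i + n)) (p (i + n + 1)) := by
  induction n with
  | zero => simpa using between_left _ _
  | succ n ih =>
    have := ih.concat hT (w := p (i + n + 2)) (h (i + n)).2 (h (i + n)).1
    push_cast
    convert this using 2 <;> ring

lemma IsChainPts.btw {p : ℤ → V} (h : IsChainPts T p) {i j k : ℤ} (hij : i ≤ j) (hjk : j ≤ k) :
    Between T (p i) (p j) (p k) := by
  obtain ⟨n, rfl⟩ := Int.le.dest hjk
  clear hjk
  induction n with
  | zero => simpa using between_right _ _
  | succ n ih =>
    have h1 := h.btw_succ hT i (j - i + n).toNat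
    rw [Int.toNat_of_nonneg (by omega)] at h1
    have h2 : Between T (p i) (p (j + n)) (p (j + n + 1)) := by convert h1 using 2 <;> ring
    have := h2.trans_left hT ih
    push_cast
    convert this using 2
    ring

lemma IsChainPts.le_dist {p : ℤ → V} (h : IsChainPts T p) (i : ℤ) (n : ℕ) :
    n ≤ T.dist (p i) (p (i + n)) := by
  induction n with
  | zero => simp
  | succ n ih =>
    have h1 := h.btw_succ hT i n
    have h2 := hT.connected.pos_dist_of_ne (h (i + n)).1
    unfold Between at h1
    push_cast
    rw [← add_assoc]
    omega

lemma IsChainPts.natAbs_le_dist {p : ℤ → V} (h : IsChainPts T p) (n : ℤ) :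
    n.natAbs ≤ T.dist (p 0) (p n) := by
  rcases le_total 0 n with hn | hn
  · have := h.le_dist hT 0 n.natAbs
    rwa [zero_add, Int.natAbs_of_nonneg hn] at this
  · have := h.le_dist hT n n.natAbs
    rwa [show n + n.natAbs = 0 by omega, T.dist_comm] at this

omit hT in
/-- The vertices of the geodesic with origin `p 0` through the points `p j`. -/
noncomputable def lineVert (T : SimpleGraph V) (p : ℤ → V) (n : ℤ) : V :=
  -- By `IsChainPts.natAbs_le_dist` the segment from `p 0` to `p n` has at least `|n|` edges. Aiming
  -- at `p n` makes this vertex depend on `p 0` and `p n` only, whence the continuity of lifts.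
  segPoint T (p 0) (p n) n.natAbs

/-- If a sequence passes through the points `p j` isometrically, it is `lineVert T p`. -/
lemma lineVert_eq {p : ℤ → V} {l : Geod T} {s : ℤ → ℤ} (hs : StrictMono s) (hs0 : s 0 = 0)
    (hl : ∀ j, l.vert (s j) = p j) (n : ℤ) : lineVert T p n = l.vert n := by
  have hsn : ∀ n : ℕ, (n : ℤ) ≤ s n := by
    intro n
    induction n with
    | zero => simp [hs0]
    | succ n ih => have := hs (show (n : ℤ) < n + 1 by omega); push_cast; omega
  have hsn' : ∀ n : ℕ, s (-(n : ℤ)) ≤ -(n : ℤ) := by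
    intro n
    induction n with
    | zero => simp [hs0]
    | succ n ih => have := hs (show -(n : ℤ) - 1 < -(n : ℤ) by omega)
                   push_cast
                   rw [show -((n : ℤ) + 1) = -(n : ℤ) - 1 by ring]; omega
  have h0 : p 0 = l.vert 0 := by rw [← hl 0, hs0]
  unfold lineVert
  rw [h0, ← hl n]
  rcases le_total 0 n with hn | hn
  · have h1 : n ≤ s n := by have := hsn n.toNat; rwa [Int.toNat_of_nonneg hn] at this
    have := segPoint_eq hT (Geod.btw hT l hn h1)
    have h2 := Geod.dist_eq' hT l hn
    rwa [show T.dist (l.vert 0) (l.vert n) = n.natAbs by omega] at this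
  · have h1 : s n ≤ n := by
      have := hsn' (-n).toNat; rwa [Int.toNat_of_nonneg (by omega), neg_neg] at this
    have := segPoint_eq hT (Geod.btw hT l h1 hn).symm
    have h2 := Geod.dist_eq' hT l hn
    rw [T.dist_comm] at h2
    rwa [show T.dist (l.vert 0) (l.vert n) = n.natAbs by omega] at this

lemma IsChainPts.segPoint_of_le {p : ℤ → V} (h : IsChainPts T p) {m n : ℤ}
    (hm : 0 ≤ m) (hmn : m ≤ n) {k : ℕ} (hk : k ≤ T.dist (p 0) (p m)) :
    segPoint T (p 0) (p m) k = segPoint T (p 0) (p n) k := by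
  have h1 := segPoint_spec hT hk
  have h2 := segPoint_eq hT ((h.btw hT hm hmn).trans_left hT h1.2)
  rw [← h2, h1.1]

lemma IsChainPts.segPoint_of_ge {p : ℤ → V} (h : IsChainPts T p) {m n : ℤ}
    (hm : m ≤ 0) (hmn : n ≤ m) {k : ℕ} (hk : k ≤ T.dist (p 0) (p m)) :
    segPoint T (p 0) (p m) k = segPoint T (p 0) (p n) k := by
  have h1 := segPoint_spec hT hk
  have h2 := segPoint_eq hT ((h.btw hT hmn hm).symm.trans_left hT h1.2)
  rw [← h2, h1.1]

lemma dist_of_btw_of_le {x y z w : V} (h1 : Between T x y w) (h2 : Between T x z w)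
    (h : T.dist x y ≤ T.dist x z) : T.dist y z = T.dist x z - T.dist x y := by
  have := h1.of_le hT h2 h
  unfold Between at this
  omega

/-- Isometry of `lineVert`. -/
lemma IsChainPts.lineVert_dist {p : ℤ → V} (h : IsChainPts T p) {m n : ℤ} (hmn : m ≤ n) :
    (T.dist (lineVert T p m) (lineVert T p n) : ℤ) = n - m := by
  have pos : ∀ {m n : ℤ}, 0 ≤ m → m ≤ n →
      (T.dist (lineVert T p m) (lineVert T p n) : ℤ) = n - m := by
    intro m n hm hmn
    have e := h.segPoint_of_le hT hm hmn (h.natAbs_le_dist hT m)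
    have a1 := segPoint_spec hT (h.natAbs_le_dist hT n)
    have a2 := segPoint_spec hT (x := p 0) (y := p n) (k := m.natAbs)
      (by have := h.natAbs_le_dist hT n; omega)
    unfold lineVert
    rw [e, dist_of_btw_of_le hT a2.2 a1.2 (by omega)]
    omega
  have neg : ∀ {m n : ℤ}, n ≤ 0 → m ≤ n →
      (T.dist (lineVert T p m) (lineVert T p n) : ℤ) = n - m := by
    intro m n hm hmn
    have e := h.segPoint_of_ge hT hm hmn (h.natAbs_le_dist hT n)
    have a1 := segPoint_spec hT (h.natAbs_le_dist hT m)
    have a2 := segPoint_spec hT (x := p 0) (y := p m) (k := n.natAbs)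
      (by have := h.natAbs_le_dist hT m; omega)
    unfold lineVert
    rw [e, T.dist_comm, dist_of_btw_of_le hT a2.2 a1.2 (by omega)]
    omega
  rcases le_total 0 m with hm | hm
  · exact pos hm hmn
  rcases le_total n 0 with hn | hn
  · exact neg hn hmn
  have b := h.btw hT hm hn
  -- When `0` is between `m` and `n`, the two vertices are on opposite sides of `p 0` and their
  -- distances to it add up.
  have a1 := segPoint_spec hT (h.natAbs_le_dist hT m)
  have a2 := segPoint_spec hT (h.natAbs_le_dist hT n)
  have b1 := b.trans_right hT a1.2.symm
  have b3 : Between T (lineVert T p m) (p 0) (lineVert T p n) := by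
    have c := b1.symm.trans_right hT a2.2.symm
    exact c.symm
  unfold Between at b3
  rw [T.dist_comm (u := lineVert T p m) (v := p 0)] at b3
  unfold lineVert at *
  omega

/-- The geodesic with origin `p 0` through the points `p j`. -/
noncomputable def IsChainPts.line {p : ℤ → V} (h : IsChainPts T p) : Geod T where
  vert := lineVert T p
  adj n := by
    have := h.lineVert_dist hT (show n ≤ n + 1 by omega)
    exact SimpleGraph.dist_eq_one_iff_adj.1 (by omega)
  inj a b hab := by
    wlog hle : a ≤ b generalizing a b
    · exact (this b a hab.symm (by omega)).symm
    have := h.lineVert_dist hT hle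
    rw [hab, T.dist_self] at this
    push_cast at this
    omega

/-- The line passes through the given points, in order. -/
lemma IsChainPts.exists_times {p : ℤ → V} (h : IsChainPts T p) :
    ∃ s : ℤ → ℤ, StrictMono s ∧ s 0 = 0 ∧ ∀ j, (h.line hT).vert (s j) = p j := by
  -- The time of passage at `p j` is the signed distance from `p 0`.
  refine ⟨fun j => if 0 ≤ j then T.dist (p 0) (p j) else -T.dist (p 0) (p j), ?_, by simp, ?_⟩
  · refine strictMono_int_of_lt_succ fun j => ?_
    have hpos := hT.connected.pos_dist_of_ne (h j).1
    rcases lt_trichotomy j (-1) with hj | hj | hj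
    · have := h.btw hT (show j ≤ j + 1 by omega) (show j + 1 ≤ 0 by omega)
      rw [if_neg (by omega), if_neg (by omega)]
      unfold Between at this
      rw [T.dist_comm (u := p 0) (v := p j), T.dist_comm (u := p 0) (v := p (j + 1))]
      omega
    · subst hj
      simp only [neg_add_cancel] at hpos
      rw [T.dist_comm] at hpos
      simpa using hpos
    · have := h.btw hT (show 0 ≤ j by omega) (show j ≤ j + 1 by omega)
      rw [if_pos (by omega), if_pos (by omega)]
      unfold Between at this
      omega
  · intro j
    have hj := h.natAbs_le_dist hT j
    have hle : ∀ j : ℤ, 0 ≤ j → (h.line hT).vert (T.dist (p 0) (p j)) = p j := by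
      intro j hj
      have h0 := h.natAbs_le_dist hT j
      have h1 := h.natAbs_le_dist hT (T.dist (p 0) (p j))
      have h2 := h.segPoint_of_le hT hj (n := T.dist (p 0) (p j)) (by omega) le_rfl
      rw [segPoint_eq hT (between_right _ _)] at h2
      exact h2.symm
    have hge : ∀ j : ℤ, j ≤ 0 → (h.line hT).vert (-T.dist (p 0) (p j)) = p j := by
      intro j hj
      have h0 := h.natAbs_le_dist hT j
      have h2 := h.segPoint_of_ge hT hj (n := -T.dist (p 0) (p j)) (by omega) le_rfl
      rw [segPoint_eq hT (between_right _ _)] at h2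
      change segPoint _ _ _ _ = _
      rw [Int.natAbs_neg, Int.natAbs_natCast]
      exact h2.symm
    dsimp only
    split_ifs with h'
    · exact hle j h'
    · exact hge j (by omega)

lemma IsChainPts.line_unique {p : ℤ → V} (h : IsChainPts T p) {l : Geod T} {s : ℤ → ℤ}
    (hs : StrictMono s) (hs0 : s 0 = 0) (hl : ∀ j, l.vert (s j) = p j) : h.line hT = l :=
  Geod.ext (funext fun n => lineVert_eq hT hs hs0 hl n)

end TreeMetric


/-! ### The minimal invariant subtree -/

section MinSubtree

variable {V : Type u} {T : SimpleGraph V} {Γ : Type w} [Group Γ] (ρ : Γ →* (T ≃g T))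

@[simp] lemma inv_act (γ : Γ) (v : V) : ρ γ⁻¹ (ρ γ v) = v := by
  rw [← RelIso.mul_apply, ← map_mul]; simp

@[simp] lemma act_inv (γ : Γ) (v : V) : ρ γ (ρ γ⁻¹ v) = v := by
  rw [← RelIso.mul_apply, ← map_mul]; simp

lemma act_mul (γ η : Γ) (v : V) : ρ (γ * η) v = ρ γ (ρ η v) := by
  rw [map_mul, RelIso.mul_apply]

lemma act_adj {γ : Γ} {a b : V} : T.Adj (ρ γ a) (ρ γ b) ↔ T.Adj a b := (ρ γ).map_rel_iff

/-- The nonempty invariant subtrees. -/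
def InvSubtree : Set (Set V) :=
  {S | (∀ γ, ∀ v ∈ S, ρ γ v ∈ S) ∧ S.Nonempty ∧ TConvex T S}

variable (hT : T.IsTree)
include hT

/-- In a tree, nonempty convex sets of vertices are the connected ones; convexity is the form that
passes to intersections. -/
lemma mem_minSubtree {v : V} : v ∈ minSubtree ρ ↔ ∀ S ∈ InvSubtree ρ, v ∈ S := by
  refine ⟨fun h S hS => h S ⟨hS.1, connected_of_convex hT hS.2.1 hS.2.2⟩, fun h S hS =>
    h S ⟨hS.1, ?_, convex_of_connected hT hS.2⟩⟩
  obtain ⟨x⟩ := hS.2.nonempty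
  exact ⟨x.1, x.2⟩

lemma min_act (γ : Γ) {v : V} (hv : v ∈ minSubtree ρ) : ρ γ v ∈ minSubtree ρ := by
  rw [mem_minSubtree ρ hT] at *
  exact fun S hS => hS.1 γ v (hv S hS)

lemma min_convex : TConvex T (minSubtree ρ) := by
  intro a ha b hb c hc
  rw [mem_minSubtree ρ hT] at *
  exact fun S hS => hS.2.2 a (ha S hS) b (hb S hS) c hc

/-- Every half-tree with extremal vertex in the minimal subtree meets every orbit. -/
lemma exists_act_mem_halfspace {u v : V} (h : T.Adj u v) (hv : v ∈ minSubtree ρ) (x : V) :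
    ∃ γ, T.dist (ρ γ x) v < T.dist (ρ γ x) u := by
  by_contra hcon
  push Not at hcon
  -- The intersection of all half-trees containing the orbit of `x` is an invariant subtree, so it
  -- contains `v`. If the whole orbit were on the side of `u`, this would put `v` strictly closer to
  -- `u` than to itself.
  have hS : {c | ∀ a b, T.Adj a b → (∀ γ, T.dist (ρ γ x) a < T.dist (ρ γ x) b) →
      T.dist c a < T.dist c b} ∈ InvSubtree ρ := by
    refine ⟨?_, ⟨x, fun a b _ h => by simpa using h 1⟩, ?_⟩
    · intro γ c hc a b hab hall
      have := hc (ρ γ⁻¹ a) (ρ γ⁻¹ b) ((act_adj ρ).2 hab) (fun η => by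
        have h1 := hall (γ * η)
        rw [act_mul] at h1
        have h2 := dist_map (ρ γ) (ρ η x) (ρ γ⁻¹ a)
        have h3 := dist_map (ρ γ) (ρ η x) (ρ γ⁻¹ b)
        rw [act_inv] at h2 h3
        omega)
      have h2 := dist_map (ρ γ) c (ρ γ⁻¹ a)
      have h3 := dist_map (ρ γ) c (ρ γ⁻¹ b)
      rw [act_inv] at h2 h3
      omega
    · intro c hc c' hc' d hd a b hab hall
      exact halfspace_convex hT hab (hc a b hab hall) (hc' a b hab hall) hd
  have := (mem_minSubtree ρ hT).1 hv _ hS u v h (fun γ => by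
    have := hcon γ
    rcases dist_adj_cases hT h (ρ γ x) with h4 | h4 <;> omega)
  simp at this

omit hT in
lemma IsNonElementary.exists_act_ne (hne : IsNonElementary ρ) (v : V) : ∃ γ, ρ γ v ≠ v := by
  obtain ⟨γ, hγ⟩ := hne (Sum.inl v) (Sum.inl v)
  refine ⟨γ, fun h => hγ ?_⟩
  simp [h]

omit hT in
lemma IsNonElementary.exists_act_end_ne (hne : IsNonElementary ρ) (ξ : Bdry T) :
    ∃ γ, Bdry.map (ρ γ) ξ ≠ ξ := by
  obtain ⟨γ, hγ⟩ := hne (Sum.inr ξ) (Sum.inr ξ)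
  refine ⟨γ, fun h => hγ ?_⟩
  simp [h]

/-- The minimal subtree has no terminal vertex. -/
lemma min_no_leaf (hinv : NoInversion ρ) {u v : V} (hu : u ∈ minSubtree ρ)
    (hv : v ∈ minSubtree ρ) (h : T.Adj u v) : ∃ w ∈ minSubtree ρ, T.Adj v w ∧ w ≠ u := by
  by_contra hcon
  push Not at hcon
  -- If `v` is terminal, the only vertex of the minimal subtree beyond a translate of the edge is
  -- the translate of `v`.
  have key : ∀ γ, ∀ z ∈ minSubtree ρ, T.dist z (ρ γ v) < T.dist z (ρ γ u) → z = ρ γ v := by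
    intro γ z hz hlt
    by_contra hzv
    obtain ⟨w, hw, hb⟩ := exists_adj_btw hT (Ne.symm hzv)
    have hwM := min_convex ρ hT _ (min_act ρ hT γ hv) _ hz _ hb
    have h1 := hcon (ρ γ⁻¹ w) (min_act ρ hT _ hwM) (by
      have := (act_adj ρ (γ := γ⁻¹)).2 hw
      rwa [inv_act] at this)
    rw [← h1, act_inv] at hlt
    unfold Between at hb
    have := SimpleGraph.dist_eq_one_iff_adj.2 hw
    rw [T.dist_comm (u := z), T.dist_comm (u := z)] at hlt
    omega
  -- Some translate of `u` lies beyond the edge, so it is `v`. Comparing `v` with the edge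
  -- translated by `γ⁻¹`, which ends at `γ⁻¹ v = u`, gives either `v = u` or an inversion.
  obtain ⟨γ, hγ⟩ := exists_act_mem_halfspace ρ hT h hv u
  have h1 : ρ γ u = v := by
    simpa using key 1 (ρ γ u) (min_act ρ hT γ hu) (by simpa using hγ)
  by_cases h2 : T.dist v (ρ γ⁻¹ v) < T.dist v (ρ γ⁻¹ u)
  · have := key γ⁻¹ v hv h2
    rw [← h1, inv_act, h1] at this
    exact h.ne this.symm
  · have h3 : ρ γ⁻¹ v = u := by rw [← h1, inv_act]
    rw [h3] at h2
    have e1 := SimpleGraph.dist_eq_one_iff_adj.2 h.symm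
    have h4 : T.Adj (ρ γ⁻¹ u) u := by
      have := (act_adj ρ (γ := γ⁻¹)).2 h
      rwa [h3] at this
    have h5 : T.dist v (ρ γ⁻¹ u) = 0 := by
      rcases dist_adj_cases hT h4 v with h5 | h5 <;> omega
    have h6 := (tdist_eq_zero hT).1 h5
    refine hinv γ u v h ⟨h1, ?_⟩
    rw [h6, act_inv]

/-! #### Nonemptiness of the minimal subtree -/

lemma finite_ball (hlf : ∀ v, (T.neighborSet v).Finite) (x : V) (n : ℕ) :
    {v | T.dist x v ≤ n}.Finite := by
  induction n with
  | zero =>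
    refine (finite_singleton x).subset fun v hv => ?_
    exact ((tdist_eq_zero hT).1 (Nat.le_zero.1 hv)).symm
  | succ n ih =>
    refine (ih.union (ih.biUnion fun v _ => hlf v)).subset fun v hv => ?_
    by_cases h : T.dist x v ≤ n
    · exact Or.inl h
    right
    have hv' : T.dist x v = n + 1 := by
      have : T.dist x v ≤ n + 1 := hv
      omega
    obtain ⟨z, hz, hb⟩ := exists_btw hT x v (k := n) (by omega)
    unfold Between at hb
    exact mem_biUnion (x := z) hz.le (SimpleGraph.dist_eq_one_iff_adj.1 (by omega))

lemma countable_vertices (hlf : ∀ v, (T.neighborSet v).Finite) : Countable V := by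
  obtain ⟨x⟩ := hT.connected.nonempty
  have : (univ : Set V) = ⋃ n : ℕ, {v | T.dist x v ≤ n} := by
    ext v; simp only [mem_univ, mem_iUnion, true_iff]; exact ⟨T.dist x v, le_refl (T.dist x v)⟩
  rw [← countable_univ_iff, this]
  exact countable_iUnion fun n => (finite_ball hT hlf x n).countable

/-- Two disjoint invariant subtrees would be joined by a unique shortest bridge, from `s` to `t`. It
would be preserved, so `s` would be a global fixed vertex, which non-elementarity excludes. -/
lemma InvSubtree.inter (hne : IsNonElementary ρ) {S S' : Set V} (hS : S ∈ InvSubtree ρ)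
    (hS' : S' ∈ InvSubtree ρ) : S ∩ S' ∈ InvSubtree ρ := by
  refine ⟨fun γ v hv => ⟨hS.1 γ v hv.1, hS'.1 γ v hv.2⟩, ?_, hS.2.2.inter hS'.2.2⟩
  by_contra hemp
  obtain ⟨x, hx⟩ := hS.2.1
  obtain ⟨t, ht, htg⟩ := exists_gate hT hS'.2.1 hS'.2.2 x
  obtain ⟨s, hs, hsg⟩ := exists_gate hT hS.2.1 hS.2.2 t
  have hst : s ≠ t := fun h => hemp ⟨s, hs, h ▸ ht⟩
  -- `t` is also the gate of `s`
  have hsx : Between T x s t := (hsg x hx).symm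
  have htg' : ∀ w ∈ S', Between T s t w := fun w hw => (htg w hw).trans_right hT hsx
  have hdist : ∀ a ∈ S, ∀ b ∈ S', T.dist a b = T.dist a s + T.dist s t + T.dist t b := by
    intro a ha b hb
    have h1 := (hsg a ha).symm
    have h2 := h1.concat hT (htg' b hb) hst
    unfold Between at h1 h2
    omega
  obtain ⟨γ, hγ⟩ := IsNonElementary.exists_act_ne ρ hne s
  have h1 := hdist _ (hS.1 γ s hs) _ (hS'.1 γ t ht)
  rw [dist_map] at h1
  exact hγ ((tdist_eq_zero hT).1 (by omega))

lemma univ_mem_invSubtree : (univ : Set V) ∈ InvSubtree ρ := by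
  obtain ⟨x⟩ := hT.connected.nonempty
  exact ⟨fun _ _ _ => mem_univ _, ⟨x, mem_univ _⟩, fun _ _ _ _ _ _ => mem_univ _⟩

/-- Each vertex is missed by some invariant subtree, and finite intersections are again invariant
subtrees by `InvSubtree.inter`. -/
lemma exists_invSubtree_disjoint (hne : IsNonElementary ρ) (hemp : minSubtree ρ = ∅)
    {F : Set V} (hF : F.Finite) : ∃ S ∈ InvSubtree ρ, ∀ v ∈ S, v ∉ F := by
  induction F, hF using Set.Finite.induction_on with
  | empty => exact ⟨univ, univ_mem_invSubtree ρ hT, fun _ _ h => h⟩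
  | @insert a F _ _ ih =>
    obtain ⟨S, hS, h⟩ := ih
    have ha : a ∉ minSubtree ρ := by simp [hemp]
    rw [mem_minSubtree ρ hT] at ha
    push Not at ha
    obtain ⟨S', hS', h'⟩ := ha
    refine ⟨S ∩ S', InvSubtree.inter ρ hT hne hS hS', fun v hv hvF => ?_⟩
    rcases hvF with rfl | hvF
    · exact h' hv.2
    · exact h v hv.1 hvF

omit hT in
/-- The vertices separating `x` from some invariant subtree. -/
def TowardMin (x v : V) : Prop := ∃ S ∈ InvSubtree ρ, ∀ w ∈ S, Between T x v w

omit hT in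
lemma TowardMin.act {x v : V} (h : TowardMin ρ x v) (γ : Γ) :
    TowardMin ρ (ρ γ x) (ρ γ v) := by
  obtain ⟨S, hS, h⟩ := h
  refine ⟨S, hS, fun w hw => ?_⟩
  have := (h _ (hS.1 γ⁻¹ w hw)).map (ρ γ)
  rwa [act_inv] at this

lemma TowardMin.unique (hne : IsNonElementary ρ) {x v v' : V} (h : TowardMin ρ x v)
    (h' : TowardMin ρ x v') (hd : T.dist x v = T.dist x v') : v = v' := by
  obtain ⟨S, hS, h⟩ := h
  obtain ⟨S', hS', h'⟩ := h'
  obtain ⟨w, hw, hw'⟩ := (InvSubtree.inter ρ hT hne hS hS').2.1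
  exact btw_unique hT (h w hw) (h' w hw') hd

lemma exists_towardMin (hlf : ∀ v, (T.neighborSet v).Finite) (hne : IsNonElementary ρ)
    (hemp : minSubtree ρ = ∅) (x : V) (n : ℕ) : ∃ v, TowardMin ρ x v ∧ T.dist x v = n := by
  obtain ⟨S, hS, h⟩ := exists_invSubtree_disjoint ρ hT hne hemp (finite_ball hT hlf x n)
  obtain ⟨g, hg, hgate⟩ := exists_gate hT hS.2.1 hS.2.2 x
  have h1 := h g hg
  obtain ⟨v, hv, hb⟩ := exists_btw hT x g (k := n) (by
    rw [mem_ofPred_eq] at h1; omega)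
  exact ⟨v, ⟨S, hS, fun w hw => (hgate w hw).trans_left hT hb⟩, hv⟩

lemma exists_ray_towardMin (hlf : ∀ v, (T.neighborSet v).Finite) (hne : IsNonElementary ρ)
    (hemp : minSubtree ρ = ∅) (x : V) :
    ∃ r : GeodRay T, ∀ n, TowardMin ρ x (r.vert n) ∧ T.dist x (r.vert n) = n := by
  choose r hr using exists_towardMin ρ hT hlf hne hemp x
  refine ⟨⟨r, fun n => ?_, fun a b hab => ?_⟩, hr⟩
  · obtain ⟨z, hz, hb⟩ := exists_btw hT x (r (n + 1)) (k := n) (by rw [(hr _).2]; omega)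
    have h1 : TowardMin ρ x z := by
      obtain ⟨S, hS, h⟩ := (hr (n + 1)).1
      exact ⟨S, hS, fun w hw => (h w hw).trans_left hT hb⟩
    rw [TowardMin.unique ρ hT hne (hr n).1 h1 (by rw [hz, (hr n).2])]
    refine SimpleGraph.dist_eq_one_iff_adj.1 ?_
    unfold Between at hb
    have := (hr (n + 1)).2
    omega
  · rw [← (hr a).2, hab, (hr b).2]

/-- If the invariant subtrees had empty intersection, they would recede to infinity by local
finiteness. The rays from all vertices towards them would converge to one common end, fixed by the
group. -/
lemma min_nonempty (hlf : ∀ v, (T.neighborSet v).Finite) (hne : IsNonElementary ρ) :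
    (minSubtree ρ).Nonempty := by
  by_contra hemp
  rw [not_nonempty_iff_eq_empty] at hemp
  choose r hr using exists_ray_towardMin ρ hT hlf hne hemp
  have hend : ∀ x y, (r x).endpoint = (r y).endpoint := by
    intro x y
    -- Missing the ball of radius `d(x, y)` about `x` forces `x` and `y` to have the same gate in
    -- `S`: otherwise the segment from `x` to `y` would reach `S`. Beyond the common gate the two
    -- rays agree.
    obtain ⟨S, hS, h⟩ := exists_invSubtree_disjoint ρ hT hne hemp
      (finite_ball hT hlf x (T.dist x y))
    obtain ⟨g, hg, hgate⟩ := exists_gate hT hS.2.1 hS.2.2 x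
    obtain ⟨g', hg', hgate'⟩ := exists_gate hT hS.2.1 hS.2.2 y
    have hgg : g = g' := by
      by_contra hgg
      have h1 := ((hgate g' hg').concat' hT (hgate' g hg).symm hgg)
      have h2 := h g hg
      unfold Between at h1
      rw [mem_ofPred_eq] at h2
      omega
    subst hgg
    refine Quotient.sound ⟨T.dist x g, T.dist y g, fun k => ?_⟩
    set v := (r x).vert (T.dist x g + k) with hv
    obtain ⟨hv1, hv2⟩ := hr x (T.dist x g + k)
    rw [← hv] at hv1 hv2
    have key : TowardMin ρ y v ∧ T.dist y v = T.dist y g + k := by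
      obtain ⟨S', hS', h'⟩ := hv1
      have hall : ∀ w ∈ S ∩ S', Between T y v w ∧ T.dist y v = T.dist y g + k := by
        intro w hw
        have h1 := hgate w hw.1
        have h2 := h' w hw.2
        have h3 := h1.of_le hT h2 (by omega)
        have h4 := h1.mid hT h2 (by omega)
        have h5 := hgate' w hw.1
        have t1 := dist_tri hT y v w
        have t2 := dist_tri hT y g v
        unfold Between at *
        omega
      refine ⟨⟨S ∩ S', InvSubtree.inter ρ hT hne hS hS', fun w hw => (hall w hw).1⟩, ?_⟩
      obtain ⟨w, hw⟩ := (InvSubtree.inter ρ hT hne hS hS').2.1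
      exact (hall w hw).2
    exact TowardMin.unique ρ hT hne key.1 (hr y _).1 (by rw [key.2, (hr y _).2])
  obtain ⟨x⟩ := hT.connected.nonempty
  obtain ⟨γ, hγ⟩ := IsNonElementary.exists_act_end_ne ρ hne (r x).endpoint
  refine hγ ?_
  rw [hend x (ρ γ x)]
  refine (congrArg (Bdry.map (ρ γ)) (hend x (ρ γ x))).symm.trans ?_
  refine Quotient.sound ⟨0, 0, fun k => ?_⟩
  change ρ γ ((r x).vert (0 + k)) = (r (ρ γ x)).vert (0 + k)
  refine TowardMin.unique ρ hT hne ((hr x _).1.act ρ γ) (hr _ _).1 ?_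
  rw [dist_map, (hr x _).2, (hr _ _).2]

end MinSubtree


/-! ### Horoballs over the cuspidal rays -/

section Horoballs

variable {V : Type u} {T : SimpleGraph V} {Γ : Type w} [Group Γ] {ρ : Γ →* (T ≃g T)}

/-- Non-elementary actions without inversion on a locally finite tree. -/
structure IsNonElementaryAction (ρ : Γ →* (T ≃g T)) : Prop where
  tree : T.IsTree
  finite_nbrs : ∀ v, (T.neighborSet v).Finite
  noInversion : NoInversion ρ
  nonElementary : IsNonElementary ρ

lemma projVertex_eq_iff {v w : V} : projVertex ρ v = projVertex ρ w ↔ ∃ γ, ρ γ v = w :=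
  Quotient.eq (r := vertexSetoid ρ)

lemma projEdge_eq_iff {d e : T.Dart} :
    projEdge ρ d = projEdge ρ e ↔ ∃ γ, ρ γ d.fst = e.fst ∧ ρ γ d.snd = e.snd :=
  Quotient.eq (r := edgeSetoid ρ)

lemma projVertex_act (γ : Γ) (v : V) : projVertex ρ (ρ γ v) = projVertex ρ v :=
  projVertex_eq_iff.2 ⟨γ⁻¹, inv_act ρ γ v⟩

lemma origin_bar (e : QuotEdge ρ) : e.bar.origin = e.target := by
  induction e using Quotient.inductionOn; rfl

lemma target_bar (e : QuotEdge ρ) : e.bar.target = e.origin := by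
  induction e using Quotient.inductionOn; rfl

variable (D : CuspidalDecomposition ρ)

/-- The vertices over the `n`-th interior vertex of the `i`-th ray. -/
def AtLevel (i : Fin D.numRays) (n : ℕ) (v : V) : Prop :=
  v ∈ minSubtree ρ ∧ projVertex ρ v = (D.ray i n).target

/-- The neighbor of a vertex of a horoball in the direction of the point at infinity. -/
noncomputable def up (v : V) : V :=
  open Classical in
  if h : ∃ w, T.Adj v w ∧ ∃ i n, AtLevel D i n v ∧ AtLevel D i (n + 1) w then h.choose else v

/-- The two vertices lie in the same horoball. -/
def HConn (v w : V) : Prop := ∃ p : T.Walk v w, ∀ x ∈ p.support, x ∈ D.horo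

variable {D}

lemma mem_horo_iff {v : V} : v ∈ D.horo ↔ ∃ i n, AtLevel D i n v := by
  simp only [CuspidalDecomposition.horo, AtLevel, mem_ofPred_eq]
  constructor
  · rintro ⟨h, i, n, h'⟩; exact ⟨i, n, h, h'⟩
  · rintro ⟨i, n, h, h'⟩; exact ⟨h, i, n, h'⟩

lemma AtLevel.mem_horo {i : Fin D.numRays} {n : ℕ} {v : V} (h : AtLevel D i n v) : v ∈ D.horo :=
  mem_horo_iff.2 ⟨i, n, h⟩

lemma horo_subset {v : V} (h : v ∈ D.horo) : v ∈ minSubtree ρ := h.1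

lemma AtLevel.unique {i j : Fin D.numRays} {n m : ℕ} {v : V} (h : AtLevel D i n v)
    (h' : AtLevel D j m v) : i = j ∧ n = m := by
  have := D.interior_injective (a₁ := (i, n)) (a₂ := (j, m)) (h.2.symm.trans h'.2)
  simpa using this

lemma HConn.refl {v : V} (h : v ∈ D.horo) : HConn D v v := ⟨SimpleGraph.Walk.nil, by simpa⟩

lemma HConn.symm {v w : V} (h : HConn D v w) : HConn D w v := by
  obtain ⟨p, hp⟩ := h
  exact ⟨p.reverse, by simpa using hp⟩

lemma HConn.trans {v w x : V} (h : HConn D v w) (h' : HConn D w x) : HConn D v x := by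
  obtain ⟨p, hp⟩ := h
  obtain ⟨q, hq⟩ := h'
  refine ⟨p.append q, fun y hy => ?_⟩
  rw [SimpleGraph.Walk.mem_support_append_iff] at hy
  exact hy.elim (hp y) (hq y)

lemma HConn.left {v w : V} (h : HConn D v w) : v ∈ D.horo := by
  obtain ⟨p, hp⟩ := h; exact hp _ p.start_mem_support

lemma HConn.right {v w : V} (h : HConn D v w) : w ∈ D.horo := h.symm.left

lemma HConn.of_adj {v w : V} (h : T.Adj v w) (hv : v ∈ D.horo) (hw : w ∈ D.horo) :
    HConn D v w := ⟨h.toWalk, by simp [hv, hw]⟩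

variable (H : IsNonElementaryAction ρ)
include H

lemma AtLevel.act {i : Fin D.numRays} {n : ℕ} {v : V} (h : AtLevel D i n v) (γ : Γ) :
    AtLevel D i n (ρ γ v) :=
  ⟨min_act ρ H.tree γ h.1, by rw [projVertex_act, h.2]⟩

lemma horo_act {v : V} (γ : Γ) (h : v ∈ D.horo) : ρ γ v ∈ D.horo := by
  rw [mem_horo_iff] at *
  obtain ⟨i, n, h⟩ := h
  exact ⟨i, n, h.act H γ⟩

lemma horo_act_iff {v : V} (γ : Γ) : ρ γ v ∈ D.horo ↔ v ∈ D.horo :=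
  ⟨fun h => by simpa using horo_act H γ⁻¹ h, horo_act H γ⟩

lemma HConn.act {v w : V} (h : HConn D v w) (γ : Γ) : HConn D (ρ γ v) (ρ γ w) := by
  obtain ⟨p, hp⟩ := h
  refine ⟨p.map (ρ γ).toHom, fun x hx => ?_⟩
  rw [SimpleGraph.Walk.support_map, List.mem_map] at hx
  obtain ⟨y, hy, rfl⟩ := hx
  exact horo_act H γ (hp y hy)

lemma HConn.mid {a b c : V} (h : HConn D a b) (hc : Between T a c b) : HConn D a c := by
  classical
  obtain ⟨p, hp⟩ := h
  have hc' := mem_support_of_btw H.tree p hc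
  exact ⟨p.takeUntil c hc', fun x hx => hp x (p.support_takeUntil_subset_support hc' hx)⟩

omit H in
/-- The edges of the minimal subtree issued from a vertex of a horoball. -/
lemma AtLevel.edge_cases {i : Fin D.numRays} {n : ℕ} {v w : V} (h : AtLevel D i n v)
    (hw : w ∈ minSubtree ρ) (hvw : T.Adj v w) :
    projEdge ρ ⟨(v, w), hvw⟩ = D.ray i (n + 1) ∨ projEdge ρ ⟨(v, w), hvw⟩ = (D.ray i n).bar := by
  have hmem : projEdge ρ ⟨(v, w), hvw⟩ ∈ minQuotEdge ρ := ⟨_, ⟨h.1, hw⟩, rfl⟩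
  have horig : (projEdge ρ ⟨(v, w), hvw⟩).origin = (D.ray i n).target := h.2
  rcases D.cover_edge _ hmem with he | ⟨j, m, he | he⟩
  · exact absurd (horig ▸ D.origin_mem _ he) (D.interior_not_mem i n)
  · rw [he] at horig
    cases m with
    | zero => exact absurd (horig ▸ D.origin_ray j) (D.interior_not_mem i n)
    | succ m =>
      rw [← D.consecutive] at horig
      have := D.interior_injective (a₁ := (j, m)) (a₂ := (i, n)) horig
      simp only [Prod.mk.injEq] at this
      obtain ⟨rfl, rfl⟩ := this
      exact Or.inl he
  · rw [he, origin_bar] at horig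
    have := D.interior_injective (a₁ := (j, m)) (a₂ := (i, n)) horig
    simp only [Prod.mk.injEq] at this
    obtain ⟨rfl, rfl⟩ := this
    exact Or.inr he

omit H in
lemma AtLevel.edge_eq_of_up {i : Fin D.numRays} {n : ℕ} {v w : V} (h : AtLevel D i n v)
    (hw : AtLevel D i (n + 1) w) (hvw : T.Adj v w) :
    projEdge ρ ⟨(v, w), hvw⟩ = D.ray i (n + 1) := by
  rcases h.edge_cases hw.1 hvw with he | he
  · exact he
  · exfalso
    -- A descending edge ends at a vertex of level `n - 1`, or out of the horoballs if `n = 0`,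
    -- which distinctness of the ray vertices separates from level `n + 1`.
    have ht : (D.ray i n).bar.target = (D.ray i (n + 1)).target := by rw [← he]; exact hw.2
    rw [target_bar] at ht
    cases n with
    | zero => exact D.interior_not_mem i _ (ht ▸ D.origin_ray i)
    | succ n =>
      rw [← D.consecutive] at ht
      have := D.interior_injective (a₁ := (i, n)) (a₂ := (i, n + 1 + 1)) ht
      simp at this
      omega

omit H in
-- Two ascending edges at `v` lie over the same edge of the ray, so an element fixing `v` takes one
-- to the other; by cuspidality it fixes the upper vertex too. This is where horoballs acquire a
-- unique direction to infinity.
lemma AtLevel.up_unique_aux {i : Fin D.numRays} {n : ℕ} {v w w' : V} (h : AtLevel D i n v)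
    (hw : AtLevel D i (n + 1) w) (hvw : T.Adj v w) (hw' : AtLevel D i (n + 1) w')
    (hvw' : T.Adj v w') : w = w' := by
  have e1 := h.edge_eq_of_up hw hvw
  have e2 := h.edge_eq_of_up hw' hvw'
  obtain ⟨γ, h1, h2⟩ := projEdge_eq_iff.1 (e1.trans e2.symm)
  simp only at h1 h2
  rw [← h2]
  exact (D.cuspidal i (n + 1) (by omega) ⟨(v, w), hvw⟩ e1 γ h1).symm

lemma AtLevel.exists_up {i : Fin D.numRays} {n : ℕ} {v : V} (h : AtLevel D i n v) :
    ∃ w, T.Adj v w ∧ AtLevel D i (n + 1) w := by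
  obtain ⟨d, ⟨hd1, hd2⟩, hd⟩ := D.ray_subset i (n + 1)
  have ho : projVertex ρ d.fst = projVertex ρ v := by
    rw [h.2, D.consecutive, ← hd]; rfl
  obtain ⟨γ, hγ⟩ := projVertex_eq_iff.1 ho
  refine ⟨ρ γ d.snd, hγ ▸ (act_adj ρ).2 d.adj, min_act ρ H.tree γ hd2, ?_⟩
  rw [projVertex_act, ← hd]; rfl

lemma AtLevel.up_spec {i : Fin D.numRays} {n : ℕ} {v : V} (h : AtLevel D i n v) :
    T.Adj v (up D v) ∧ AtLevel D i (n + 1) (up D v) := by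
  have hex : ∃ w, T.Adj v w ∧ ∃ i n, AtLevel D i n v ∧ AtLevel D i (n + 1) w := by
    obtain ⟨w, hw, hw'⟩ := h.exists_up H
    exact ⟨w, hw, i, n, h, hw'⟩
  rw [up, dif_pos hex]
  obtain ⟨h1, j, m, h2, h3⟩ := hex.choose_spec
  obtain ⟨rfl, rfl⟩ := h.unique h2
  exact ⟨h1, h3⟩

lemma AtLevel.eq_up {i : Fin D.numRays} {n : ℕ} {v w : V} (h : AtLevel D i n v)
    (hw : AtLevel D i (n + 1) w) (hvw : T.Adj v w) : w = up D v :=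
  h.up_unique_aux hw hvw (h.up_spec H).2 (h.up_spec H).1

/-- The local structure of horoballs: over the two edges of the ray at its `n`-th interior vertex
lie respectively one edge going up and edges going down, the latter leaving the horoball exactly
from level 0. -/
lemma AtLevel.adj_cases {i : Fin D.numRays} {n : ℕ} {v w : V} (h : AtLevel D i n v)
    (hw : w ∈ minSubtree ρ) (hvw : T.Adj v w) :
    w = up D v ∨ (n = 0 ∧ w ∉ D.horo) ∨ ∃ m, n = m + 1 ∧ AtLevel D i m w ∧ v = up D w := by
  rcases h.edge_cases hw hvw with he | he
  · left
    refine h.eq_up H ⟨hw, ?_⟩ hvw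
    rw [← he]; rfl
  · right
    have ht : projVertex ρ w = (D.ray i n).origin := by rw [← target_bar, ← he]; rfl
    cases n with
    | zero =>
      refine Or.inl ⟨rfl, fun hcon => ?_⟩
      obtain ⟨j, m, hj⟩ := mem_horo_iff.1 hcon
      exact D.interior_not_mem j m (hj.2 ▸ ht ▸ D.origin_ray i)
    | succ n =>
      rw [← D.consecutive] at ht
      have hw' : AtLevel D i n w := ⟨hw, ht⟩
      exact Or.inr ⟨n, rfl, hw', hw'.eq_up H h hvw.symm⟩

lemma AtLevel.exists_down {i : Fin D.numRays} {n : ℕ} {v : V} (h : AtLevel D i (n + 1) v) :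
    ∃ w, AtLevel D i n w ∧ up D w = v := by
  obtain ⟨d, ⟨hd1, hd2⟩, hd⟩ := D.ray_subset i (n + 1)
  have ho : projVertex ρ d.snd = projVertex ρ v := by rw [h.2, ← hd]; rfl
  obtain ⟨γ, hγ⟩ := projVertex_eq_iff.1 ho
  have h1 : AtLevel D i n (ρ γ d.fst) := by
    refine ⟨min_act ρ H.tree γ hd1, ?_⟩
    rw [projVertex_act, D.consecutive, ← hd]; rfl
  exact ⟨_, h1, (h1.eq_up H h (hγ ▸ (act_adj ρ).2 d.adj)).symm⟩

lemma AtLevel.exists_exit {i : Fin D.numRays} {v : V} (h : AtLevel D i 0 v) :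
    ∃ w ∈ minSubtree ρ, T.Adj v w ∧ w ∉ D.horo := by
  obtain ⟨d, ⟨hd1, hd2⟩, hd⟩ := D.ray_subset i 0
  have ho : projVertex ρ d.snd = projVertex ρ v := by rw [h.2, ← hd]; rfl
  obtain ⟨γ, hγ⟩ := projVertex_eq_iff.1 ho
  refine ⟨ρ γ d.fst, min_act ρ H.tree γ hd1, hγ ▸ (act_adj ρ).2 d.adj.symm, fun hcon => ?_⟩
  obtain ⟨j, m, hj⟩ := mem_horo_iff.1 hcon
  have : projVertex ρ (ρ γ d.fst) = (D.ray i 0).origin := by rw [projVertex_act, ← hd]; rfl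
  exact D.interior_not_mem j m (hj.2 ▸ this ▸ D.origin_ray i)

lemma AtLevel.up_iterate {i : Fin D.numRays} {n : ℕ} {v : V} (h : AtLevel D i n v) (k : ℕ) :
    AtLevel D i (n + k) ((up D)^[k] v) := by
  induction k with
  | zero => exact h
  | succ k ih =>
    rw [Function.iterate_succ_apply']
    exact (ih.up_spec H).2

lemma AtLevel.exists_level_zero {i : Fin D.numRays} {n : ℕ} {v : V} (h : AtLevel D i n v) :
    ∃ w, AtLevel D i 0 w ∧ (up D)^[n] w = v := by
  induction n generalizing v with
  | zero => exact ⟨v, h, rfl⟩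
  | succ n ih =>
    obtain ⟨w, hw, rfl⟩ := h.exists_down H
    obtain ⟨x, hx, rfl⟩ := ih hw
    exact ⟨x, hx, Function.iterate_succ_apply' _ _ _⟩

lemma up_act {v : V} (h : v ∈ D.horo) (γ : Γ) : up D (ρ γ v) = ρ γ (up D v) := by
  obtain ⟨i, n, h⟩ := mem_horo_iff.1 h
  have h1 := h.up_spec H
  exact ((h.act H γ).eq_up H (h1.2.act H γ) ((act_adj ρ).2 h1.1)).symm

lemma up_mem {v : V} (h : v ∈ D.horo) : up D v ∈ D.horo := by
  obtain ⟨i, n, h⟩ := mem_horo_iff.1 h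
  exact (h.up_spec H).2.mem_horo

lemma up_adj {v : V} (h : v ∈ D.horo) : T.Adj v (up D v) := by
  obtain ⟨i, n, h⟩ := mem_horo_iff.1 h
  exact (h.up_spec H).1

lemma up_iterate_mem {v : V} (h : v ∈ D.horo) (k : ℕ) : (up D)^[k] v ∈ D.horo := by
  obtain ⟨i, n, h⟩ := mem_horo_iff.1 h
  exact (h.up_iterate H k).mem_horo

lemma up_iterate_act {v : V} (h : v ∈ D.horo) (γ : Γ) (k : ℕ) :
    (up D)^[k] (ρ γ v) = ρ γ ((up D)^[k] v) := by
  induction k with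
  | zero => rfl
  | succ k ih =>
    rw [Function.iterate_succ_apply', Function.iterate_succ_apply', ih,
      up_act H (up_iterate_mem H h k)]

/-- Adjacent vertices of the horoballs. -/
lemma up_of_adj {v w : V} (hv : v ∈ D.horo) (hw : w ∈ D.horo) (h : T.Adj v w) :
    w = up D v ∨ v = up D w := by
  obtain ⟨i, n, hv⟩ := mem_horo_iff.1 hv
  rcases hv.adj_cases H hw.1 h with h1 | ⟨_, h1⟩ | ⟨m, _, _, h1⟩
  · exact Or.inl h1
  · exact absurd hw h1
  · exact Or.inr h1

lemma HConn.up_iterate {v : V} (h : v ∈ D.horo) (k : ℕ) : HConn D v ((up D)^[k] v) := by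
  induction k with
  | zero => exact HConn.refl h
  | succ k ih =>
    rw [Function.iterate_succ_apply']
    have h1 := up_iterate_mem H h k
    exact ih.trans (HConn.of_adj (up_adj H h1) h1 (up_mem H h1))

/-- Every edge inside a horoball joins a vertex to its successor under `up`, so coalescence of
ascending rays propagates along a walk. -/
lemma HConn.exists_up_eq {v w : V} (h : HConn D v w) :
    ∃ m n, (up D)^[m] v = (up D)^[n] w := by
  obtain ⟨p, hp⟩ := h
  induction p with
  | nil => exact ⟨0, 0, rfl⟩
  | @cons v y w hvy p ih =>
    simp only [SimpleGraph.Walk.support_cons, List.mem_cons, forall_eq_or_imp] at hp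
    obtain ⟨m, n, hmn⟩ := ih hp.2
    rcases up_of_adj H hp.1 (hp.2 y p.start_mem_support) hvy with rfl | rfl
    · exact ⟨m + 1, n, hmn⟩
    · refine ⟨m, n + 1, ?_⟩
      rw [Function.iterate_succ_apply', ← hmn, ← Function.iterate_succ_apply' (up D) m,
        Function.iterate_succ_apply]

lemma HConn.same_ray {v w : V} (h : HConn D v w) {i j : Fin D.numRays} {n m : ℕ}
    (hv : AtLevel D i n v) (hw : AtLevel D j m w) : i = j := by
  obtain ⟨a, b, hab⟩ := h.exists_up_eq H
  exact ((hv.up_iterate H a).unique (hab ▸ hw.up_iterate H b)).1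

lemma HConn.up_eq_of_level {v w : V} (h : HConn D v w) {i j : Fin D.numRays} {n : ℕ}
    (hv : AtLevel D i n v) (hw : AtLevel D j n w) : ∃ k, (up D)^[k] v = (up D)^[k] w := by
  obtain ⟨a, b, hab⟩ := h.exists_up_eq H
  have := ((hv.up_iterate H a).unique (hab ▸ hw.up_iterate H b)).2
  obtain rfl : a = b := by omega
  exact ⟨a, hab⟩

/-- An element preserving a horoball fixes its vertices far along each ascending ray. -/
lemma exists_act_up_eq {v : V} {γ : Γ} (h : HConn D v (ρ γ v)) :
    ∃ k, ρ γ ((up D)^[k] v) = (up D)^[k] v := by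
  obtain ⟨i, n, hv⟩ := mem_horo_iff.1 h.left
  -- The action preserves levels, so the ascending rays of `v` and of its image merge after the same
  -- number of steps.
  obtain ⟨k, hk⟩ := h.up_eq_of_level H hv (hv.act H γ)
  exact ⟨k, by rw [← up_iterate_act H h.left, hk]⟩

lemma exists_not_mem_horo : ∃ x ∈ minSubtree ρ, x ∉ D.horo := by
  obtain ⟨v, hv⟩ := min_nonempty ρ H.tree H.finite_nbrs H.nonElementary
  by_cases h : v ∈ D.horo
  · obtain ⟨i, n, h⟩ := mem_horo_iff.1 h
    obtain ⟨w, hw, -⟩ := h.exists_level_zero H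
    obtain ⟨x, hx, -, hx'⟩ := hw.exists_exit H
    exact ⟨x, hx, hx'⟩
  · exact ⟨v, hv, h⟩

/-- Segments of the minimal subtree can be prolonged up to a vertex out of the horoballs. -/
lemma exists_prolong {x y : V} (hx : x ∈ minSubtree ρ) (hy : y ∈ minSubtree ρ) (hxy : x ≠ y) :
    ∃ z ∈ minSubtree ρ, z ∉ D.horo ∧ z ≠ y ∧ Between T x y z := by
  have hT := H.tree
  obtain ⟨u, hu, hub⟩ := exists_adj_btw hT hxy.symm
  have huM := min_convex ρ hT _ hy _ hx _ hub
  obtain ⟨w, hw, hyw, hwu⟩ := min_no_leaf ρ hT H.noInversion huM hy hu.symm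
  obtain ⟨x₀, hx₀, hx₀'⟩ := exists_not_mem_horo (D := D) H
  -- As `y` is not terminal, the segment continues by an edge to `w`; the half-tree beyond contains
  -- a translate of a vertex chosen outside the horoballs.
  obtain ⟨γ, hγ⟩ := exists_act_mem_halfspace ρ hT hyw hw x₀
  refine ⟨ρ γ x₀, min_act ρ hT γ hx₀, fun h => hx₀' ((horo_act_iff H γ).1 h), ?_, ?_⟩
  · intro h
    rw [h, T.dist_self] at hγ
    omega
  · have h1 := btw_of_adj_adj hT hu.symm hyw hwu.symm
    have h2 := btw_of_adj_of_lt hT hyw hγ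
    have h3 := h1.concat' hT h2 hyw.ne
    exact hub.symm.concat hT h3 hu.ne.symm

end Horoballs


/-! ### The tree obtained by collapsing the horoballs -/

section Gate

variable {V : Type u} {T : SimpleGraph V}

open Classical in
/-- The projection to a convex set. -/
noncomputable def gate (T : SimpleGraph V) (S : Set V) (x : V) : V :=
  if h : ∃ g ∈ S, ∀ w ∈ S, Between T x g w then h.choose else x

variable {S : Set V} (hT : T.IsTree) (hne : S.Nonempty) (hS : TConvex T S)
include hT hne hS

lemma gate_spec (x : V) : gate T S x ∈ S ∧ ∀ w ∈ S, Between T x (gate T S x) w := by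
  have h := exists_gate hT hne hS x
  rw [gate, dif_pos h]
  exact h.choose_spec

lemma gate_eq {x g : V} (hg : g ∈ S) (h : ∀ w ∈ S, Between T x g w) : gate T S x = g :=
  gate_unique hT (gate_spec hT hne hS x).1 (gate_spec hT hne hS x).2 hg h

lemma gate_of_mem {x : V} (hx : x ∈ S) : gate T S x = x :=
  gate_eq hT hne hS hx fun _ _ => between_left _ _

lemma gate_adj {a b : V} (h : T.Adj a b) :
    gate T S a = gate T S b ∨ T.Adj (gate T S a) (gate T S b) := by
  have h1 := (gate_spec hT hne hS a).2 _ (gate_spec hT hne hS b).1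
  have h2 := (gate_spec hT hne hS b).2 _ (gate_spec hT hne hS a).1
  have h3 := SimpleGraph.dist_eq_one_iff_adj.2 h
  have h4 := dist_tri hT a b (gate T S b)
  have h5 := dist_tri hT b a (gate T S a)
  unfold Between at *
  rw [T.dist_comm (u := gate T S b) (v := gate T S a)] at h2
  rw [T.dist_comm (u := b) (v := a)] at h5
  have h6 : T.dist (gate T S a) (gate T S b) ≤ 1 := by omega
  rcases Nat.le_one_iff_eq_zero_or_eq_one.1 h6 with h7 | h7
  · exact Or.inl ((tdist_eq_zero hT).1 h7)
  · exact Or.inr (SimpleGraph.dist_eq_one_iff_adj.1 h7)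

end Gate

section Collapse

variable {V : Type u} {T : SimpleGraph V} {Γ : Type w} [Group Γ] {ρ : Γ →* (T ≃g T)}
  (D : CuspidalDecomposition ρ)

/-- The equivalence relation identifying the vertices of a horoball, and vertices with the same
projection to the minimal subtree. -/
def collSetoid : Setoid V where
  r a b := gate T (minSubtree ρ) a = gate T (minSubtree ρ) b ∨
    HConn D (gate T (minSubtree ρ) a) (gate T (minSubtree ρ) b)
  iseqv :=
    { refl := fun _ => Or.inl rfl
      symm := fun h => h.elim (fun h => Or.inl h.symm) (fun h => Or.inr h.symm)
      trans := by
        rintro a b c (h | h) (h' | h')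
        · exact Or.inl (h.trans h')
        · exact Or.inr (h ▸ h')
        · exact Or.inr (h' ▸ h)
        · exact Or.inr (h.trans h') }

/-- The vertices of the collapsed tree. -/
def CollVert : Type u := Quotient (collSetoid D)

/-- The collapsing map. -/
def coll (v : V) : CollVert D := Quotient.mk (collSetoid D) v

/-- The collapsed tree. -/
def collTree : SimpleGraph (CollVert D) where
  Adj x y := x ≠ y ∧ ∃ a ∈ minSubtree ρ, ∃ b ∈ minSubtree ρ, T.Adj a b ∧ coll D a = x ∧ coll D b = y
  symm := ⟨fun _ _ ⟨h, a, ha, b, hb, hab, h1, h2⟩ => ⟨h.symm, b, hb, a, ha, hab.symm, h2, h1⟩⟩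
  loopless := ⟨fun _ h => h.1 rfl⟩

variable {D} (H : IsNonElementaryAction ρ)
include H

lemma IsNonElementaryAction.gate_spec (x : V) : gate T (minSubtree ρ) x ∈ minSubtree ρ ∧
    ∀ w ∈ minSubtree ρ, Between T x (gate T (minSubtree ρ) x) w :=
  GFTree.gate_spec H.tree (min_nonempty ρ H.tree H.finite_nbrs H.nonElementary)
    (min_convex ρ H.tree) x

lemma IsNonElementaryAction.gate_of_mem {x : V} (hx : x ∈ minSubtree ρ) :
    gate T (minSubtree ρ) x = x :=
  GFTree.gate_of_mem H.tree (min_nonempty ρ H.tree H.finite_nbrs H.nonElementary)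
    (min_convex ρ H.tree) hx

lemma IsNonElementaryAction.gate_act (γ : Γ) (x : V) :
    gate T (minSubtree ρ) (ρ γ x) = ρ γ (gate T (minSubtree ρ) x) := by
  refine GFTree.gate_eq H.tree (min_nonempty ρ H.tree H.finite_nbrs H.nonElementary)
    (min_convex ρ H.tree) (min_act ρ H.tree γ (H.gate_spec x).1) fun w hw => ?_
  have := ((H.gate_spec x).2 _ (min_act ρ H.tree γ⁻¹ hw)).map (ρ γ)
  rwa [act_inv] at this

lemma coll_gate (x : V) : coll D (gate T (minSubtree ρ) x) = coll D x :=
  Quotient.sound (Or.inl (H.gate_of_mem (H.gate_spec x).1))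

lemma exists_mem_coll_eq (x : CollVert D) : ∃ a ∈ minSubtree ρ, coll D a = x := by
  induction x using Quotient.inductionOn with
  | h v => exact ⟨_, (H.gate_spec v).1, coll_gate H v⟩

lemma coll_eq_iff {a b : V} (ha : a ∈ minSubtree ρ) (hb : b ∈ minSubtree ρ) :
    coll D a = coll D b ↔ a = b ∨ HConn D a b := by
  refine (Quotient.eq (r := collSetoid D)).trans ?_
  change (_ ∨ _) ↔ _
  rw [H.gate_of_mem ha, H.gate_of_mem hb]

lemma coll_eq_of_horo {a b : V} (ha : a ∈ D.horo) (hb : b ∈ D.horo) (h : T.Adj a b) :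
    coll D a = coll D b :=
  (coll_eq_iff H ha.1 hb.1).2 (Or.inr (HConn.of_adj h ha hb))

lemma coll_eq_left {a b : V} (ha : a ∈ minSubtree ρ) (hb : b ∈ minSubtree ρ) (h : a ∉ D.horo)
    (he : coll D a = coll D b) : a = b := by
  rcases (coll_eq_iff H ha hb).1 he with h' | h'
  · exact h'
  · exact absurd h'.left h

lemma coll_ne_iff {a b : V} (ha : a ∈ minSubtree ρ) (hb : b ∈ minSubtree ρ) (h : T.Adj a b) :
    coll D a ≠ coll D b ↔ ¬ (a ∈ D.horo ∧ b ∈ D.horo) := by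
  rw [not_iff_not, coll_eq_iff H ha hb]
  constructor
  · rintro (h' | h')
    · exact absurd h' h.ne
    · exact ⟨h'.left, h'.right⟩
  · exact fun h' => Or.inr (HConn.of_adj h h'.1 h'.2)

omit H in
lemma coll_adj_of {a b : V} (ha : a ∈ minSubtree ρ) (hb : b ∈ minSubtree ρ) (h : T.Adj a b)
    (hne : coll D a ≠ coll D b) : (collTree D).Adj (coll D a) (coll D b) :=
  ⟨hne, a, ha, b, hb, h, rfl, rfl⟩

lemma coll_simplicial {a b : V} (h : T.Adj a b) :
    coll D a = coll D b ∨ (collTree D).Adj (coll D a) (coll D b) := by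
  rcases gate_adj H.tree (min_nonempty ρ H.tree H.finite_nbrs H.nonElementary)
    (min_convex ρ H.tree) h with h' | h'
  · exact Or.inl (Quotient.sound (Or.inl h'))
  · by_cases hne : coll D a = coll D b
    · exact Or.inl hne
    · refine Or.inr ?_
      rw [← coll_gate H a, ← coll_gate H b] at hne ⊢
      exact coll_adj_of (H.gate_spec a).1 (H.gate_spec b).1 h' hne

/-- The edges of the collapsed tree lift uniquely. -/
lemma lift_unique {a b a' b' : V} (ha : a ∈ minSubtree ρ) (hb : b ∈ minSubtree ρ)
    (ha' : a' ∈ minSubtree ρ) (hb' : b' ∈ minSubtree ρ) (h : T.Adj a b) (h' : T.Adj a' b')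
    (hne : coll D a ≠ coll D b) (h1 : coll D a = coll D a') (h2 : coll D b = coll D b') :
    a = a' ∧ b = b' := by
  have key : ∀ {a b a' b' : V}, a ∈ minSubtree ρ → b ∈ minSubtree ρ → a' ∈ minSubtree ρ →
      b' ∈ minSubtree ρ → T.Adj a b → T.Adj a' b' → coll D a ≠ coll D b →
      coll D a = coll D a' → coll D b = coll D b' → a = a' := by
    intro a b a' b' ha hb ha' hb' h h' hne h1 h2
    by_contra haa
    have h3 := ((coll_eq_iff H ha ha').1 h1).resolve_left haa
    -- If the terminal vertices also differed, both `a` and `b` would lie in horoballs and the edge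
    -- would be collapsed. If they agree, `b` lies between `a` and `a'` in a convex horoball, with
    -- the same conclusion.
    have hbb : b = b' := by
      by_contra hbb
      have h4 := ((coll_eq_iff H hb hb').1 h2).resolve_left hbb
      exact hne (coll_eq_of_horo H h3.left h4.left h)
    subst hbb
    exact hne ((coll_eq_iff H ha hb).2
      (Or.inr (h3.mid H (btw_of_adj_adj H.tree h h'.symm haa))))
  exact ⟨key ha hb ha' hb' h h' hne h1 h2, key hb ha hb' ha' h.symm h'.symm hne.symm h2 h1⟩

/-- Vertices with the same image are on the same side of a non-collapsed edge. -/
lemma same_side {a b x y : V} (ha : a ∈ minSubtree ρ) (hb : b ∈ minSubtree ρ) (hab : T.Adj a b)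
    (hne : coll D a ≠ coll D b) (hx : x ∈ minSubtree ρ) (hy : y ∈ minSubtree ρ)
    (hxy : coll D x = coll D y) (hlt : T.dist x a < T.dist x b) : T.dist y a < T.dist y b := by
  have hT := H.tree
  by_contra hcon
  have hlt' : T.dist y b < T.dist y a := by
    rcases dist_adj_cases hT hab y with h4 | h4 <;> omega
  rcases (coll_eq_iff H hx hy).1 hxy with rfl | hc
  · omega
  have h1 := dist_across hT hab hlt hlt'
  have e := SimpleGraph.dist_eq_one_iff_adj.2 hab
  have t1 := dist_tri hT a b y
  have t2 := dist_tri hT x a y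
  have t3 := dist_tri hT x b y
  have t4 := dist_tri hT x a b
  -- The segment from `x` to `y` stays in one horoball and crosses the edge, so the edge would be
  -- collapsed.
  have h2 : HConn D x a := hc.mid H (by unfold Between; omega)
  have h3 : HConn D x b := hc.mid H (by unfold Between; omega)
  exact hne ((coll_eq_iff H ha hb).2 (Or.inr (h2.symm.trans h3)))

/-- Connectedness passes to the image of the simplicial map `coll`. Every edge is a bridge because
the sides of its lift descend to the quotient by `same_side`, and only the lift itself joins them.
-/
lemma collTree_isTree : (collTree D).IsTree := by
  have hT := H.tree
  constructor
  · have hreach : ∀ a b : V, (collTree D).Reachable (coll D a) (coll D b) := by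
      intro a b
      obtain ⟨p⟩ := hT.connected.preconnected a b
      induction p with
      | nil => exact SimpleGraph.Reachable.refl _
      | @cons a c b h p ih =>
        rcases coll_simplicial (D := D) H h with h' | h'
        · rwa [h']
        · exact h'.reachable.trans ih
    obtain ⟨x⟩ := hT.connected.nonempty
    have : Nonempty (CollVert D) := ⟨coll D x⟩
    refine ⟨fun x y => ?_⟩
    obtain ⟨a, -, rfl⟩ := exists_mem_coll_eq H x
    obtain ⟨b, -, rfl⟩ := exists_mem_coll_eq H y
    exact hreach a b
  · rw [SimpleGraph.isAcyclic_iff_forall_adj_isBridge]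
    rintro _ _ ⟨hne, a, ha, b, hb, hab, rfl, rfl⟩
    rw [SimpleGraph.isBridge_iff]
    rintro ⟨p⟩
    have hside := fun x hx y hy h => same_side H (x := x) (y := y) ha hb hab hne hx hy h
    have key : ∀ x y : CollVert D,
        ∀ _ : (collTree D \ SimpleGraph.fromEdgeSet {s(coll D a, coll D b)}).Walk x y,
        (∃ v ∈ minSubtree ρ, coll D v = x ∧ T.dist v a < T.dist v b) →
        ∃ v ∈ minSubtree ρ, coll D v = y ∧ T.dist v a < T.dist v b := by
      intro x y p
      induction p with
      | nil => exact id
      | @cons x y z h p ih =>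
        rintro ⟨v, hv, rfl, hlt⟩
        refine ih ?_
        rw [SimpleGraph.sdiff_adj, SimpleGraph.fromEdgeSet_adj] at h
        obtain ⟨⟨hvy, c, hc, d, hd, hcd, hcv, rfl⟩, hnot⟩ := h
        refine ⟨d, hd, rfl, ?_⟩
        have h1 := hside v hv c hc hcv.symm hlt
        by_contra hcon
        have h2 : T.dist d b < T.dist d a := by
          rcases dist_adj_cases hT hab d with h4 | h4 <;> omega
        have h3 := dist_across hT hab h1 h2
        rw [SimpleGraph.dist_eq_one_iff_adj.2 hcd] at h3
        have h4 : c = a := (tdist_eq_zero hT).1 (by omega)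
        have h5 : b = d := (tdist_eq_zero hT).1 (by omega)
        subst h4; subst h5
        exact hnot ⟨by rw [hcv]; rfl, hvy⟩
    obtain ⟨v, hv, hvb, hlt⟩ := key _ _ p ⟨a, ha, rfl, by
      rw [T.dist_self]; exact hT.connected.pos_dist_of_ne hab.ne⟩
    have := hside v hv b hb hvb hlt
    rw [T.dist_self] at this
    omega

/-! #### The action on the collapsed tree -/

lemma coll_act_congr (γ : Γ) {a b : V} (h : coll D a = coll D b) :
    coll D (ρ γ a) = coll D (ρ γ b) := by
  have h' : _ ∨ _ := Quotient.exact h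
  refine Quotient.sound (?_ : _ ∨ _)
  rw [H.gate_act, H.gate_act]
  exact h'.imp (fun h => by rw [h]) (fun h => h.act H γ)

/-- The action of an element on the vertices of the collapsed tree. -/
def collMap (γ : Γ) : CollVert D → CollVert D :=
  Quotient.map (sa := collSetoid D) (sb := collSetoid D) (ρ γ)
    fun _ _ h => Quotient.exact (coll_act_congr H γ (Quotient.sound h))

lemma collMap_adj (γ : Γ) {x y : CollVert D} (h : (collTree D).Adj x y) :
    (collTree D).Adj (collMap H γ x) (collMap H γ y) := by
  obtain ⟨hne, a, ha, b, hb, hab, rfl, rfl⟩ := h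
  refine ⟨fun h => hne ?_, _, min_act ρ H.tree γ ha, _, min_act ρ H.tree γ hb,
    (act_adj ρ).2 hab, rfl, rfl⟩
  simpa using coll_act_congr H γ⁻¹ h

lemma collMap_inv (γ : Γ) (x : CollVert D) : collMap H γ⁻¹ (collMap H γ x) = x := by
  induction x using Quotient.inductionOn with
  | h v => exact congrArg (coll D) (inv_act ρ γ v)

lemma collMap_inv' (γ : Γ) (x : CollVert D) : collMap H γ (collMap H γ⁻¹ x) = x := by
  induction x using Quotient.inductionOn with
  | h v => exact congrArg (coll D) (act_inv ρ γ v)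

variable (D) in
/-- The action on the collapsed tree. -/
def collAct : Γ →* (collTree D ≃g collTree D) where
  toFun γ :=
    { toFun := collMap H γ
      invFun := collMap H γ⁻¹
      left_inv := collMap_inv H γ
      right_inv := collMap_inv' H γ
      map_rel_iff' := ⟨fun h => by simpa [collMap_inv] using collMap_adj H γ⁻¹ h,
        collMap_adj H γ⟩ }
  map_one' := by
    ext x
    induction x using Quotient.inductionOn with
    | h v => exact congrArg (coll D) (by simp)
  map_mul' γ η := by
    ext x
    induction x using Quotient.inductionOn with
    | h v => exact congrArg (coll D) (act_mul ρ γ η v)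

lemma collAct_coll (γ : Γ) (v : V) : collAct D H γ (coll D v) = coll D (ρ γ v) := rfl

lemma collAct_noInversion : NoInversion (collAct D H) := by
  rintro γ _ _ ⟨hne, a, ha, b, hb, hab, rfl, rfl⟩ ⟨h1, h2⟩
  rw [collAct_coll] at h1 h2
  have h3 := lift_unique H hb ha (min_act ρ H.tree γ ha) (min_act ρ H.tree γ hb) hab.symm
    ((act_adj ρ).2 hab) hne.symm h1.symm h2.symm
  exact H.noInversion γ a b hab ⟨h3.1.symm, h3.2.symm⟩

/-- An element fixing an edge of the collapsed tree fixes its lift. -/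
lemma act_eq_of_fixes_edge {γ : Γ} {a b : V} (ha : a ∈ minSubtree ρ) (hb : b ∈ minSubtree ρ)
    (hab : T.Adj a b) (hne : coll D a ≠ coll D b) (h1 : collAct D H γ (coll D a) = coll D a)
    (h2 : collAct D H γ (coll D b) = coll D b) : ρ γ a = a ∧ ρ γ b = b := by
  have := lift_unique H ha hb (min_act ρ H.tree γ ha) (min_act ρ H.tree γ hb) hab
    ((act_adj ρ).2 hab) hne h1.symm h2.symm
  exact ⟨this.1.symm, this.2.symm⟩

/-! ### Stabilizers, finiteness of the quotient graph and acylindricity -/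

lemma finite_collEdgeStab (hfin : ∀ v, Finite (vertexStab ρ v)) (x y : CollVert D)
    (h : (collTree D).Adj x y) :
    Finite ↥(vertexStab (collAct D H) x ⊓ vertexStab (collAct D H) y) := by
  obtain ⟨hne, a, ha, b, hb, hab, rfl, rfl⟩ := h
  have := hfin a
  have hle : vertexStab (collAct D H) (coll D a) ⊓ vertexStab (collAct D H) (coll D b) ≤
      vertexStab ρ a :=
    fun γ hγ => (act_eq_of_fixes_edge H ha hb hab hne hγ.1 hγ.2).1
  exact Finite.of_injective _ (Subgroup.inclusion_injective hle)

/-- An element preserving a horoball fixes all but finitely many vertices of a given ascending ray,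
so finitely many generators share a fixed vertex, whose stabilizer is finite. Outside the horoballs,
the stabilizer is that of a vertex of `T`. -/
lemma locallyFinite_collVertexStab (hfin : ∀ v, Finite (vertexStab ρ v)) (x : CollVert D) :
    IsLocallyFiniteSubgroup (vertexStab (collAct D H) x) := by
  intro K hK hfg
  obtain ⟨a, ha, rfl⟩ := exists_mem_coll_eq H x
  suffices h : ∃ v, K ≤ vertexStab ρ v by
    obtain ⟨v, hv⟩ := h
    have := hfin v
    exact Finite.of_injective _ (Subgroup.inclusion_injective hv)
  by_cases hh : a ∈ D.horo
  · have key : ∀ γ ∈ K, ∃ k, ∀ n, k ≤ n → ρ γ ((up D)^[n] a) = (up D)^[n] a := by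
      intro γ hγ
      have h1 : coll D a = coll D (ρ γ a) := (hK hγ : collAct D H γ (coll D a) = coll D a).symm
      have h2 : HConn D a (ρ γ a) := by
        rcases (coll_eq_iff H ha (min_act ρ H.tree γ ha)).1 h1 with h2 | h2
        · rw [← h2]; exact HConn.refl hh
        · exact h2
      obtain ⟨k, hk⟩ := exists_act_up_eq H h2
      refine ⟨k, fun n hn => ?_⟩
      obtain ⟨m, rfl⟩ := Nat.exists_eq_add_of_le' hn
      rw [Function.iterate_add_apply, ← up_iterate_act H (up_iterate_mem H hh k), hk]
    obtain ⟨S, rfl⟩ := hfg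
    choose! k hk using key
    refine ⟨(up D)^[S.sup k] a, (Subgroup.closure_le _).2 fun γ hγ => ?_⟩
    exact hk γ (Subgroup.subset_closure hγ) _ (Finset.le_sup (f := k) hγ)
  · refine ⟨a, fun γ hγ => ?_⟩
    have h1 : coll D a = coll D (ρ γ a) := (hK hγ : collAct D H γ (coll D a) = coll D a).symm
    exact (coll_eq_left H ha (min_act ρ H.tree γ ha) hh h1).symm

/-- A horoball contains vertices of level 0, so the finite subgraph and the first interior vertices
of the rays account for all orbits. -/
lemma finite_collQuotVertex : Finite (QuotVertex (collAct D H)) := by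
  set F : Set (QuotVertex ρ) := D.finV ∪ range fun i => (D.ray i 0).target with hF
  have hFfin : F.Finite := D.finite_finV.union (finite_range _)
  have key : ∀ x : QuotVertex (collAct D H), ∃ q : F, ∃ a, projVertex ρ a = q ∧
      projVertex (collAct D H) (coll D a) = x := by
    intro x
    induction x using Quotient.inductionOn with
    | h y =>
      obtain ⟨a, ha, rfl⟩ := exists_mem_coll_eq H y
      by_cases hh : a ∈ D.horo
      · obtain ⟨i, n, hi⟩ := mem_horo_iff.1 hh
        obtain ⟨b, hb, rfl⟩ := hi.exists_level_zero H
        refine ⟨⟨_, Or.inr ⟨i, rfl⟩⟩, b, hb.2, congrArg (projVertex (collAct D H)) ?_⟩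
        exact (coll_eq_iff H hb.1 ha).2 (Or.inr (HConn.up_iterate H hb.mem_horo n))
      · refine ⟨⟨projVertex ρ a, Or.inl ?_⟩, a, rfl, rfl⟩
        rcases D.cover_vertex _ ⟨a, ha, rfl⟩ with h | ⟨i, n, h⟩
        · exact h
        · exact absurd ⟨ha, i, n, h⟩ hh
  choose q a hqa hax using key
  have := hFfin.to_subtype
  refine Finite.of_injective q fun x y hxy => ?_
  have h1 : projVertex ρ (a x) = projVertex ρ (a y) := by rw [hqa, hqa, hxy]
  obtain ⟨γ, hγ⟩ := projVertex_eq_iff.1 h1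
  rw [← hax x, ← hax y]
  exact projVertex_eq_iff.2 ⟨γ, congrArg (coll D) hγ⟩

/-- Only the initial edges of the rays survive the collapse, since all later ones have both ends in
a horoball; each must be counted with its opposite. -/
lemma finite_collQuotEdge : Finite (QuotEdge (collAct D H)) := by
  set F : Set (QuotEdge ρ) :=
    D.finE ∪ ((range fun i => D.ray i 0) ∪ range fun i => (D.ray i 0).bar) with hF
  have hFfin : F.Finite := D.finite_finE.union ((finite_range _).union (finite_range _))
  have key : ∀ x : QuotEdge (collAct D H), ∃ q : F, ∃ d : T.Dart, projEdge ρ d = q ∧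
      ∃ e : (collTree D).Dart, projEdge (collAct D H) e = x ∧ coll D d.fst = e.fst ∧
        coll D d.snd = e.snd := by
    intro x
    induction x using Quotient.inductionOn with
    | h e =>
      obtain ⟨hne, a, ha, b, hb, hab, h1, h2⟩ := e.adj
      refine ⟨⟨projEdge ρ ⟨(a, b), hab⟩, ?_⟩, ⟨(a, b), hab⟩, rfl, e, rfl, h1, h2⟩
      rw [← h1, ← h2, coll_ne_iff H ha hb hab] at hne
      rcases D.cover_edge _ ⟨⟨(a, b), hab⟩, ⟨ha, hb⟩, rfl⟩ with h | ⟨i, n, h | h⟩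
      · exact Or.inl h
      · cases n with
        | zero => exact Or.inr (Or.inl ⟨i, h.symm⟩)
        | succ n =>
          refine absurd ⟨⟨ha, i, n, ?_⟩, ⟨hb, i, n + 1, ?_⟩⟩ hne
          · rw [D.consecutive, ← h]; rfl
          · rw [← h]; rfl
      · cases n with
        | zero => exact Or.inr (Or.inr ⟨i, h.symm⟩)
        | succ n =>
          refine absurd ⟨⟨ha, i, n + 1, ?_⟩, ⟨hb, i, n, ?_⟩⟩ hne
          · rw [← origin_bar, ← h]; rfl
          · rw [D.consecutive, ← target_bar, ← h]; rfl
  choose q d hqd e hex h1 h2 using key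
  have := hFfin.to_subtype
  refine Finite.of_injective q fun x y hxy => ?_
  have h3 : projEdge ρ (d x) = projEdge ρ (d y) := by rw [hqd, hqd, hxy]
  obtain ⟨γ, hγ1, hγ2⟩ := projEdge_eq_iff.1 h3
  rw [← hex x, ← hex y]
  refine projEdge_eq_iff.2 ⟨γ, ?_, ?_⟩
  · rw [← h1, ← h1, collAct_coll, hγ1]
  · rw [← h2, ← h2, collAct_coll, hγ2]

lemma isHoroballCollapse : IsHoroballCollapse D (collTree D) (coll D) := by
  refine ⟨?_, fun a ha b hb => coll_eq_iff H ha hb, fun x y => Iff.rfl⟩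
  rw [eq_univ_iff_forall]
  intro x
  obtain ⟨a, ha, h⟩ := exists_mem_coll_eq H x
  exact ⟨a, ha, h⟩

/-- Paths of length 1 suffice. An element fixing an edge fixes its lift, hence has finite order; if
nontrivial and in `Γ'`, it would force both ends of the lift into horoballs, and the edge would be
collapsed. -/
lemma collAct_isAcylindrical (hfin : ∀ v, Finite (vertexStab ρ v)) {Γ' : Subgroup Γ}
    (hΓ' : ∀ γ ∈ Γ', IsOfFinOrder γ → γ ≠ 1 → ∀ v ∈ minSubtree ρ, ρ γ v = v → v ∈ D.horo) :
    IsAcylindrical ((collAct D H).comp Γ'.subtype) := by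
  refine ⟨fun γ a b hab => collAct_noInversion H γ a b hab, 1, le_rfl, ?_⟩
  intro x y p hp hlen γ hγ
  obtain ⟨hne, a, ha, b, hb, hab, rfl, rfl⟩ := SimpleGraph.Walk.adj_of_length_eq_one hlen
  have h := act_eq_of_fixes_edge (γ := (γ : Γ)) H ha hb hab hne
    (hγ _ p.start_mem_support) (hγ _ p.end_mem_support)
  by_contra hγ1
  have hγ1' : (γ : Γ) ≠ 1 := fun h => hγ1 (Subtype.ext h)
  have hfo : IsOfFinOrder (γ : Γ) := by
    have := hfin a
    have h1 := isOfFinOrder_of_finite (⟨(γ : Γ), h.1⟩ : vertexStab ρ a)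
    exact (vertexStab ρ a).subtype.isOfFinOrder h1
  exact (coll_ne_iff H ha hb hab).1 hne
    ⟨hΓ' _ γ.2 hfo hγ1' a ha h.1, hΓ' _ γ.2 hfo hγ1' b hb h.2⟩

end Collapse


/-! ### Return times and suspensions -/

section ReturnTime

variable {X : Type*}

/-- The first positive time at which an orbit enters `A`. -/
noncomputable def returnTime (φ : X → X) (A : Set X) (x : X) : ℕ := sInf {n | 0 < n ∧ φ^[n] x ∈ A}

lemma returnTime_spec {φ : X → X} {A : Set X} {x : X} (h : ∃ n, 0 < n ∧ φ^[n] x ∈ A) :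
    0 < returnTime φ A x ∧ φ^[returnTime φ A x] x ∈ A :=
  Nat.sInf_mem (s := {n | 0 < n ∧ φ^[n] x ∈ A}) h

lemma not_mem_of_lt_returnTime {φ : X → X} {A : Set X} {x : X} {n : ℕ} (hn : 0 < n)
    (h : n < returnTime φ A x) : φ^[n] x ∉ A := fun h' => Nat.notMem_of_lt_sInf h ⟨hn, h'⟩

lemma returnTime_eq {φ : X → X} {A : Set X} {x : X} {n : ℕ} (hn : 0 < n) (h : φ^[n] x ∈ A)
    (h' : ∀ m, 0 < m → m < n → φ^[m] x ∉ A) : returnTime φ A x = n := by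
  have h1 := returnTime_spec ⟨n, hn, h⟩
  rcases lt_trichotomy (returnTime φ A x) n with h2 | h2 | h2
  · exact absurd h1.2 (h' _ h1.1 h2)
  · exact h2
  · exact absurd h (not_mem_of_lt_returnTime hn h2)

lemma iterate_iterate_of_leftInverse {f g : X → X} (hgf : Function.LeftInverse g f) {m n : ℕ}
    (h : m ≤ n) (x : X) : g^[m] (f^[n] x) = f^[n - m] x := by
  obtain ⟨k, rfl⟩ := Nat.exists_eq_add_of_le h
  rw [Function.iterate_add_apply, (hgf.iterate m) _, Nat.add_sub_cancel_left]

variable [TopologicalSpace X] (φ : X ≃ₜ X) {A : Set X}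

/-- The value `n` is determined by the membership in `A` of the first `n` iterates, which are clopen
conditions. -/
lemma continuous_returnTime (hA : IsClopen A) (hret : ∀ x, ∃ n, 0 < n ∧ φ^[n] x ∈ A) :
    Continuous (returnTime φ A) := by
  have hc : ∀ n, Continuous φ^[n] := fun n => φ.continuous.iterate n
  refine continuous_discrete_rng.2 fun n => isOpen_iff_mem_nhds.2 fun x hx => ?_
  obtain rfl : returnTime φ A x = n := hx
  set n := returnTime φ A x with hn
  have hopen : IsOpen (φ^[n] ⁻¹' A ∩ ⋂ m ∈ Finset.Ioo 0 n, φ^[m] ⁻¹' Aᶜ) :=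
    (hA.isOpen.preimage (hc n)).inter (isOpen_biInter_finset fun m _ =>
      hA.compl.isOpen.preimage (hc m))
  refine mem_of_superset (hopen.mem_nhds ⟨(returnTime_spec (hret x)).2, ?_⟩) ?_
  · simp only [Finset.mem_Ioo, mem_iInter]
    exact fun m hm => not_mem_of_lt_returnTime hm.1 hm.2
  · rintro y ⟨hy1, hy2⟩
    simp only [Finset.mem_Ioo, mem_iInter] at hy2
    exact returnTime_eq (returnTime_spec (hret x)).1 hy1 fun m h1 h2 => hy2 m ⟨h1, h2⟩

lemma continuous_iterate_uncurry : Continuous fun p : ℕ × X => φ^[p.1] p.2 :=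
  continuous_prod_of_discrete_left.2 fun n => φ.continuous.iterate n

lemma returnTime_symm {x : X} (hx : x ∈ A) (hret : ∃ n, 0 < n ∧ φ^[n] x ∈ A) :
    returnTime φ.symm A (φ^[returnTime φ A x] x) = returnTime φ A x := by
  have h := returnTime_spec hret
  refine returnTime_eq h.1 ?_ fun m h1 h2 => ?_
  · rw [iterate_iterate_of_leftInverse φ.symm_apply_apply le_rfl]
    simpa
  · rw [iterate_iterate_of_leftInverse φ.symm_apply_apply h2.le]
    exact not_mem_of_lt_returnTime (by omega) (Nat.sub_lt h.1 h1)

/-- The first return map. -/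
noncomputable def returnMap (hret : ∀ x, ∃ n, 0 < n ∧ φ^[n] x ∈ A) (x : A) : A :=
  ⟨φ^[returnTime φ A x] x, (returnTime_spec (hret x)).2⟩

lemma returnMap_symm_returnMap (hret : ∀ x, ∃ n, 0 < n ∧ φ^[n] x ∈ A)
    (hret' : ∀ x, ∃ n, 0 < n ∧ φ.symm^[n] x ∈ A) (x : A) :
    returnMap φ.symm hret' (returnMap φ hret x) = x := by
  refine Subtype.ext ?_
  change φ.symm^[returnTime φ.symm A (φ^[returnTime φ A x] x)] (φ^[returnTime φ A x] x) = x
  rw [returnTime_symm φ x.2 (hret x)]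
  exact φ.toEquiv.left_inv.iterate _ _

/-- The first return homeomorphism. -/
noncomputable def returnHomeo (hA : IsClopen A) (hret : ∀ x, ∃ n, 0 < n ∧ φ^[n] x ∈ A)
    (hret' : ∀ x, ∃ n, 0 < n ∧ φ.symm^[n] x ∈ A) : A ≃ₜ A where
  toFun := returnMap φ hret
  invFun := returnMap φ.symm hret'
  left_inv := returnMap_symm_returnMap φ hret hret'
  right_inv := returnMap_symm_returnMap φ.symm hret' hret
  continuous_toFun := ((continuous_iterate_uncurry φ).comp
    (((continuous_returnTime φ hA hret).comp continuous_subtype_val).prodMk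
      continuous_subtype_val)).subtype_mk _
  continuous_invFun := ((continuous_iterate_uncurry φ.symm).comp
    (((continuous_returnTime φ.symm hA hret').comp continuous_subtype_val).prodMk
      continuous_subtype_val)).subtype_mk _

/-- A homeomorphism is a suspension of its first return map to a clopen set. -/
theorem exists_suspension {Y : Type*} [TopologicalSpace Y] (S : Y → Y) (e : Y → X)
    (hA : IsClopen A) (hret : ∀ x, ∃ n, 0 < n ∧ φ^[n] x ∈ A) (hback : ∀ x, ∃ n, φ.symm^[n] x ∈ A)
    (hec : Continuous e) (heo : IsOpenMap e) (hei : Function.Injective e) (her : range e = A)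
    (heS : ∀ y, e (S y) = φ^[returnTime φ A (e y)] (e y)) :
    ∃ (r : Y → ℕ) (hr : ∀ y, 0 < r y), Continuous r ∧
      ∃ h : X ≃ₜ SuspSpace r, ∀ x, h (φ x) = suspMap S r hr (h x) := by
  set r : Y → ℕ := fun y => returnTime φ A (e y) with hrdef
  have hrc : Continuous r := (continuous_returnTime φ hA hret).comp hec
  have hr : ∀ y, 0 < r y := fun y => (returnTime_spec (hret (e y))).1
  have heA : ∀ y, e y ∈ A := fun y => her ▸ mem_range_self y
  -- The inverse of the conjugacy: start at the base point `e y` and flow for time `k`.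
  set g : SuspSpace r → X := fun p => φ^[p.1.2] (e p.1.1) with hg
  have hφi : ∀ n, Function.Injective φ^[n] := fun n => φ.injective.iterate n
  have hginj : Function.Injective g := by
    have aux : ∀ p q : SuspSpace r, p.1.2 ≤ q.1.2 → g p = g q → p = q := by
      rintro ⟨⟨y, k⟩, hk⟩ ⟨⟨y', k'⟩, hk'⟩ hle heq
      simp only [hg] at hk hk' hle heq
      obtain ⟨m, rfl⟩ := Nat.exists_eq_add_of_le hle
      rw [Function.iterate_add_apply] at heq
      have h1 := hφi k heq
      rcases Nat.eq_zero_or_pos m with rfl | hm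
      · have := hei h1
        subst this
        rfl
      · exact absurd (h1 ▸ heA y) (not_mem_of_lt_returnTime hm (lt_of_le_of_lt (by omega) hk'))
    intro p q h
    rcases le_total p.1.2 q.1.2 with hle | hle
    · exact aux p q hle h
    · exact (aux q p hle h.symm).symm
  have hgsurj : Function.Surjective g := by
    classical
    intro x
    -- The height of `x` is the time elapsed since the last visit to `A`, zero if `x` is in `A`. It
    -- is less than the roof, as otherwise the first return of the base point would be a later
    -- visit.
    set n := Nat.find (hback x) with hn
    have h1 : φ.symm^[n] x ∈ A := Nat.find_spec (hback x)
    obtain ⟨y, hy⟩ : φ.symm^[n] x ∈ range e := her ▸ h1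
    have h2 : φ^[n] (e y) = x := by
      rw [hy]; exact φ.toEquiv.right_inv.iterate _ _
    refine ⟨⟨(y, n), ?_⟩, h2⟩
    by_contra hlt
    have hle : r y ≤ n := not_lt.1 hlt
    have h3 : φ^[r y] (e y) ∈ A := (returnTime_spec (hret (e y))).2
    rw [hy, iterate_iterate_of_leftInverse φ.apply_symm_apply hle] at h3
    exact Nat.find_min (hback x) (m := n - r y) (by have := hr y; omega) h3
  have hgc : Continuous g := (continuous_iterate_uncurry φ).comp
    ((continuous_snd.comp continuous_subtype_val).prodMk
      (hec.comp (continuous_fst.comp continuous_subtype_val)))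
  have hgo : IsOpenMap g := by
    intro U hU
    obtain ⟨W, hW, rfl⟩ := isOpen_induced_iff.1 hU
    -- The heights are discrete, so openness is checked on each level, where `g` is an iterate of
    -- `φ` after `e`.
    have : g '' (Subtype.val ⁻¹' W) = ⋃ k, φ^[k] '' (e '' ({y | (y, k) ∈ W} ∩ {y | k < r y})) := by
      ext x
      simp only [mem_image, mem_iUnion]
      constructor
      · rintro ⟨⟨⟨y, k⟩, hk⟩, hp, rfl⟩
        exact ⟨k, _, ⟨y, ⟨hp, hk⟩, rfl⟩, rfl⟩
      · rintro ⟨k, _, ⟨y, ⟨hp, hk⟩, rfl⟩, rfl⟩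
        exact ⟨⟨(y, k), hk⟩, hp, rfl⟩
    rw [this]
    refine isOpen_iUnion fun k => ?_
    have hit : IsOpenMap φ^[k] := by
      induction k with
      | zero => exact IsOpenMap.id
      | succ k ih => rw [Function.iterate_succ]; exact ih.comp φ.isOpenMap
    refine hit _ (heo _ ((hW.preimage (Continuous.prodMk_left k)).inter ?_))
    exact (isOpen_discrete {n : ℕ | k < n}).preimage hrc
  let E : SuspSpace r ≃ₜ X := (Equiv.ofBijective g ⟨hginj, hgsurj⟩).toHomeomorphOfContinuousOpen
    hgc hgo
  refine ⟨r, hr, hrc, E.symm, fun x => ?_⟩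
  obtain ⟨p, rfl⟩ := E.surjective x
  rw [E.symm_apply_apply, E.symm_apply_eq]
  change φ (g p) = g (suspMap S r hr p)
  unfold suspMap
  split_ifs with h
  · exact (Function.iterate_succ_apply' _ _ _).symm
  · have h1 : p.1.2 + 1 = r p.1.1 := by have := p.2; omega
    change _ = e (S p.1.1)
    rw [heS]
    change _ = φ^[r p.1.1] _
    rw [← h1, Function.iterate_succ_apply']

end ReturnTime

/-! ### The topology of the spaces of geodesics -/

section GeodTopology

variable {V : Type u} {G : SimpleGraph V}

lemma isOpen_vert_mem (n : ℤ) (s : Set V) : IsOpen {l : Geod G | l.vert n ∈ s} := by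
  let : TopologicalSpace V := ⊥
  have : DiscreteTopology V := ⟨rfl⟩
  have : Continuous fun l : Geod G => l.vert n :=
    (continuous_apply n).comp continuous_induced_dom
  exact (isOpen_discrete s).preimage this

lemma continuous_geod {X : Type*} [TopologicalSpace X] {g : X → Geod G}
    (h : ∀ n v, IsOpen {x | (g x).vert n = v}) : Continuous g := by
  let : TopologicalSpace V := ⊥
  have : DiscreteTopology V := ⟨rfl⟩
  refine continuous_induced_rng.2 (continuous_pi fun n => ?_)
  exact continuous_discrete_rng.2 fun v => h n v

lemma exists_window {U : Set (Geod G)} (hU : IsOpen U) {l : Geod G} (hl : l ∈ U) :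
    ∃ N : ℕ, ∀ l' : Geod G, (∀ n : ℤ, n.natAbs ≤ N → l'.vert n = l.vert n) → l' ∈ U := by
  let : TopologicalSpace V := ⊥
  have : DiscreteTopology V := ⟨rfl⟩
  obtain ⟨W, hW, rfl⟩ := isOpen_induced_iff.1 hU
  obtain ⟨I, w, hw, hIW⟩ := isOpen_pi_iff.1 hW _ hl
  refine ⟨I.sup Int.natAbs, fun l' h => hIW fun n hn => ?_⟩
  rw [h n (Finset.le_sup (f := Int.natAbs) hn)]
  exact (hw n hn).2

lemma continuous_shift : Continuous (Geod.shift : Geod G → Geod G) :=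
  continuous_geod fun n v => isOpen_vert_mem (n + 1) {v}

lemma continuous_geodMap (g : G ≃g G) : Continuous (Geod.map g) :=
  continuous_geod fun n v => isOpen_vert_mem n (g ⁻¹' {v})

/-- The inverse of the geodesic transformation. -/
def shiftInv (l : Geod G) : Geod G where
  vert n := l.vert (n - 1)
  adj n := by simpa using l.adj (n - 1)
  inj a b h := by have := l.inj h; omega

/-- The geodesic transformation as a homeomorphism. -/
def shiftHomeo (G : SimpleGraph V) : Geod G ≃ₜ Geod G where
  toFun := Geod.shift
  invFun := shiftInv
  left_inv l := Geod.ext (funext fun n => by simp [Geod.shift, shiftInv])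
  right_inv l := Geod.ext (funext fun n => by simp [Geod.shift, shiftInv])
  continuous_toFun := continuous_shift
  continuous_invFun := continuous_geod fun n v => isOpen_vert_mem (n - 1) {v}

lemma shift_iterate_vert (l : Geod G) (k : ℕ) (n : ℤ) :
    (Geod.shift^[k] l).vert n = l.vert (n + k) := by
  induction k generalizing l with
  | zero => simp
  | succ k ih =>
    rw [Function.iterate_succ_apply, ih]
    simp only [Geod.shift]
    congr 1; push_cast; ring

lemma shiftInv_iterate_vert (l : Geod G) (k : ℕ) (n : ℤ) :
    (shiftInv^[k] l).vert n = l.vert (n - k) := by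
  induction k generalizing l with
  | zero => simp
  | succ k ih =>
    rw [Function.iterate_succ_apply, ih]
    simp only [shiftInv]
    congr 1; push_cast; ring

variable {Γ : Type w} [Group Γ] (ρ : Γ →* (G ≃g G))

lemma projGeod_eq_iff {l l' : Geod G} : projGeod ρ l = projGeod ρ l' ↔ ∃ γ, l.map (ρ γ) = l' :=
  Quotient.eq (r := geodSetoid ρ)

lemma continuous_projGeod : Continuous (projGeod ρ) := continuous_quotient_mk'

lemma projGeod_surjective : Function.Surjective (projGeod ρ) := Quotient.mk_surjective

lemma isQuotientMap_projGeod : IsQuotientMap (projGeod ρ) := isQuotientMap_quotient_mk'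

lemma isOpenMap_projGeod : IsOpenMap (projGeod ρ) := by
  intro U hU
  rw [← (isQuotientMap_projGeod ρ).isOpen_preimage]
  have : projGeod ρ ⁻¹' (projGeod ρ '' U) = ⋃ γ, Geod.map (ρ γ) ⁻¹' U := by
    ext l
    simp only [mem_preimage, mem_image, mem_iUnion]
    constructor
    · rintro ⟨l', hl', h⟩
      obtain ⟨γ, hγ⟩ := (projGeod_eq_iff ρ).1 h.symm
      exact ⟨γ, hγ ▸ hl'⟩
    · rintro ⟨γ, hγ⟩
      exact ⟨_, hγ, ((projGeod_eq_iff ρ).2 ⟨γ, rfl⟩).symm⟩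
  rw [this]
  exact isOpen_iUnion fun γ => hU.preimage (continuous_geodMap _)

/-- The geodesic transformation of the quotient as a homeomorphism. -/
def quotShiftHomeo : QuotGeod ρ ≃ₜ QuotGeod ρ where
  toFun := QuotGeod.shift ρ
  invFun := Quotient.map' (s₁ := geodSetoid ρ) (s₂ := geodSetoid ρ) shiftInv (by
    rintro a b ⟨γ, rfl⟩
    exact ⟨γ, rfl⟩)
  left_inv q := by
    induction q using Quotient.inductionOn with
    | h l => exact congrArg (projGeod ρ) ((shiftHomeo G).left_inv l)
  right_inv q := by
    induction q using Quotient.inductionOn with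
    | h l => exact congrArg (projGeod ρ) ((shiftHomeo G).right_inv l)
  continuous_toFun := (isQuotientMap_projGeod ρ).continuous_iff.2
    ((continuous_projGeod ρ).comp continuous_shift)
  continuous_invFun := (isQuotientMap_projGeod ρ).continuous_iff.2
    ((continuous_projGeod ρ).comp (shiftHomeo G).symm.continuous)

lemma quotShift_iterate (l : Geod G) (k : ℕ) :
    (QuotGeod.shift ρ)^[k] (projGeod ρ l) = projGeod ρ (Geod.shift^[k] l) := by
  induction k generalizing l with
  | zero => rfl
  | succ k ih => rw [Function.iterate_succ_apply, Function.iterate_succ_apply, ← ih]; rfl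

lemma quotShift_symm_iterate (l : Geod G) (k : ℕ) :
    (quotShiftHomeo ρ).symm^[k] (projGeod ρ l) = projGeod ρ (shiftInv^[k] l) := by
  induction k generalizing l with
  | zero => rfl
  | succ k ih => rw [Function.iterate_succ_apply, Function.iterate_succ_apply, ← ih]; rfl

end GeodTopology


/-! ### Geodesics of the tree and of the collapsed tree -/

lemma le_of_strictMono_int {s : ℤ → ℤ} (hs : StrictMono s) (h0 : s 0 = 0) {n : ℤ} (hn : 0 ≤ n) :
    n ≤ s n := by
  induction n, hn using Int.leInduction with
  | base => exact h0.ge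
  | succ n hn ih => have := hs (show n < n + 1 by omega); omega

lemma ge_of_strictMono_int {s : ℤ → ℤ} (hs : StrictMono s) (h0 : s 0 = 0) {n : ℤ} (hn : n ≤ 0) :
    s n ≤ n := by
  induction n, hn using Int.leInductionDown with
  | base => exact h0.le
  | pred n hn ih => have := hs (show n - 1 < n by omega); omega

section Crossings

variable {V : Type u} {T : SimpleGraph V} {Γ : Type w} [Group Γ] {ρ : Γ →* (T ≃g T)}
  (D : CuspidalDecomposition ρ)

/-- The `n`-th edge of the geodesic is not collapsed. -/
def Crosses (l : Geod T) (n : ℤ) : Prop := coll D (l.vert n) ≠ coll D (l.vert (n + 1))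

/-- The geodesics of the minimal subtree that leave the horoballs infinitely often in both
directions. -/
def recSet : Set (Geod T) :=
  {l | (∀ n, l.vert n ∈ minSubtree ρ) ∧
    ∀ N : ℤ, (∃ n, N ≤ n ∧ Crosses D l n) ∧ ∃ n, n ≤ N ∧ Crosses D l n}

/-- The image of `recSet` in the quotient. -/
def recQuot : Set (QuotGeod ρ) := projGeod ρ '' recSet D

lemma crosses_shift (l : Geod T) (n : ℤ) : Crosses D l.shift n ↔ Crosses D l (n + 1) := Iff.rfl

lemma crosses_shift_iterate (l : Geod T) (k : ℕ) (n : ℤ) :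
    Crosses D (Geod.shift^[k] l) n ↔ Crosses D l (n + k) := by
  simp only [Crosses, shift_iterate_vert, show n + 1 + (k : ℤ) = n + k + 1 by ring]

lemma crosses_shiftInv_iterate (l : Geod T) (k : ℕ) (n : ℤ) :
    Crosses D (shiftInv^[k] l) n ↔ Crosses D l (n - k) := by
  simp only [Crosses, shiftInv_iterate_vert, show n + 1 - (k : ℤ) = n - k + 1 by ring]

lemma isClopen_crosses (n : ℤ) : IsClopen {l : Geod T | Crosses D l n} := by
  have h : ∀ P : V → V → Prop, IsOpen {l : Geod T | P (l.vert n) (l.vert (n + 1))} := by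
    intro P
    have : {l : Geod T | P (l.vert n) (l.vert (n + 1))} =
        ⋃ a : V, {l | l.vert n ∈ ({a} : Set V)} ∩ {l | l.vert (n + 1) ∈ {b | P a b}} := by
      ext l; simp
    rw [this]
    exact isOpen_iUnion fun a => (isOpen_vert_mem _ _).inter (isOpen_vert_mem _ _)
  exact ⟨⟨h fun a b => ¬ coll D a ≠ coll D b⟩, h fun a b => coll D a ≠ coll D b⟩

variable {D}

lemma mem_recSet_shift {l : Geod T} : l ∈ recSet D ↔ shiftHomeo T l ∈ recSet D := by
  constructor
  · rintro ⟨h1, h2⟩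
    refine ⟨fun n => h1 (n + 1), fun N => ⟨?_, ?_⟩⟩
    · obtain ⟨n, hn, hc⟩ := (h2 (N + 1)).1
      exact ⟨n - 1, by omega, (crosses_shift D l _).2 (by rwa [sub_add_cancel])⟩
    · obtain ⟨n, hn, hc⟩ := (h2 (N + 1)).2
      exact ⟨n - 1, by omega, (crosses_shift D l _).2 (by rwa [sub_add_cancel])⟩
  · rintro ⟨h1, h2⟩
    refine ⟨fun n => by have := h1 (n - 1); simpa [shiftHomeo, Geod.shift] using this,
      fun N => ⟨?_, ?_⟩⟩
    · obtain ⟨n, hn, hc⟩ := (h2 N).1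
      exact ⟨n + 1, by omega, (crosses_shift D l _).1 hc⟩
    · obtain ⟨n, hn, hc⟩ := (h2 (N - 1)).2
      exact ⟨n + 1, by omega, (crosses_shift D l _).1 hc⟩

variable (D) in
/-- The geodesic transformation of `recSet`. -/
def recShift : recSet D ≃ₜ recSet D := (shiftHomeo T).subtype fun _ => mem_recSet_shift

lemma recShift_iterate (l : recSet D) (k : ℕ) :
    ((recShift D)^[k] l).1 = Geod.shift^[k] l.1 := by
  induction k with
  | zero => rfl
  | succ k ih => rw [Function.iterate_succ_apply', Function.iterate_succ_apply', ← ih]; rfl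

lemma recShift_symm_iterate (l : recSet D) (k : ℕ) :
    ((recShift D).symm^[k] l).1 = shiftInv^[k] l.1 := by
  induction k with
  | zero => rfl
  | succ k ih => rw [Function.iterate_succ_apply', Function.iterate_succ_apply', ← ih]; rfl

variable (D) in
/-- The geodesics of `recSet` whose initial edge is not collapsed. -/
def recBase : Set (recSet D) := {l | Crosses D l.1 0}

variable (D) in
lemma isClopen_recBase : IsClopen (recBase D) :=
  (isClopen_crosses D 0).preimage continuous_subtype_val

lemma recShift_iterate_mem {l : recSet D} {k : ℕ} :
    (recShift D)^[k] l ∈ recBase D ↔ Crosses D l.1 k := by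
  rw [recBase, mem_ofPred_eq, recShift_iterate, crosses_shift_iterate, zero_add]

lemma recShift_symm_iterate_mem {l : recSet D} {k : ℕ} :
    (recShift D).symm^[k] l ∈ recBase D ↔ Crosses D l.1 (-k) := by
  rw [recBase, mem_ofPred_eq, recShift_symm_iterate, crosses_shiftInv_iterate, zero_sub]

lemma exists_recShift_mem (l : recSet D) : ∃ n, 0 < n ∧ (recShift D)^[n] l ∈ recBase D := by
  obtain ⟨n, hn, hc⟩ := (l.2.2 1).1
  refine ⟨n.toNat, by omega, recShift_iterate_mem.2 ?_⟩
  rwa [Int.toNat_of_nonneg (by omega)]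

lemma exists_recShift_symm_mem (l : recSet D) :
    ∃ n, 0 < n ∧ (recShift D).symm^[n] l ∈ recBase D := by
  obtain ⟨n, hn, hc⟩ := (l.2.2 (-1)).2
  refine ⟨(-n).toNat, by omega, recShift_symm_iterate_mem.2 ?_⟩
  rwa [Int.toNat_of_nonneg (by omega), neg_neg]

variable (D) in
/-- The first return homeomorphism of `recBase`. -/
noncomputable def recReturn : recBase D ≃ₜ recBase D :=
  returnHomeo (recShift D) (isClopen_recBase D) exists_recShift_mem exists_recShift_symm_mem

variable (D) in
/-- The first return time of a geodesic of `recBase`. -/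
noncomputable def recTime (l : recBase D) : ℕ := returnTime (recShift D) (recBase D) l.1

lemma recTime_pos (l : recBase D) : 0 < recTime D l := (returnTime_spec (exists_recShift_mem _)).1

lemma recReturn_vert (l : recBase D) (n : ℤ) :
    (recReturn D l).1.1.vert n = l.1.1.vert (n + recTime D l) := by
  rw [← shift_iterate_vert, ← recShift_iterate]; rfl

lemma recReturn_symm_vert (l : recBase D) :
    ∃ t, ∀ n, ((recReturn D).symm l).1.1.vert n = l.1.1.vert (n + t) := by
  refine ⟨-recTime D ((recReturn D).symm l), fun n => ?_⟩
  conv_rhs => rw [← (recReturn D).apply_symm_apply l]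
  rw [recReturn_vert, (recReturn D).apply_symm_apply l, neg_add_cancel_right]

lemma coll_vert_of_le_recTime (l : recBase D) {n : ℕ} (hn : 0 < n) (h : n ≤ recTime D l) :
    coll D (l.1.1.vert n) = coll D (l.1.1.vert 1) := by
  induction n, hn using Nat.le_induction with
  | base => simp
  | succ n hn ih =>
    rw [← ih (by omega)]
    have := not_mem_of_lt_returnTime (φ := recShift D) (A := recBase D) (x := l.1) (n := n)
      (by omega) h
    rw [recShift_iterate_mem, Crosses, not_not] at this
    push_cast
    exact this.symm

lemma coll_recReturn (l : recBase D) :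
    coll D ((recReturn D l).1.1.vert 0) = coll D (l.1.1.vert 1) := by
  rw [recReturn_vert, zero_add, coll_vert_of_le_recTime l (recTime_pos l) le_rfl]

variable (H : IsNonElementaryAction ρ)

/-! #### From geodesics of the tree to geodesics of the collapsed tree -/

include H in
-- Backtracking in the collapsed tree would mean that two successive crossings are along the same
-- lifted edge, in opposite directions, which the injectivity of the geodesic excludes.
lemma coll_recReturn_ne (l : recBase D) :
    coll D (l.1.1.vert 0) ≠ coll D ((recReturn D (recReturn D l)).1.1.vert 0) := by
  intro h
  rw [coll_recReturn] at h
  have hl := l.1.2.1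
  have hr := (recReturn D l).1.2.1
  have h1 : Crosses D l.1.1 0 := l.2
  have h2 := lift_unique H (hl 0) (hl 1) (hr 1) (hr 0) (l.1.1.adj 0)
    ((recReturn D l).1.1.adj 0).symm h1 h (coll_recReturn l).symm
  have h3 := h2.1
  rw [recReturn_vert] at h3
  have := l.1.1.inj h3
  omega

/-- The image of a geodesic in the collapsed tree, parametrized by its non-collapsed edges. -/
noncomputable def collGeod (l : recBase D) : Geod (collTree D) where
  vert j := coll D (((recReturn D ^ j) l).1.1.vert 0)
  adj j := by
    rw [zpow_add_one, (Commute.refl (recReturn D)).zpow_left j |>.eq]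
    change (collTree D).Adj _ (coll D ((recReturn D ((recReturn D ^ j) l)).1.1.vert 0))
    rw [coll_recReturn]
    set m := (recReturn D ^ j) l
    exact coll_adj_of (m.1.2.1 0) (m.1.2.1 1) (m.1.1.adj 0) m.2
  inj := by
    refine injective_of_locally_injective_int (collTree_isTree (D := D) H) (fun j => ?_)
      fun j => ?_
    · rw [zpow_add_one, (Commute.refl (recReturn D)).zpow_left j |>.eq]
      change (collTree D).Adj _ (coll D ((recReturn D ((recReturn D ^ j) l)).1.1.vert 0))
      rw [coll_recReturn]
      set m := (recReturn D ^ j) l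
      exact coll_adj_of (m.1.2.1 0) (m.1.2.1 1) (m.1.1.adj 0) m.2
    · rw [add_comm j 2, zpow_add]
      exact coll_recReturn_ne H ((recReturn D ^ j) l)

lemma continuous_collGeod : Continuous (collGeod (D := D) H) := by
  refine continuous_geod fun n v => ?_
  have h1 : Continuous fun l : recBase D => ((recReturn D ^ n) l).1.1 :=
    continuous_subtype_val.comp (continuous_subtype_val.comp (recReturn D ^ n).continuous)
  exact (isOpen_vert_mem 0 (coll D ⁻¹' {v})).preimage h1

/-! #### From geodesics of the collapsed tree to geodesics of the tree -/

open Classical in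
variable (D) in
/-- The origin of the lift of an edge. -/
noncomputable def liftSrc (x y : CollVert D) : V :=
  if h : (collTree D).Adj x y then h.2.choose else Quotient.out (s := collSetoid D) x

lemma liftSrc_spec {x y : CollVert D} (h : (collTree D).Adj x y) :
    liftSrc D x y ∈ minSubtree ρ ∧ ∃ b ∈ minSubtree ρ, T.Adj (liftSrc D x y) b ∧
      coll D (liftSrc D x y) = x ∧ coll D b = y := by
  rw [liftSrc, dif_pos h]
  exact h.2.choose_spec

include H in
lemma liftSrc_coll {a b : V} (ha : a ∈ minSubtree ρ) (hb : b ∈ minSubtree ρ) (h : T.Adj a b)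
    (hne : coll D a ≠ coll D b) : liftSrc D (coll D a) (coll D b) = a := by
  obtain ⟨h1, c, hc, h2, h3, h4⟩ := liftSrc_spec (coll_adj_of ha hb h hne)
  exact (lift_unique H ha hb h1 hc h h2 hne h3.symm h4.symm).1.symm

lemma liftSrc_act (γ : Γ) {x y : CollVert D} (h : (collTree D).Adj x y) :
    liftSrc D (collAct D H γ x) (collAct D H γ y) = ρ γ (liftSrc D x y) := by
  obtain ⟨h1, c, hc, h2, h3, h4⟩ := liftSrc_spec h
  have h5 : liftSrc D (collAct D H γ x) (collAct D H γ y) =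
      liftSrc D (coll D (ρ γ (liftSrc D x y))) (coll D (ρ γ c)) := by
    rw [← collAct_coll H, ← collAct_coll H, h3, h4]
  rw [h5]
  refine liftSrc_coll H (min_act ρ H.tree γ h1) (min_act ρ H.tree γ hc) ((act_adj ρ).2 h2) ?_
  rw [← collAct_coll H, ← collAct_coll H, (collAct D H γ).injective.ne_iff, h3, h4]
  exact h.ne

include H in
lemma coll_eq_of_btw {x y z : V} (hx : x ∈ minSubtree ρ) (hy : y ∈ minSubtree ρ)
    (h : coll D x = coll D y) (hz : Between T x z y) : coll D z = coll D x := by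
  rcases (coll_eq_iff H hx hy).1 h with rfl | h'
  · unfold Between at hz
    rw [T.dist_self, T.dist_comm] at hz
    rw [(tdist_eq_zero H.tree).1 (show T.dist z x = 0 by omega)]
  · exact (coll_eq_iff H (min_convex ρ H.tree _ hx _ hy _ hz) hx).2 (Or.inr (h'.mid H hz).symm)

/-- The origins of the lifts of the edges of a geodesic. -/
noncomputable def liftPts (l : Geod (collTree D)) (j : ℤ) : V :=
  liftSrc D (l.vert j) (l.vert (j + 1))

lemma coll_liftPts (l : Geod (collTree D)) (j : ℤ) : coll D (liftPts l j) = l.vert j := by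
  obtain ⟨h1, c, hc, h2, h3, h4⟩ := liftSrc_spec (l.adj j)
  exact h3

lemma liftPts_mem (l : Geod (collTree D)) (j : ℤ) : liftPts l j ∈ minSubtree ρ :=
  (liftSrc_spec (l.adj j)).1

include H in
/-- The lift of an edge of a geodesic. -/
lemma exists_liftTgt (l : Geod (collTree D)) (j : ℤ) : ∃ b ∈ minSubtree ρ,
    T.Adj (liftPts l j) b ∧ coll D b = l.vert (j + 1) ∧
      Between T (liftPts l j) b (liftPts l (j + 1)) := by
  obtain ⟨h1, b, hb, h2, h3, h4⟩ := liftSrc_spec (l.adj j)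
  refine ⟨b, hb, h2, h4, btw_of_adj_of_lt H.tree h2 ?_⟩
  refine same_side (D := D) H hb h1 h2.symm ?_ hb (liftPts_mem l (j + 1)) ?_ ?_
  · rw [coll_liftPts, h4]; exact (l.adj j).ne'
  · rw [h4, coll_liftPts]
  · rw [T.dist_self]; exact H.tree.connected.pos_dist_of_ne h2.ne'

include H in
-- The lift of the edge number `j + 1` separates its predecessor from its successor. On the initial
-- side, `same_side` handles the end of the previous lift, and its origin could only be across by
-- coinciding with the next target, which would be a backtracking of `l`.
lemma liftPts_isChainPts (l : Geod (collTree D)) : IsChainPts T (liftPts l) := by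
  intro j
  have hT := H.tree
  refine ⟨fun h => (l.adj j).ne ?_, ?_⟩
  · rw [← coll_liftPts, h, coll_liftPts]
  obtain ⟨b, hb, hab, hbc, hbb⟩ := exists_liftTgt H l j
  obtain ⟨b', hb', hab', hbc', hbb'⟩ := exists_liftTgt H l (j + 1)
  rw [show j + 1 + 1 = j + 2 by ring] at hbb' hbc'
  have hne : coll D (liftPts l (j + 1)) ≠ coll D b' := by
    rw [coll_liftPts, hbc', show j + 2 = j + 1 + 1 by ring]; exact (l.adj (j + 1)).ne
  have h1 : T.dist b (liftPts l (j + 1)) < T.dist b b' := by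
    refine same_side H (liftPts_mem l _) hb' hab' hne (liftPts_mem l (j + 1)) hb ?_ ?_
    · rw [coll_liftPts, hbc]
    · rw [T.dist_self]; exact hT.connected.pos_dist_of_ne hab'.ne
  have h2 : T.dist (liftPts l j) (liftPts l (j + 1)) < T.dist (liftPts l j) b' := by
    by_contra hcon
    have h3 : T.dist (liftPts l j) b' < T.dist (liftPts l j) (liftPts l (j + 1)) := by
      rcases dist_adj_cases hT hab' (liftPts l j) with h4 | h4 <;> omega
    have h5 := dist_across hT hab' h1 h3
    rw [T.dist_comm, SimpleGraph.dist_eq_one_iff_adj.2 hab] at h5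
    have h6 : b' = liftPts l j := (tdist_eq_zero hT).1 (by omega)
    have h7 : l.vert j = l.vert (j + 2) := by rw [← hbc', h6, coll_liftPts]
    have := l.inj h7
    omega
  have h8 := lt_of_btw_adj hab' hbb'
  have h9 := dist_across hT hab' h2 h8
  have h10 := SimpleGraph.dist_eq_one_iff_adj.2 hab'
  unfold Between at hbb' ⊢
  omega

/-- The lift of a geodesic of the collapsed tree. -/
noncomputable def liftGeod (l : Geod (collTree D)) : Geod T := (liftPts_isChainPts H l).line H.tree

/-- The times at which the lift of a geodesic crosses the lifts of its edges. -/
noncomputable def liftTimes (l : Geod (collTree D)) : ℤ → ℤ :=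
  ((liftPts_isChainPts H l).exists_times H.tree).choose

lemma liftTimes_spec (l : Geod (collTree D)) : StrictMono (liftTimes H l) ∧
    liftTimes H l 0 = 0 ∧ ∀ j, (liftGeod H l).vert (liftTimes H l j) = liftPts l j :=
  ((liftPts_isChainPts H l).exists_times H.tree).choose_spec

lemma liftGeod_eq {l : Geod (collTree D)} {m : Geod T} {s : ℤ → ℤ} (hs : StrictMono s)
    (hs0 : s 0 = 0) (h : ∀ j, m.vert (s j) = liftPts l j) : liftGeod H l = m :=
  (liftPts_isChainPts H l).line_unique H.tree hs hs0 h

lemma liftGeod_mem (l : Geod (collTree D)) (n : ℤ) : (liftGeod H l).vert n ∈ minSubtree ρ := by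
  obtain ⟨hs, hs0, hl⟩ := liftTimes_spec H l
  have key : ∀ a b : ℤ, liftTimes H l a ≤ n → n ≤ liftTimes H l b →
      (liftGeod H l).vert n ∈ minSubtree ρ := by
    intro a b ha hb
    refine min_convex ρ H.tree _ (liftPts_mem l a) _ (liftPts_mem l b) _ ?_
    rw [← hl a, ← hl b]
    exact Geod.btw H.tree _ ha hb
  rcases le_total 0 n with hn | hn
  · exact key 0 n (by omega) (le_of_strictMono_int hs hs0 hn)
  · exact key n 0 (ge_of_strictMono_int hs hs0 hn) (by omega)

/-- The image in the collapsed tree of the lift of a geodesic. -/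
lemma coll_liftGeod (l : Geod (collTree D)) {j n : ℤ} (h : liftTimes H l j < n)
    (h' : n ≤ liftTimes H l (j + 1)) : coll D ((liftGeod H l).vert n) = l.vert (j + 1) := by
  obtain ⟨hs, hs0, hl⟩ := liftTimes_spec H l
  obtain ⟨b, hb, hab, hbc, hbb⟩ := exists_liftTgt H l j
  have h1 := hs (show j < j + 1 by omega)
  -- Just after passing at the origin of a lifted edge, the geodesic passes at its end, being
  -- aligned with the next point. From there to the next crossing it stays in a set with constant
  -- image.
  have h2 : (liftGeod H l).vert (liftTimes H l j + 1) = b := by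
    have h3 := Geod.btw H.tree (liftGeod H l) (show liftTimes H l j ≤ liftTimes H l j + 1 by omega)
      (show liftTimes H l j + 1 ≤ liftTimes H l (j + 1) by omega)
    rw [hl j, hl (j + 1)] at h3
    refine btw_unique H.tree h3 hbb ?_
    rw [SimpleGraph.dist_eq_one_iff_adj.2 hab, ← hl j]
    exact SimpleGraph.dist_eq_one_iff_adj.2 ((liftGeod H l).adj _)
  rw [← hbc]
  refine coll_eq_of_btw H hb (liftPts_mem l (j + 1)) (by rw [hbc, coll_liftPts]) ?_
  rw [← h2, ← hl (j + 1)]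
  exact Geod.btw H.tree _ (by omega) h'

lemma liftGeod_crosses (l : Geod (collTree D)) (j : ℤ) :
    Crosses D (liftGeod H l) (liftTimes H l j) := by
  obtain ⟨hs, hs0, hl⟩ := liftTimes_spec H l
  have h1 := hs (show j < j + 1 by omega)
  rw [Crosses, coll_liftGeod H l (j := j) (n := liftTimes H l j + 1) (by omega) (by omega), hl, coll_liftPts]
  exact (l.adj j).ne

lemma liftGeod_not_crosses (l : Geod (collTree D)) {j n : ℤ} (h : liftTimes H l j < n)
    (h' : n < liftTimes H l (j + 1)) : ¬ Crosses D (liftGeod H l) n := by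
  rw [Crosses, not_not, coll_liftGeod H l h h'.le,
    coll_liftGeod H l (j := j) (n := n + 1) (by omega) (by omega)]

lemma liftGeod_mem_recSet (l : Geod (collTree D)) : liftGeod H l ∈ recSet D := by
  obtain ⟨hs, hs0, hl⟩ := liftTimes_spec H l
  refine ⟨liftGeod_mem H l, fun N => ⟨⟨_, ?_, liftGeod_crosses H l (max N 0)⟩,
    ⟨_, ?_, liftGeod_crosses H l (min N 0)⟩⟩⟩
  · have := le_of_strictMono_int hs hs0 (le_max_right N 0)
    omega
  · have := ge_of_strictMono_int hs hs0 (min_le_right N 0)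
    omega

/-- The lift of a geodesic, as an element of `recBase`. -/
noncomputable def liftBase (l : Geod (collTree D)) : recBase D :=
  ⟨⟨liftGeod H l, liftGeod_mem_recSet H l⟩, by
    have := liftGeod_crosses H l 0
    rwa [(liftTimes_spec H l).2.1] at this⟩

lemma recTime_liftBase (l : Geod (collTree D)) :
    (recTime D (liftBase H l) : ℤ) = liftTimes H l 1 := by
  obtain ⟨hs, hs0, hl⟩ := liftTimes_spec H l
  have h1 := hs (show (0 : ℤ) < 1 by omega)
  have : recTime D (liftBase H l) = (liftTimes H l 1).toNat := by
    refine returnTime_eq (by omega) ?_ fun m hm hm' => ?_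
    · rw [recShift_iterate_mem, Int.toNat_of_nonneg (by omega)]
      exact liftGeod_crosses H l 1
    · rw [recShift_iterate_mem]
      exact liftGeod_not_crosses H l (j := 0) (by omega) (by rw [zero_add]; omega)
  omega

/-- Both geodesics pass in order through the lifted points of the shifted geodesic, starting at the
first of them at time 0, and such a geodesic is unique. -/
lemma recReturn_liftBase (l : Geod (collTree D)) :
    recReturn D (liftBase H l) = liftBase H l.shift := by
  obtain ⟨hs, hs0, hl⟩ := liftTimes_spec H l
  refine Subtype.ext (Subtype.ext (Eq.symm ?_))
  refine liftGeod_eq H (s := fun j => liftTimes H l (j + 1) - liftTimes H l 1)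
    (fun i j hij => ?_) (by simp) fun j => ?_
  · have := hs (show i + 1 < j + 1 by omega)
    simp only
    omega
  · rw [recReturn_vert, recTime_liftBase, sub_add_cancel]
    exact hl (j + 1)

lemma recReturn_zpow_liftBase (l : Geod (collTree D)) (j : ℤ) :
    (recReturn D ^ j) (liftBase H l) = liftBase H ((shiftHomeo (collTree D) ^ j) l) := by
  have hsymm : ∀ l, (recReturn D)⁻¹ (liftBase H l) =
      liftBase H ((shiftHomeo (collTree D))⁻¹ l) := by
    intro l
    refine (recReturn D).symm_apply_eq.2 ?_
    rw [recReturn_liftBase]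
    exact congrArg (liftBase H) ((shiftHomeo (collTree D)).apply_symm_apply l).symm
  induction j using Int.induction_on generalizing l with
  | zero => rfl
  | succ j ih =>
    rw [zpow_add_one, zpow_add_one]
    exact (congrArg _ (recReturn_liftBase H l)).trans (ih l.shift)
  | pred j ih =>
    rw [zpow_sub_one, zpow_sub_one]
    exact (congrArg _ (hsymm l)).trans (ih _)

lemma shiftHomeo_zpow_vert {V : Type*} {G : SimpleGraph V} (l : Geod G) (j n : ℤ) :
    ((shiftHomeo G ^ j) l).vert n = l.vert (n + j) := by
  induction j using Int.induction_on generalizing l with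
  | zero => simp
  | succ j ih =>
    rw [zpow_add_one]
    refine (ih l.shift).trans ?_
    simp only [Geod.shift]
    congr 1; ring
  | pred j ih =>
    rw [zpow_sub_one]
    refine (ih (shiftInv l)).trans ?_
    simp only [shiftInv]
    congr 1; ring

lemma collGeod_liftBase (l : Geod (collTree D)) : collGeod H (liftBase H l) = l := by
  refine Geod.ext (funext fun j => ?_)
  change coll D (((recReturn D ^ j) (liftBase H l)).1.1.vert 0) = _
  rw [recReturn_zpow_liftBase]
  set l' := (shiftHomeo (collTree D) ^ j) l with hl'
  have h := (liftTimes_spec H l').2.2 0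
  rw [(liftTimes_spec H l').2.1] at h
  change coll D ((liftGeod H l').vert 0) = _
  rw [h, coll_liftPts, hl', shiftHomeo_zpow_vert, zero_add]

lemma recReturn_zpow_vert (l : recBase D) (j : ℤ) :
    ∃ t, ∀ n, ((recReturn D ^ j) l).1.1.vert n = l.1.1.vert (n + t) := by
  induction j using Int.induction_on generalizing l with
  | zero => exact ⟨0, fun n => by simp⟩
  | succ j ih =>
    obtain ⟨t, ht⟩ := ih (recReturn D l)
    rw [zpow_add_one]
    refine ⟨t + recTime D l, fun n => (ht n).trans ?_⟩
    rw [recReturn_vert, add_assoc]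
  | pred j ih =>
    obtain ⟨t, ht⟩ := ih ((recReturn D).symm l)
    obtain ⟨t', ht'⟩ := recReturn_symm_vert l
    rw [zpow_sub_one]
    refine ⟨t + t', fun n => (ht n).trans ?_⟩
    rw [ht', add_assoc]

/-- The cumulated return times `s j` are the times at which `l` passes at the lifts of the edges of
its image; uniqueness of the line through these points concludes. -/
lemma liftBase_collGeod (l : recBase D) : liftBase H (collGeod H l) = l := by
  choose s hs using recReturn_zpow_vert l
  have hsucc : ∀ j, s (j + 1) = s j + recTime D ((recReturn D ^ j) l) := by
    intro j
    have h1 := hs (j + 1) 0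
    rw [zpow_add_one, (Commute.refl (recReturn D)).zpow_left j |>.eq] at h1
    change (recReturn D ((recReturn D ^ j) l)).1.1.vert 0 = _ at h1
    rw [recReturn_vert, hs] at h1
    have := l.1.1.inj h1
    omega
  refine Subtype.ext (Subtype.ext (liftGeod_eq H (s := s) ?_ ?_ fun j => ?_))
  · refine strictMono_int_of_lt_succ fun j => ?_
    rw [hsucc]
    have := recTime_pos ((recReturn D ^ j) l)
    omega
  · have := hs 0 0
    rw [zpow_zero] at this
    have := l.1.1.inj this
    omega
  · have h0 := hs j 0
    rw [zero_add] at h0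
    rw [← h0]
    set m := (recReturn D ^ j) l with hm
    have h1 : (collGeod H l).vert j = coll D (m.1.1.vert 0) := rfl
    have h2 : (collGeod H l).vert (j + 1) = coll D (m.1.1.vert 1) := by
      rw [← coll_recReturn, hm]
      change coll D (((recReturn D ^ (j + 1)) l).1.1.vert 0) = _
      rw [zpow_add_one, (Commute.refl (recReturn D)).zpow_left j |>.eq]
      rfl
    rw [liftPts, h1, h2]
    exact (liftSrc_coll H (m.1.2.1 0) (m.1.2.1 1) (m.1.1.adj 0) m.2).symm

/-- By the choice made in `lineVert`, the vertex of index `n` of the lift depends only on the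
vertices of index `0`, `1`, `n` and `n + 1`. -/
lemma continuous_liftGeod : Continuous (liftGeod (D := D) H) := by
  refine continuous_geod fun n v => isOpen_iff_mem_nhds.2 fun l hl => ?_
  have hopen : IsOpen ({l' : Geod (collTree D) | l'.vert 0 ∈ ({l.vert 0} : Set _)} ∩
      {l' | l'.vert (0 + 1) ∈ ({l.vert (0 + 1)} : Set _)} ∩
      ({l' | l'.vert n ∈ ({l.vert n} : Set _)} ∩
      {l' | l'.vert (n + 1) ∈ ({l.vert (n + 1)} : Set _)})) :=
    ((isOpen_vert_mem _ _).inter (isOpen_vert_mem _ _)).inter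
      ((isOpen_vert_mem _ _).inter (isOpen_vert_mem _ _))
  refine mem_of_superset (hopen.mem_nhds ⟨⟨rfl, rfl⟩, ⟨rfl, rfl⟩⟩) ?_
  rintro l' ⟨⟨h1, h2⟩, ⟨h3, h4⟩⟩
  simp only [mem_ofPred_eq, mem_singleton_iff] at h1 h2 h3 h4 hl ⊢
  rw [← hl]
  change lineVert T (liftPts l') n = lineVert T (liftPts l) n
  simp only [lineVert, liftPts]
  rw [h1, h2, h3, h4]

lemma liftGeod_map (γ : Γ) (l : Geod (collTree D)) :
    liftGeod H (l.map (collAct D H γ)) = (liftGeod H l).map (ρ γ) := by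
  obtain ⟨hs, hs0, hl⟩ := liftTimes_spec H l
  refine liftGeod_eq H hs hs0 fun j => ?_
  change ρ γ ((liftGeod H l).vert (liftTimes H l j)) = _
  rw [hl]
  exact (liftSrc_act H γ (l.adj j)).symm

end Crossings


/-! ### The suspension on the quotient -/

section Quotient

variable {V : Type u} {T : SimpleGraph V} {Γ : Type w} [Group Γ] {ρ : Γ →* (T ≃g T)}
  {D : CuspidalDecomposition ρ} (H : IsNonElementaryAction ρ)
include H

lemma crosses_map_iff (γ : Γ) (l : Geod T) (n : ℤ) :
    Crosses D (l.map (ρ γ)) n ↔ Crosses D l n := by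
  refine not_congr ⟨fun h => ?_, fun h => coll_act_congr H γ h⟩
  have := coll_act_congr H γ⁻¹ h
  change coll D (ρ γ⁻¹ (ρ γ _)) = coll D (ρ γ⁻¹ (ρ γ _)) at this
  rwa [inv_act, inv_act] at this

lemma mem_recSet_map {γ : Γ} {l : Geod T} (h : l ∈ recSet D) : l.map (ρ γ) ∈ recSet D := by
  refine ⟨fun n => min_act ρ H.tree γ (h.1 n), fun N => ?_⟩
  simpa only [crosses_map_iff H] using h.2 N

lemma projGeod_mem_recQuot {l : Geod T} : projGeod ρ l ∈ recQuot D ↔ l ∈ recSet D := by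
  refine ⟨?_, fun h => ⟨l, h, rfl⟩⟩
  rintro ⟨l', hl', h⟩
  obtain ⟨γ, rfl⟩ := (projGeod_eq_iff ρ).1 h
  exact mem_recSet_map H hl'

lemma projGeod_mem_crosses {l : Geod T} {n : ℤ} :
    projGeod ρ l ∈ projGeod ρ '' {l | Crosses D l n} ↔ Crosses D l n := by
  refine ⟨?_, fun h => ⟨l, h, rfl⟩⟩
  rintro ⟨l', hl', h⟩
  obtain ⟨γ, rfl⟩ := (projGeod_eq_iff ρ).1 h
  exact (crosses_map_iff H γ l' n).2 hl'

lemma isClopen_image_crosses (n : ℤ) : IsClopen (projGeod ρ '' {l | Crosses D l n}) := by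
  refine ⟨⟨?_⟩, isOpenMap_projGeod ρ _ (isClopen_crosses D n).isOpen⟩
  have : (projGeod ρ '' {l | Crosses D l n})ᶜ = projGeod ρ '' {l | Crosses D l n}ᶜ := by
    ext q
    obtain ⟨l, rfl⟩ := projGeod_surjective ρ q
    rw [mem_compl_iff, projGeod_mem_crosses H]
    refine ⟨fun h => ⟨l, h, rfl⟩, ?_⟩
    rintro ⟨l', hl', h⟩ hl
    obtain ⟨γ, rfl⟩ := (projGeod_eq_iff ρ).1 h
    exact hl' ((crosses_map_iff H γ l' n).1 hl)
  rw [this]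
  exact isOpenMap_projGeod ρ _ (isClopen_crosses D n).compl.isOpen

lemma mem_recQuot_shift (q : QuotGeod ρ) : q ∈ recQuot D ↔ quotShiftHomeo ρ q ∈ recQuot D := by
  obtain ⟨l, rfl⟩ := projGeod_surjective ρ q
  change _ ↔ projGeod ρ l.shift ∈ _
  rw [projGeod_mem_recQuot H, projGeod_mem_recQuot H]
  exact mem_recSet_shift

variable (D) in
/-- The geodesic transformation of `recQuot`. -/
def recQuotShift : recQuot D ≃ₜ recQuot D :=
  (quotShiftHomeo ρ).subtype (mem_recQuot_shift H)

lemma recQuotShift_iterate (x : recQuot D) (k : ℕ) :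
    ((recQuotShift D H)^[k] x).1 = (QuotGeod.shift ρ)^[k] x.1 := by
  induction k with
  | zero => rfl
  | succ k ih => rw [Function.iterate_succ_apply', Function.iterate_succ_apply', ← ih]; rfl

lemma recQuotShift_symm_iterate (x : recQuot D) (k : ℕ) :
    ((recQuotShift D H).symm^[k] x).1 = (quotShiftHomeo ρ).symm^[k] x.1 := by
  induction k with
  | zero => rfl
  | succ k ih => rw [Function.iterate_succ_apply', Function.iterate_succ_apply', ← ih]; rfl

omit H in
variable (D) in
/-- The elements of `recQuot` whose initial edge is not collapsed. -/
def recQuotBase : Set (recQuot D) := Subtype.val ⁻¹' (projGeod ρ '' {l | Crosses D l 0})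

lemma recQuotShift_iterate_mem {l : Geod T} (hl : projGeod ρ l ∈ recQuot D) {k : ℕ} :
    (recQuotShift D H)^[k] ⟨_, hl⟩ ∈ recQuotBase D ↔ Crosses D l k := by
  rw [recQuotBase, mem_preimage, recQuotShift_iterate, quotShift_iterate, projGeod_mem_crosses H,
    crosses_shift_iterate, zero_add]

lemma recQuotShift_symm_iterate_mem {l : Geod T} (hl : projGeod ρ l ∈ recQuot D) {k : ℕ} :
    (recQuotShift D H).symm^[k] ⟨_, hl⟩ ∈ recQuotBase D ↔ Crosses D l (-k) := by
  rw [recQuotBase, mem_preimage, recQuotShift_symm_iterate, quotShift_symm_iterate,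
    projGeod_mem_crosses H, crosses_shiftInv_iterate, zero_sub]

/-- The lift of elements of the quotient of the space of geodesics of the collapsed tree. -/
noncomputable def liftQuot : QuotGeod (collAct D H) → recQuot D :=
  Quotient.lift (s := geodSetoid (collAct D H))
    (fun l => ⟨projGeod ρ (liftGeod H l), liftGeod H l, liftGeod_mem_recSet H l, rfl⟩) (by
      rintro l _ ⟨γ, rfl⟩
      refine Subtype.ext ?_
      simp only
      rw [liftGeod_map]
      exact (projGeod_eq_iff ρ).2 ⟨γ, rfl⟩)

lemma liftQuot_proj (l : Geod (collTree D)) :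
    (liftQuot H (projGeod (collAct D H) l)).1 = projGeod ρ (liftGeod H l) := rfl

lemma continuous_liftQuot : Continuous (liftQuot (D := D) H) :=
  (isQuotientMap_projGeod _).continuous_iff.2
    (((continuous_projGeod ρ).comp (continuous_liftGeod H)).subtype_mk _)

lemma liftGeod_injective : Function.Injective (liftGeod (D := D) H) := by
  intro l l' h
  rw [← collGeod_liftBase H l, ← collGeod_liftBase H l']
  congr 1
  exact Subtype.ext (Subtype.ext h)

lemma liftQuot_injective : Function.Injective (liftQuot (D := D) H) := by
  intro q q' h
  obtain ⟨l, rfl⟩ := projGeod_surjective _ q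
  obtain ⟨l', rfl⟩ := projGeod_surjective _ q'
  obtain ⟨γ, hγ⟩ := (projGeod_eq_iff ρ).1 (congrArg Subtype.val h)
  rw [← liftGeod_map] at hγ
  exact (projGeod_eq_iff _).2 ⟨γ, liftGeod_injective H hγ⟩

lemma range_liftQuot : range (liftQuot (D := D) H) = recQuotBase D := by
  ext ⟨q, hq⟩
  obtain ⟨l, rfl⟩ := projGeod_surjective ρ q
  rw [recQuotBase, mem_preimage, projGeod_mem_crosses H]
  constructor
  · rintro ⟨q', hq'⟩
    obtain ⟨l', rfl⟩ := projGeod_surjective _ q'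
    have h : projGeod ρ (liftGeod H l') = projGeod ρ l := congrArg Subtype.val hq'
    rw [← projGeod_mem_crosses H, ← h, projGeod_mem_crosses H]
    exact (liftBase H l').2
  · intro hc
    have h := liftBase_collGeod H ⟨⟨l, (projGeod_mem_recQuot H).1 hq⟩, hc⟩
    refine ⟨projGeod _ (collGeod H ⟨⟨l, (projGeod_mem_recQuot H).1 hq⟩, hc⟩), Subtype.ext ?_⟩
    rw [liftQuot_proj]
    exact congrArg (projGeod ρ) (congrArg (fun x : recBase D => x.1.1) h)

/-- On the open set `recBase` the lift has the continuous inverse `collGeod`, so an open set is the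
trace of some open `O`, and projection to the quotient is open. -/
lemma isOpenMap_liftQuot : IsOpenMap (liftQuot (D := D) H) := by
  intro U hU
  have h1 : IsOpen (collGeod H ⁻¹' (projGeod (collAct D H) ⁻¹' U) : Set (recBase D)) :=
    (hU.preimage (continuous_projGeod _)).preimage (continuous_collGeod H)
  have h2 := (isClopen_recBase D).isOpen.isOpenMap_subtype_val _ h1
  obtain ⟨O, hO, hOeq⟩ := isOpen_induced_iff.1 h2
  have hmem : ∀ l (hl : l ∈ recSet D), l ∈ O ↔ ∃ hc : Crosses D l 0,
      projGeod (collAct D H) (collGeod H ⟨⟨l, hl⟩, hc⟩) ∈ U := by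
    intro l hl
    change (⟨l, hl⟩ : recSet D) ∈ Subtype.val ⁻¹' O ↔ _
    rw [hOeq]
    constructor
    · rintro ⟨⟨x, hxc⟩, hx, hxl⟩
      simp only at hxl
      subst hxl
      exact ⟨hxc, hx⟩
    · rintro ⟨hc, hx⟩
      exact ⟨_, hx, rfl⟩
  refine isOpen_induced_iff.2 ⟨projGeod ρ '' O, isOpenMap_projGeod ρ _ hO, ?_⟩
  ext ⟨q, hq⟩
  constructor
  · rintro ⟨l, hl, hlq⟩
    simp only at hlq
    subst hlq
    obtain ⟨hc, hu⟩ := (hmem l ((projGeod_mem_recQuot H).1 hq)).1 hl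
    refine ⟨_, hu, Subtype.ext ?_⟩
    rw [liftQuot_proj]
    exact congrArg (projGeod ρ) (congrArg (fun x : recBase D => x.1.1) (liftBase_collGeod H _))
  · rintro ⟨q', hq', hqq⟩
    obtain ⟨l', rfl⟩ := projGeod_surjective _ q'
    refine ⟨liftGeod H l', (hmem _ (liftGeod_mem_recSet H l')).2 ⟨(liftBase H l').2, ?_⟩,
      congrArg Subtype.val hqq⟩
    have := collGeod_liftBase H l'
    exact (congrArg (projGeod (collAct D H)) this).symm ▸ hq'

/-- Crossing is an invariant condition, so the return time computed in the quotient equals that of a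
lift, and `recReturn_liftBase` descends. -/
lemma liftQuot_shift (q : QuotGeod (collAct D H)) :
    liftQuot H (QuotGeod.shift _ q) =
      (recQuotShift D H)^[returnTime (recQuotShift D H) (recQuotBase D) (liftQuot H q)]
        (liftQuot H q) := by
  obtain ⟨l, rfl⟩ := projGeod_surjective _ q
  obtain ⟨hs, hs0, hl⟩ := liftTimes_spec H l
  have h1 := hs (show (0 : ℤ) < 1 by omega)
  have hmem : projGeod ρ (liftGeod H l) ∈ recQuot D := ⟨_, liftGeod_mem_recSet H l, rfl⟩
  have hq : liftQuot H (projGeod (collAct D H) l) = ⟨_, hmem⟩ := rfl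
  have ht : returnTime (recQuotShift D H) (recQuotBase D) ⟨_, hmem⟩ = recTime D (liftBase H l) := by
    refine returnTime_eq (recTime_pos _) ?_ fun m hm hm' => ?_
    · rw [recQuotShift_iterate_mem, recTime_liftBase]
      exact liftGeod_crosses H l 1
    · rw [recQuotShift_iterate_mem]
      have := recTime_liftBase H l
      exact liftGeod_not_crosses H l (j := 0) (by omega) (by rw [zero_add]; omega)
  rw [hq, ht]
  refine Subtype.ext ?_
  rw [recQuotShift_iterate, quotShift_iterate]
  change projGeod ρ (liftGeod H l.shift) = _
  have h2 : (liftBase H l.shift).1.1 = (recReturn D (liftBase H l)).1.1 := by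
    rw [recReturn_liftBase]
  change projGeod ρ (liftBase H l.shift).1.1 = _
  rw [h2]
  refine congrArg (projGeod ρ) (Geod.ext (funext fun n => ?_))
  rw [recReturn_vert, shift_iterate_vert]
  rfl

theorem isSuspensionOf_recQuot :
    IsSuspensionOf (QuotGeod.shift ρ) (recQuot D) (QuotGeod.shift (collAct D H)) := by
  have hret : ∀ x, ∃ n, 0 < n ∧ (recQuotShift D H)^[n] x ∈ recQuotBase D := by
    rintro ⟨q, hq⟩
    obtain ⟨l, rfl⟩ := projGeod_surjective ρ q
    obtain ⟨n, hn, hc⟩ := (((projGeod_mem_recQuot H).1 hq).2 1).1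
    refine ⟨n.toNat, by omega, (recQuotShift_iterate_mem H hq).2 ?_⟩
    rwa [Int.toNat_of_nonneg (by omega)]
  have hback : ∀ x, ∃ n, (recQuotShift D H).symm^[n] x ∈ recQuotBase D := by
    rintro ⟨q, hq⟩
    obtain ⟨l, rfl⟩ := projGeod_surjective ρ q
    obtain ⟨n, hn, hc⟩ := (((projGeod_mem_recQuot H).1 hq).2 0).2
    refine ⟨(-n).toNat, (recQuotShift_symm_iterate_mem H hq).2 ?_⟩
    rwa [Int.toNat_of_nonneg (by omega), neg_neg]
  obtain ⟨r, hr, hrc, h, hh⟩ := exists_suspension (recQuotShift D H)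
    (QuotGeod.shift (collAct D H)) (liftQuot H) (A := recQuotBase D)
    ((isClopen_image_crosses H 0).preimage continuous_subtype_val) hret hback
    (continuous_liftQuot H) (isOpenMap_liftQuot H) (liftQuot_injective H) (range_liftQuot H)
    (liftQuot_shift H)
  exact ⟨fun q hq => (mem_recQuot_shift H q).1 hq, r, hr, hrc, h, hh⟩

/-! #### Density -/

lemma exists_prolong_seq {a b : V} (ha : a ∈ minSubtree ρ) (hb : b ∈ minSubtree ρ) (hab : a ≠ b) :
    ∃ q : ℕ → V, q 0 = a ∧ q 1 = b ∧ ∀ n, q n ∈ minSubtree ρ ∧ q n ≠ q (n + 1) ∧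
      Between T (q n) (q (n + 1)) (q (n + 2)) ∧ q (n + 2) ∉ D.horo := by
  have hex : ∀ x y, ∃ z, x ∈ minSubtree ρ → y ∈ minSubtree ρ → x ≠ y →
      z ∈ minSubtree ρ ∧ z ∉ D.horo ∧ z ≠ y ∧ Between T x y z := by
    intro x y
    by_cases h : x ∈ minSubtree ρ ∧ y ∈ minSubtree ρ ∧ x ≠ y
    · obtain ⟨z, h1, h2, h3, h4⟩ := exists_prolong (D := D) H h.1 h.2.1 h.2.2
      exact ⟨z, fun _ _ _ => ⟨h1, h2, h3, h4⟩⟩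
    · exact ⟨x, fun h1 h2 h3 => absurd ⟨h1, h2, h3⟩ h⟩
  choose ext hext using hex
  -- The recursion runs on pairs of consecutive points, since a prolongation depends on the last
  -- segment.
  set F : ℕ → V × V := fun n => (fun p : V × V => (p.2, ext p.1 p.2))^[n] (a, b) with hF
  have hsucc : ∀ n, F (n + 1) = ((F n).2, ext (F n).1 (F n).2) := fun n =>
    Function.iterate_succ_apply' _ _ _
  have hinv : ∀ n, (F n).1 ∈ minSubtree ρ ∧ (F n).2 ∈ minSubtree ρ ∧ (F n).1 ≠ (F n).2 := by
    intro n
    induction n with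
    | zero => exact ⟨ha, hb, hab⟩
    | succ n ih =>
      rw [hsucc]
      have := hext _ _ ih.1 ih.2.1 ih.2.2
      exact ⟨ih.2.1, this.1, this.2.2.1.symm⟩
  refine ⟨fun n => (F n).1, rfl, rfl, fun n => ?_⟩
  have h1 := hinv n
  have h2 := hext _ _ h1.1 h1.2.1 h1.2.2
  simp only [hsucc]
  exact ⟨h1.1, h1.2.2, h2.2.2.2, h2.2.1⟩

/-- Every segment of the minimal subtree is contained in a chain of points most of which are out
of the horoballs. -/
lemma exists_chainPts {a b : V} (ha : a ∈ minSubtree ρ) (hb : b ∈ minSubtree ρ) (hab : a ≠ b) :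
    ∃ p : ℤ → V, IsChainPts T p ∧ p 0 = a ∧ p 1 = b ∧ (∀ j, p j ∈ minSubtree ρ) ∧
      ∀ j, j ≠ 0 → j ≠ 1 → p j ∉ D.horo := by
  obtain ⟨q, hq0, hq1, hq⟩ := exists_prolong_seq (D := D) H ha hb hab
  obtain ⟨q', hq0', hq1', hq'⟩ := exists_prolong_seq (D := D) H hb ha hab.symm
  -- The sequence prolonging past `b` and the reversed one prolonging past `a` overlap in both `a`
  -- and `b`, so every triple of consecutive points lies in one of them.
  set p : ℤ → V := fun j => if 0 ≤ j then q j.toNat else q' (1 - j).toNat with hp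
  have hpos : ∀ n : ℕ, p n = q n := fun n => by simp [hp]
  have hneg : ∀ n : ℕ, p (1 - n) = q' n := by
    intro n
    match n with
    | 0 => simp [hp, hq0', hq1]
    | 1 => simp [hp, hq0, hq1']
    | n + 2 =>
      simp only [hp]
      rw [if_neg (by push_cast; omega)]
      congr 1; omega
  refine ⟨p, fun j => ?_, by simpa [hq0] using hpos 0, by simpa [hq1] using hpos 1, fun j => ?_,
    fun j h0 h1 => ?_⟩
  · rcases le_or_gt 0 j with hj | hj
    · obtain ⟨n, rfl⟩ := Int.eq_ofNat_of_zero_le hj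
      have e1 := hpos n
      have e2 := hpos (n + 1)
      have e3 := hpos (n + 2)
      push_cast at e1 e2 e3
      rw [e1, e2, e3]
      exact ⟨(hq n).2.1, (hq n).2.2.1⟩
    · obtain ⟨n, hn⟩ := Int.eq_ofNat_of_zero_le (show 0 ≤ -1 - j by omega)
      have e1 := hneg n
      have e2 := hneg (n + 1)
      have e3 := hneg (n + 2)
      rw [show (1 - (n : ℤ)) = j + 2 by omega] at e1
      rw [show (1 - ((n + 1 : ℕ) : ℤ)) = j + 1 by push_cast; omega] at e2
      rw [show (1 - ((n + 2 : ℕ) : ℤ)) = j by push_cast; omega] at e3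
      rw [e1, e2, e3]
      exact ⟨(hq' (n + 1)).2.1.symm, (hq' n).2.2.1.symm⟩
  · simp only [hp]
    split_ifs
    · exact (hq _).1
    · exact (hq' _).1
  · rcases le_or_gt 0 j with hj | hj
    · obtain ⟨n, hn⟩ := Int.eq_ofNat_of_zero_le (show 0 ≤ j - 2 by omega)
      have e := hpos (n + 2)
      rw [show ((n + 2 : ℕ) : ℤ) = j by push_cast; omega] at e
      rw [e]
      exact (hq n).2.2.2
    · obtain ⟨n, hn⟩ := Int.eq_ofNat_of_zero_le (show 0 ≤ -1 - j by omega)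
      have e := hneg (n + 2)
      rw [show (1 - ((n + 2 : ℕ) : ℤ)) = j by push_cast; omega] at e
      rw [e]
      exact (hq' n).2.2.2

lemma crosses_of_not_mem_horo {l : Geod T} (hl : ∀ n, l.vert n ∈ minSubtree ρ) {n : ℤ}
    (hn : l.vert n ∉ D.horo) : Crosses D l n :=
  (coll_ne_iff H (hl n) (hl (n + 1)) (l.adj n)).2 fun h => hn h.1

/-- Every segment of the minimal subtree is contained in a geodesic of `recSet`. -/
lemma exists_recSet_through {a b : V} (ha : a ∈ minSubtree ρ) (hb : b ∈ minSubtree ρ)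
    (hab : a ≠ b) : ∃ l ∈ recSet D, l.vert 0 = a ∧ l.vert (T.dist a b) = b := by
  obtain ⟨p, hp, hp0, hp1, hpM, hph⟩ := exists_chainPts (D := D) H ha hb hab
  obtain ⟨s, hs, hs0, hl⟩ := hp.exists_times H.tree
  set l := hp.line H.tree with hldef
  have hM : ∀ n, l.vert n ∈ minSubtree ρ := by
    have key : ∀ n i j : ℤ, s i ≤ n → n ≤ s j → l.vert n ∈ minSubtree ρ := by
      intro n i j hi hj
      refine min_convex ρ H.tree _ (hpM i) _ (hpM j) _ ?_
      rw [← hl i, ← hl j]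
      exact Geod.btw H.tree _ hi hj
    intro n
    rcases le_total 0 n with hn | hn
    · exact key n 0 n (by omega) (le_of_strictMono_int hs hs0 hn)
    · exact key n n 0 (ge_of_strictMono_int hs hs0 hn) (by omega)
  refine ⟨l, ⟨hM, fun N => ⟨⟨s (max N 2), ?_, crosses_of_not_mem_horo H hM ?_⟩,
    ⟨s (min N (-1)), ?_, crosses_of_not_mem_horo H hM ?_⟩⟩⟩, ?_, ?_⟩
  · have := le_of_strictMono_int hs hs0 (n := max N 2) (by omega)
    omega
  · rw [hl]; exact hph _ (by omega) (by omega)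
  · have := ge_of_strictMono_int hs hs0 (n := min N (-1)) (by omega)
    omega
  · rw [hl]; exact hph _ (by omega) (by omega)
  · rw [← hp0, ← hl, hs0]
  · have h1 := hs (show (0 : ℤ) < 1 by omega)
    have h2 := Geod.dist_eq' H.tree l (show s 0 ≤ s 1 by omega)
    rw [hl, hl, hp0, hp1, hs0, sub_zero] at h2
    rw [h2, hl, hp1]

/-- A basic neighborhood only sees a finite window of the geodesic, and the corresponding segment
extends to a geodesic of `recSet`. -/
lemma dense_recQuot :
    Dense ((↑) ⁻¹' recQuot D : Set (minQuotGeod ρ)) := by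
  rw [dense_iff_inter_open]
  rintro W hW ⟨⟨q, l, hl, rfl⟩, hlW⟩
  obtain ⟨O, hO, rfl⟩ := isOpen_induced_iff.1 hW
  have hlO : l ∈ projGeod ρ ⁻¹' O := hlW
  obtain ⟨N, hN⟩ := exists_window (hO.preimage (continuous_projGeod ρ)) hlO
  have hd := Geod.dist_eq' H.tree l (show -(N + 1 : ℤ) ≤ N + 1 by omega)
  obtain ⟨m, hm, hm0, hm1⟩ := exists_recSet_through (D := D) H (hl (-(N + 1 : ℤ)))
    (hl (N + 1 : ℤ)) (fun h => by have := l.inj h; omega)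
  -- The geodesic `m` starts at the left end `-(N + 1)` of the window; the shift recenters it.
  have hm' : Geod.shift^[N + 1] m ∈ recSet D := by
    have := ((recShift D)^[N + 1] ⟨m, hm⟩).2
    rwa [recShift_iterate] at this
  refine ⟨⟨projGeod ρ (Geod.shift^[N + 1] m), _, hm'.1, rfl⟩, hN _ fun n hn => ?_,
    (projGeod_mem_recQuot H).2 hm'⟩
  rw [shift_iterate_vert]
  have e1 := Geod.btw H.tree m (show 0 ≤ n + (N + 1 : ℕ) by push_cast; omega)
    (show n + (N + 1 : ℕ) ≤ T.dist (l.vert (-(N + 1 : ℤ))) (l.vert (N + 1 : ℤ)) by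
      push_cast; omega)
  have e2 := Geod.btw H.tree l (show -(N + 1 : ℤ) ≤ n by omega) (show n ≤ N + 1 by omega)
  rw [hm0, hm1] at e1
  refine btw_unique H.tree e1 e2 ?_
  have e3 := Geod.dist_eq' H.tree m (show 0 ≤ n + (N + 1 : ℕ) by push_cast; omega)
  have e4 := Geod.dist_eq' H.tree l (show -(N + 1 : ℤ) ≤ n by omega)
  rw [hm0] at e3
  push_cast at e3
  push_cast
  omega

/-! ### Borel complexity of the recurrent set -/

lemma recQuot_eq : recQuot D = minQuotGeod ρ ∩
    ⋂ N : ℤ, ((⋃ n : {n // N ≤ n}, projGeod ρ '' {l | Crosses D l n}) ∩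
      ⋃ n : {n // n ≤ N}, projGeod ρ '' {l | Crosses D l n}) := by
  ext q
  obtain ⟨l, rfl⟩ := projGeod_surjective ρ q
  simp only [mem_inter_iff, mem_iInter, mem_iUnion, projGeod_mem_crosses H,
    projGeod_mem_recQuot H, Subtype.exists, exists_prop]
  refine and_congr_left fun _ => ⟨fun h => ⟨l, h, rfl⟩, ?_⟩
  rintro ⟨l', hl', h⟩ n
  obtain ⟨γ, rfl⟩ := (projGeod_eq_iff ρ).1 h
  exact min_act ρ H.tree γ (hl' n)

lemma isGδ_recQuot : IsGδ ((↑) ⁻¹' recQuot D : Set (minQuotGeod ρ)) := by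
  have : ((↑) ⁻¹' recQuot D : Set (minQuotGeod ρ)) = ⋂ N : ℤ, (↑) ⁻¹'
      ((⋃ n : {n // N ≤ n}, projGeod ρ '' {l | Crosses D l n}) ∩
        ⋃ n : {n // n ≤ N}, projGeod ρ '' {l | Crosses D l n}) := by
    rw [recQuot_eq H, preimage_inter, Subtype.coe_preimage_self, univ_inter, preimage_iInter]
  rw [this]
  have hopen : ∀ P : ℤ → Prop,
      IsOpen (⋃ n : {n // P n}, projGeod ρ '' {l | Crosses D l n}) := fun P =>
    isOpen_iUnion fun n => (isClopen_image_crosses (D := D) H n.1).isOpen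
  exact IsGδ.iInter_of_isOpen fun N => IsOpen.preimage continuous_subtype_val
    ((hopen fun n => N ≤ n).inter (hopen fun n => n ≤ N))

lemma isClosed_minQuotGeod : IsClosed (minQuotGeod ρ) := by
  refine ⟨?_⟩
  have : (minQuotGeod ρ)ᶜ = projGeod ρ '' ⋃ n : ℤ, {l | l.vert n ∈ (minSubtree ρ)ᶜ} := by
    ext q
    obtain ⟨l, rfl⟩ := projGeod_surjective ρ q
    simp only [mem_compl_iff, mem_image, mem_iUnion]
    constructor
    · intro h
      refine ⟨l, ?_, rfl⟩
      by_contra hcon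
      push Not at hcon
      exact h ⟨l, fun n => by simpa using hcon n, rfl⟩
    · rintro ⟨l', ⟨n, hn⟩, h⟩ ⟨l'', hl'', h'⟩
      obtain ⟨γ, rfl⟩ := (projGeod_eq_iff ρ).1 (h'.trans h.symm)
      exact hn (min_act ρ H.tree γ (hl'' n))
  rw [this]
  exact isOpenMap_projGeod ρ _ (isOpen_iUnion fun n => isOpen_vert_mem n _)

end Quotient


/-! ### The boundary of a tree -/

instance borelSpace_bdry {V : Type u} (G : SimpleGraph V) : BorelSpace (Bdry G) := ⟨rfl⟩

instance borelSpace_geod {V : Type u} (G : SimpleGraph V) : BorelSpace (Geod G) := ⟨rfl⟩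

instance borelSpace_quotGeod {V : Type u} {G : SimpleGraph V} {Γ : Type w} [Group Γ]
    (ρ : Γ →* (G ≃g G)) : BorelSpace (QuotGeod ρ) := ⟨rfl⟩

section Boundary

variable {V : Type u} {T : SimpleGraph V}

lemma endpoint_eq_iff {r s : GeodRay T} :
    r.endpoint = s.endpoint ↔ ∃ m n, ∀ k, r.vert (m + k) = s.vert (n + k) :=
  Quotient.eq (r := raySetoid T)

lemma endpoint_surjective : Function.Surjective (GeodRay.endpoint : GeodRay T → Bdry T) :=
  Quotient.mk_surjective

lemma isQuotientMap_endpoint : IsQuotientMap (GeodRay.endpoint : GeodRay T → Bdry T) :=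
  isQuotientMap_quotient_mk'

lemma isOpen_ray_vert (n : ℕ) (s : Set V) : IsOpen {r : GeodRay T | r.vert n ∈ s} := by
  let _ : TopologicalSpace V := ⊥
  have _ : DiscreteTopology V := ⟨rfl⟩
  have : Continuous fun r : GeodRay T => r.vert n :=
    (continuous_apply n).comp continuous_induced_dom
  exact (isOpen_discrete s).preimage this

lemma continuous_ray {X : Type*} [TopologicalSpace X] {g : X → GeodRay T}
    (h : ∀ n v, IsOpen {x | (g x).vert n = v}) : Continuous g := by
  let _ : TopologicalSpace V := ⊥
  have _ : DiscreteTopology V := ⟨rfl⟩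
  refine continuous_induced_rng.2 (continuous_pi fun n => ?_)
  exact continuous_discrete_rng.2 fun v => h n v

lemma continuous_bdryMap (g : T ≃g T) : Continuous (Bdry.map g) := by
  refine isQuotientMap_endpoint.continuous_iff.2 ?_
  have h : Continuous (GeodRay.map g) :=
    continuous_ray fun n v => isOpen_ray_vert n (g ⁻¹' {v})
  exact isQuotientMap_endpoint.continuous.comp h

/-- The boundary is a continuous image of the second countable space of rays. The property is what
makes the complement of the support of a measure null. -/
lemma hereditarilyLindelof_bdry [Countable V] : HereditarilyLindelofSpace (Bdry T) := by
  have : SecondCountableTopology (GeodRay T) := by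
    let _ : TopologicalSpace V := ⊥
    have _ : DiscreteTopology V := ⟨rfl⟩
    exact TopologicalSpace.secondCountableTopology_induced _ _ _
  refine ⟨fun s _ => ?_⟩
  have h := (HereditarilyLindelofSpace.isLindelof (GeodRay.endpoint ⁻¹' s : Set (GeodRay T)))
  have := h.image isQuotientMap_endpoint.continuous
  rwa [image_preimage_eq _ endpoint_surjective] at this

variable (T) in
/-- The ends on the side of `v` of the edge from `u` to `v`. -/
def shadow (u v : V) : Set (Bdry T) :=
  {ξ | ∃ r : GeodRay T, r.endpoint = ξ ∧ ∃ N, ∀ n, N ≤ n → T.dist (r.vert n) v < T.dist (r.vert n) u}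

lemma endpoint_mem_shadow {r : GeodRay T} {u v : V} : r.endpoint ∈ shadow T u v ↔
    ∃ N, ∀ n, N ≤ n → T.dist (r.vert n) v < T.dist (r.vert n) u := by
  refine ⟨?_, fun h => ⟨r, rfl, h⟩⟩
  rintro ⟨s, hs, N, hN⟩
  obtain ⟨m, n, h⟩ := endpoint_eq_iff.1 hs
  refine ⟨n + N, fun k hk => ?_⟩
  have := hN (m + (k - n)) (by omega)
  rwa [h, show n + (k - n) = k by omega] at this

variable (hT : T.IsTree)
include hT

/-- A ray eventually moves away from any vertex. -/
lemma exists_dist_add (r : GeodRay T) (x : V) (N₀ : ℕ) :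
    ∃ N, N₀ ≤ N ∧ ∀ k, T.dist x (r.vert (N + k)) = T.dist x (r.vert N) + k := by
  -- The distance changes by one at each step and cannot decrease forever; once it increases,
  -- alignment makes it increase ever after.
  obtain ⟨N, hN₀, hN⟩ : ∃ N, N₀ ≤ N ∧ T.dist x (r.vert (N + 1)) = T.dist x (r.vert N) + 1 := by
    by_contra hcon
    push Not at hcon
    have hlt : ∀ k, T.dist x (r.vert (N₀ + k)) + k ≤ T.dist x (r.vert N₀) := by
      intro k
      induction k with
      | zero => simp
      | succ k ih =>
        have h1 := hcon (N₀ + k) (by omega)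
        rw [show N₀ + (k + 1) = N₀ + k + 1 by ring]
        rcases dist_adj_cases hT (r.adj (N₀ + k)) x with h | h <;> omega
    have := hlt (T.dist x (r.vert N₀) + 1)
    omega
  refine ⟨N, hN₀, fun k => ?_⟩
  have h1 : Between T x (r.vert N) (r.vert (N + 1)) := by
    unfold Between
    rw [hN, SimpleGraph.dist_eq_one_iff_adj.2 (r.adj N)]
  rcases Nat.eq_zero_or_pos k with rfl | hk
  · simp
  have h2 := h1.concat' hT (GeodRay.btw hT r (show N ≤ N + 1 by omega)
    (show N + 1 ≤ N + k by omega)) (r.adj N).ne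
  unfold Between at h2
  rw [GeodRay.dist_eq hT] at h2
  exact h2.symm

/-- A ray ends on the side of `v` as soon as it moves away from `u` at some edge starting on that
side, a condition on two consecutive vertices. -/
lemma isOpen_shadow {u v : V} (h : T.Adj u v) : IsOpen (shadow T u v) := by
  rw [← isQuotientMap_endpoint.isOpen_preimage]
  have : GeodRay.endpoint ⁻¹' shadow T u v = ⋃ k : ℕ, ⋃ a : V,
      {r : GeodRay T | r.vert k ∈ ({a} ∩ {b | T.dist b v < T.dist b u} : Set V)} ∩
        {r | r.vert (k + 1) ∈ {b | T.dist u b = T.dist u a + 1}} := by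
    ext r
    simp only [mem_preimage, endpoint_mem_shadow, mem_iUnion, mem_inter_iff, mem_ofPred_eq,
      mem_singleton_iff]
    constructor
    · rintro ⟨N, hN⟩
      obtain ⟨k, hk, hd⟩ := exists_dist_add hT r u N
      exact ⟨k, r.vert k, ⟨rfl, hN k hk⟩, hd 1⟩
    · rintro ⟨k, a, ⟨rfl, hlt⟩, hd⟩
      refine ⟨k + 1, fun n hn => ?_⟩
      have h1 : Between T u (r.vert k) (r.vert (k + 1)) := by
        unfold Between
        rw [hd, SimpleGraph.dist_eq_one_iff_adj.2 (r.adj k)]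
      have h2 := h1.concat' hT (GeodRay.btw hT r (show k ≤ k + 1 by omega) hn) (r.adj k).ne
      exact lt_of_btw_adj h (h2.trans_left hT (btw_of_adj_of_lt hT h hlt))
  rw [this]
  exact isOpen_iUnion fun k => isOpen_iUnion fun a => (isOpen_ray_vert _ _).inter
    (isOpen_ray_vert _ _)

/-- A ray ending in the shadows of all the edges of `r` must pass at all far vertices of `r`. This
makes points of the boundary Borel. -/
lemma singleton_eq_iInter_shadow (r : GeodRay T) :
    {r.endpoint} = ⋂ n, shadow T (r.vert n) (r.vert (n + 1)) := by
  ext ξ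
  obtain ⟨s, rfl⟩ := endpoint_surjective ξ
  simp only [mem_singleton_iff, mem_iInter]
  constructor
  · intro h n
    rw [h, endpoint_mem_shadow]
    exact ⟨n + 1, fun m hm => lt_of_btw_adj (r.adj n)
      (GeodRay.btw hT r (show n ≤ n + 1 by omega) hm)⟩
  · intro h
    obtain ⟨N, -, hN⟩ := exists_dist_add hT r (s.vert 0) 0
    refine endpoint_eq_iff.2 ⟨T.dist (s.vert 0) (r.vert N), N, fun k => ?_⟩
    obtain ⟨m, hm⟩ := endpoint_mem_shadow.1 (h (N + k))
    set m' := max m (T.dist (s.vert 0) (r.vert N) + k) with hm'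
    have h1 := dist_across hT (r.adj (N + k)) (z := s.vert 0) (w := s.vert m') (by
      rw [hN k, show N + k + 1 = N + (k + 1) by ring, hN (k + 1)]; omega) (hm m' (by omega))
    have h2 : Between T (s.vert 0) (r.vert (N + k)) (s.vert m') := by
      have t1 := dist_tri hT (s.vert 0) (r.vert (N + k)) (s.vert m')
      have t2 := dist_tri hT (r.vert (N + k)) (r.vert (N + k + 1)) (s.vert m')
      have t3 := SimpleGraph.dist_eq_one_iff_adj.2 (r.adj (N + k))
      unfold Between
      omega
    have h3 := GeodRay.btw hT s (show 0 ≤ T.dist (s.vert 0) (r.vert N) + k by omega)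
      (show T.dist (s.vert 0) (r.vert N) + k ≤ m' by omega)
    refine btw_unique hT h3 h2 ?_
    have h4 := GeodRay.dist_eq hT s 0 (T.dist (s.vert 0) (r.vert N) + k)
    rw [zero_add] at h4
    rw [h4, hN k]

lemma measurableSet_singleton_bdry (ξ : Bdry T) : MeasurableSet ({ξ} : Set (Bdry T)) := by
  obtain ⟨r, rfl⟩ := endpoint_surjective ξ
  rw [singleton_eq_iInter_shadow hT r]
  exact MeasurableSet.iInter fun n => (isOpen_shadow hT (r.adj n)).measurableSet

/-- The sequence defining the cocycle is eventually constant, so its limit is one of its values,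
bounded by the triangle inequality. -/
lemma busemann_le_dist (ξ : Bdry T) (x y : V) : busemann ξ x y ≤ T.dist x y := by
  unfold busemann
  set r := Quotient.out (s := raySetoid T) ξ
  obtain ⟨N, -, hN⟩ := exists_dist_add hT r x 0
  obtain ⟨N', -, hN'⟩ := exists_dist_add hT r y 0
  have hconst : ∀ k, ((T.dist x (r.vert (N + N' + k)) : ℝ) - T.dist (r.vert (N + N' + k)) y) =
      (T.dist x (r.vert (N + N')) : ℝ) - T.dist (r.vert (N + N')) y := by
    intro k
    rw [T.dist_comm (v := y), T.dist_comm (v := y), hN N', add_assoc, hN (N' + k),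
      show N + (N' + k) = N' + (N + k) by ring, hN' (N + k), add_comm N N', hN' N]
    push_cast; ring
  have hlim : Tendsto (fun n : ℕ => ((T.dist x (r.vert n) : ℝ) - T.dist (r.vert n) y)) atTop
      (𝓝 ((T.dist x (r.vert (N + N')) : ℝ) - T.dist (r.vert (N + N')) y)) := by
    refine tendsto_const_nhds.congr' ?_
    filter_upwards [eventually_ge_atTop (N + N')] with n hn
    obtain ⟨k, rfl⟩ := Nat.exists_eq_add_of_le hn
    exact (hconst k).symm
  rw [hlim.limUnder_eq]
  have h := dist_tri hT x y (r.vert (N + N'))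
  rw [T.dist_comm (u := y)] at h
  have h' : (T.dist x (r.vert (N + N')) : ℝ) ≤ T.dist x y + T.dist (r.vert (N + N')) y := by
    exact_mod_cast h
  linarith

end Boundary

/-! ### Patterson-Sullivan measures -/

section PattersonSullivan

variable {V : Type u} {T : SimpleGraph V} {Γ : Type w} [Group Γ] {ρ : Γ →* (T ≃g T)} {δ : ℝ}
  {μ : V → Measure (Bdry T)}

/-- The density is bounded below through the bound on the cocycle. Only the inequality for
`withDensity` is used, which requires no measurability of `s`. -/
lemma _root_.IsPattersonSullivan.exp_mul_le (hμ : IsPattersonSullivan ρ δ μ) (hT : T.IsTree)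
    (hδ : 0 ≤ δ) (x y : V) (s : Set (Bdry T)) :
    ENNReal.ofReal (Real.exp (-δ * T.dist x y)) * μ y s ≤ μ x s := by
  rw [hμ.density_eq x y]
  refine le_trans ?_ (withDensity_apply_le _ s)
  rw [← setLIntegral_const]
  refine lintegral_mono fun ξ => ENNReal.ofReal_le_ofReal (Real.exp_le_exp.2 ?_)
  have := mul_le_mul_of_nonneg_left (busemann_le_dist hT ξ x y) hδ
  linarith

lemma _root_.IsPattersonSullivan.act_apply (hμ : IsPattersonSullivan ρ δ μ) (γ : Γ) (x : V)
    {s : Set (Bdry T)} (hs : MeasurableSet s) : μ (ρ γ x) s = μ x (Bdry.map (ρ γ) ⁻¹' s) := by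
  rw [← hμ.map_eq γ x, Measure.map_apply (continuous_bdryMap _).measurable hs]

lemma _root_.IsPattersonSullivan.ne_zero_of_ne_zero (hμ : IsPattersonSullivan ρ δ μ) (hT : T.IsTree)
    (hδ : 0 ≤ δ) {x : V} (y : V) {s : Set (Bdry T)} (h : μ x s ≠ 0) : μ y s ≠ 0 := by
  intro h0
  have := hμ.exp_mul_le hT hδ y x s
  rw [h0, nonpos_iff_eq_zero, mul_eq_zero] at this
  rcases this with h1 | h1
  · rw [ENNReal.ofReal_eq_zero] at h1
    exact absurd (Real.exp_pos _) (not_lt.2 h1)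
  · exact h h1

end PattersonSullivan


/-! ### Points at infinity of horoballs -/

section Cusps

variable {V : Type u} {T : SimpleGraph V} {Γ : Type w} [Group Γ] {ρ : Γ →* (T ≃g T)}
  {D : CuspidalDecomposition ρ} (H : IsNonElementaryAction ρ)
include H

variable (D) in
/-- The ray from a vertex of a horoball to its point at infinity. -/
noncomputable def upRay (v : D.horo) : GeodRay T where
  vert n := (up D)^[n] v
  adj n := by
    rw [Function.iterate_succ_apply']
    exact up_adj H (up_iterate_mem H v.2 n)
  inj a b hab := by
    obtain ⟨i, n, h⟩ := mem_horo_iff.1 v.2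
    have h1 := h.up_iterate H a
    have h2 := h.up_iterate H b
    simp only at hab
    rw [hab] at h1
    have := (h1.unique h2).2
    omega

variable (D) in
/-- The point at infinity of the horoball of `v`. -/
noncomputable def cusp (v : D.horo) : Bdry T := (upRay D H v).endpoint

lemma cusp_eq_iff {v w : D.horo} : cusp D H v = cusp D H w ↔ HConn D (v : V) w := by
  constructor
  · intro h
    obtain ⟨m, n, h⟩ := endpoint_eq_iff.1 h
    have h0 : (up D)^[m] (v : V) = (up D)^[n] (w : V) := h 0
    refine (HConn.up_iterate H v.2 m).trans ?_
    rw [h0]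
    exact (HConn.up_iterate H w.2 n).symm
  · intro h
    obtain ⟨m, n, h⟩ := h.exists_up_eq H
    refine endpoint_eq_iff.2 ⟨m, n, fun k => ?_⟩
    change (up D)^[m + k] (v : V) = (up D)^[n + k] (w : V)
    rw [add_comm m, add_comm n, Function.iterate_add_apply, Function.iterate_add_apply, h]

lemma map_cusp (γ : Γ) (v : D.horo) :
    Bdry.map (ρ γ) (cusp D H v) = cusp D H ⟨ρ γ v, horo_act H γ v.2⟩ :=
  endpoint_eq_iff.2 ⟨0, 0, fun k => (up_iterate_act H v.2 γ (0 + k)).symm⟩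

/-- A ray that remains in a horoball converges to its point at infinity. -/
lemma exists_cusp_eq {r : GeodRay T} {N : ℕ} (h : ∀ n, N ≤ n → r.vert n ∈ D.horo) :
    ∃ v, r.endpoint = cusp D H v := by
  have hstep : ∀ n, N ≤ n → r.vert (n + 1) = up D (r.vert n) := by
    intro n hn
    -- After one descending step, an ascending one would backtrack, so the ray would descend
    -- forever, whereas levels are natural numbers.
    refine (up_of_adj H (h n hn) (h (n + 1) (by omega)) (r.adj n)).resolve_right fun hdown => ?_
    have hall : ∀ k, r.vert (n + k) = up D (r.vert (n + k + 1)) := by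
      intro k
      induction k with
      | zero => exact hdown
      | succ k ih =>
        refine (up_of_adj H (h _ (by omega)) (h _ (by omega)) (r.adj (n + (k + 1)))).resolve_left
          fun hup => ?_
        have := r.inj (hup.trans ih.symm)
        omega
    have hit : ∀ k, r.vert n = (up D)^[k] (r.vert (n + k)) := by
      intro k
      induction k with
      | zero => rfl
      | succ k ih => rw [ih, Function.iterate_succ_apply, hall k, add_assoc]
    obtain ⟨i, L, hL⟩ := mem_horo_iff.1 (h n hn)
    obtain ⟨j, L', hL'⟩ := mem_horo_iff.1 (h (n + (L + 1)) (by omega))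
    have h1 := hL'.up_iterate H (L + 1)
    rw [← hit] at h1
    have := (hL.unique h1).2
    omega
  refine ⟨⟨r.vert N, h N le_rfl⟩, endpoint_eq_iff.2 ⟨N, 0, fun k => ?_⟩⟩
  change r.vert (N + k) = (up D)^[0 + k] (r.vert N)
  rw [zero_add]
  induction k with
  | zero => rfl
  | succ k ih =>
    rw [Function.iterate_succ_apply', ← ih]
    exact hstep (N + k) (by omega)

lemma convex_hconn (z : V) : TConvex T {w | HConn D z w} := by
  intro a ha b hb c hc
  exact HConn.trans ha (HConn.mid H (HConn.trans (HConn.symm ha) hb) hc)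

/-- A segment between two vertices of a horoball, starting on the boundary, goes up. -/
lemma between_up {z z' : V} {i : Fin D.numRays} (hz : AtLevel D i 0 z) (h : HConn D z z')
    (hne : z ≠ z') : Between T z (up D z) z' := by
  obtain ⟨c, hc, hcb⟩ := exists_adj_btw H.tree hne
  have hch : c ∈ D.horo := (h.mid H hcb).right
  rcases hz.adj_cases H (horo_subset hch) hc with h1 | ⟨-, h1⟩ | ⟨m, h1, -⟩
  · rwa [h1] at hcb
  · exact absurd hch h1
  · omega

/-- What lies behind the boundary vertex `z`, seen from inside the horoball, is strictly closer to
`z` than to any other vertex of the horoball; exchanging `z` and `z'` gives a contradiction. -/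
lemma disjoint_shadow_up {z z' : V} {i j : Fin D.numRays} (hz : AtLevel D i 0 z)
    (hz' : AtLevel D j 0 z') (h : HConn D z z') (hne : z ≠ z') :
    Disjoint (shadow T (up D z) z) (shadow T (up D z') z') := by
  have key : ∀ {z z' : V} {i : Fin D.numRays}, AtLevel D i 0 z → HConn D z z' → z ≠ z' →
      ∀ w, T.dist w z < T.dist w (up D z) → T.dist w z < T.dist w z' := by
    intro z z' i hz h hne w hw
    have hadj := up_adj H hz.mem_horo
    have h1 := (btw_of_adj_of_lt H.tree hadj.symm hw).symm.concat' H.tree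
      (between_up H hz h hne) hadj.ne
    unfold Between at h1
    have := H.tree.connected.pos_dist_of_ne hne
    omega
  refine Set.disjoint_left.2 ?_
  intro ξ hξ hξ'
  obtain ⟨r, rfl⟩ := endpoint_surjective ξ
  obtain ⟨N, hN⟩ := endpoint_mem_shadow.1 hξ
  obtain ⟨N', hN'⟩ := endpoint_mem_shadow.1 hξ'
  have h1 := key hz h hne _ (hN (max N N') (le_max_left _ _))
  have h2 := key hz' h.symm hne.symm _ (hN' (max N N') (le_max_right _ _))
  omega

/-- The projection of a vertex to the horoball of a boundary vertex is a boundary vertex. -/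
lemma exists_gate_horoball {o z : V} {i : Fin D.numRays} (ho : AtLevel D i 0 o)
    (hz : z ∈ D.horo) :
    ∃ y j, AtLevel D j 0 y ∧ HConn D z y ∧ ∀ w, HConn D z w → Between T o y w := by
  obtain ⟨y, hy, hgate⟩ := exists_gate H.tree ⟨z, HConn.refl hz⟩ (convex_hconn H z) o
  have hy' : HConn D z y := hy
  obtain ⟨j, n, hn⟩ := mem_horo_iff.1 hy'.right
  rcases eq_or_ne y o with rfl | hne
  · exact ⟨y, i, ho, hy', hgate⟩
  obtain ⟨c, hc, hcb⟩ := exists_adj_btw H.tree hne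
  have hcM : c ∈ minSubtree ρ :=
    min_convex ρ H.tree _ hn.1 _ ho.1 _ hcb
  -- The step from the gate `y` back towards `o` leaves the horoball, and this is only possible from
  -- level 0.
  have hcC : c ∉ D.horo := by
    intro hch
    have h1 := hgate c (hy'.trans (HConn.of_adj hc hy'.right hch))
    have h2 := SimpleGraph.dist_eq_one_iff_adj.2 hc
    unfold Between at h1 hcb
    rw [T.dist_comm (u := o) (v := y), T.dist_comm (u := o) (v := c)] at h1
    omega
  rcases hn.adj_cases H hcM hc with h1 | ⟨rfl, -⟩ | ⟨m, -, h1, -⟩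
  · exact absurd (h1 ▸ up_mem H hy'.right) hcC
  · exact ⟨y, j, hn, hy', hgate⟩
  · exact absurd h1.mem_horo hcC

end Cusps

/-! ### Patterson-Sullivan measures have no atom at the cusps -/

section Atoms

variable {V : Type u} {T : SimpleGraph V} {Γ : Type w} [Group Γ] {ρ : Γ →* (T ≃g T)}
  {D : CuspidalDecomposition ρ} {δ : ℝ} {μ : V → Measure (Bdry T)}

lemma preimage_shadow (g : T ≃g T) (u v : V) :
    Bdry.map g ⁻¹' shadow T (g u) (g v) = shadow T u v := by
  ext ξ
  obtain ⟨r, rfl⟩ := endpoint_surjective ξ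
  change (GeodRay.map g r).endpoint ∈ shadow T (g u) (g v) ↔ r.endpoint ∈ shadow T u v
  simp only [endpoint_mem_shadow, GeodRay.map, dist_map]

lemma tsum_comp_le_of_finite_fiber {α β : Type*} (g : α → β) (f : β → ℝ≥0∞) (K : ℕ∞)
    (hK : ∀ b, (g ⁻¹' {b}).encard ≤ K) : ∑' a, f (g a) ≤ (K : ℝ≥0∞) * ∑' b, f b := by
  rw [← ENNReal.tsum_fiberwise (fun a => f (g a)) g, ← ENNReal.tsum_mul_left]
  refine ENNReal.tsum_le_tsum fun b => ?_
  have : ∑' a : g ⁻¹' {b}, f (g a) = ∑' _ : g ⁻¹' {b}, f b :=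
    tsum_congr fun a => congrArg f a.2
  rw [this, ENNReal.tsum_set_const]
  gcongr
  exact hK b

lemma encard_act_eq_le (o z : V) :
    {γ : Γ | ρ γ o = z}.encard ≤ (vertexStab ρ o : Set Γ).encard := by
  rcases Set.eq_empty_or_nonempty {γ : Γ | ρ γ o = z} with h | ⟨η, hη⟩
  · simp [h]
  · have hη : ρ η o = z := hη
    refine Set.encard_le_encard_of_injOn (f := fun γ => η⁻¹ * γ) (fun γ hγ => ?_)
      (mul_right_injective η⁻¹).injOn
    change ρ (η⁻¹ * γ) o = o
    have hγ : ρ γ o = z := hγ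
    rw [act_mul, hγ, ← hη, inv_act]

/-- Convergence of the Poincaré series does not depend on the base point. -/
lemma _root_.PoincareConverges.change_base (hT : T.IsTree) (hδ : 0 ≤ δ) {o : V}
    (h : PoincareConverges ρ o δ) (x : V) : PoincareConverges ρ x δ := by
  unfold PoincareConverges at *
  refine Summable.of_nonneg_of_le (fun γ => (Real.exp_pos _).le) (fun γ => ?_)
    (h.mul_left (Real.exp (δ * (2 * T.dist o x))))
  rw [← Real.exp_add]
  refine Real.exp_le_exp.2 ?_
  have h1 : (T.dist o (ρ γ o) : ℝ) ≤ 2 * T.dist o x + T.dist x (ρ γ x) := by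
    have e1 := dist_tri hT o x (ρ γ o)
    have e2 := dist_tri hT x (ρ γ x) (ρ γ o)
    rw [dist_map, T.dist_comm (u := x) (v := o)] at e2
    have : T.dist o (ρ γ o) ≤ 2 * T.dist o x + T.dist x (ρ γ x) := by omega
    exact_mod_cast this
  nlinarith [mul_le_mul_of_nonneg_left h1 hδ]

variable (H : IsNonElementaryAction ρ) (hμ : IsPattersonSullivan ρ δ μ) (hδ : 0 ≤ δ)
include H hμ

/-- The edge extends to a geodesic of the minimal subtree, so the open shadow meets the limit set,
which is the support. -/
lemma shadow_ne_zero (x : V) {a b : V} (ha : a ∈ minSubtree ρ) (hb : b ∈ minSubtree ρ)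
    (hab : T.Adj a b) (D : CuspidalDecomposition ρ) : μ x (shadow T a b) ≠ 0 := by
  obtain ⟨l, hl, h0, h1⟩ := exists_recSet_through (D := D) H ha hb hab.ne
  rw [SimpleGraph.dist_eq_one_iff_adj.2 hab] at h1
  have hmem : l.rayPos.endpoint ∈ (μ x).support := by
    rw [hμ.support_eq]
    exact ⟨_, rfl, fun n => hl.1 n⟩
  refine ((Measure.mem_support_iff_forall _).1 hmem _ ((isOpen_shadow H.tree hab).mem_nhds ?_)).ne'
  rw [endpoint_mem_shadow]
  refine ⟨1, fun n hn => lt_of_btw_adj hab ?_⟩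
  have := Geod.btw H.tree l (show (0 : ℤ) ≤ 1 by omega) (show (1 : ℤ) ≤ n by omega)
  rwa [h0, show l.vert 1 = b from h1] at this

include hδ

/-- If the point at infinity of a horoball is an atom, then the Poincaré series converges. -/
lemma poincareConverges_of_atom (hfin : ∀ v, Finite (vertexStab ρ v)) {o : V}
    {i : Fin D.numRays} (ho : AtLevel D i 0 o)
    (hatom : μ o {cusp D H ⟨o, ho.mem_horo⟩} ≠ 0) : PoincareConverges ρ o δ := by
  have hT := H.tree
  have := hμ.finite
  set m := μ o {cusp D H ⟨o, ho.mem_horo⟩} with hm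
  set κ := μ o (shadow T (up D o) o) with hκ
  have hκ0 : κ ≠ 0 := shadow_ne_zero H hμ o (horo_subset (up_mem H ho.mem_horo)) ho.1
    (up_adj H ho.mem_horo).symm D
  -- The orbit of `o` is grouped according to the horoball, that is the cusp `ξ`. By equivariance
  -- each `z` in it has shadow mass at least `κ` and cusp mass at least `m`, measured from `z`.
  let Z := {z : D.horo // ∃ γ, ρ γ o = z}
  let E : V → V → ℝ≥0∞ := fun a b => ENNReal.ofReal (Real.exp (-δ * T.dist a b))
  have hZ : ∀ z : Z, ∃ γ, z.1 = ⟨ρ γ o, horo_act H γ ho.mem_horo⟩ := fun z =>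
    z.2.imp fun γ hγ => Subtype.ext hγ.symm
  have hlev : ∀ z : Z, AtLevel D i 0 (z.1 : V) := by
    intro z
    obtain ⟨γ, hγ⟩ := hZ z
    rw [hγ]
    exact ho.act H γ
  have hadj : ∀ z : Z, T.Adj (up D (z.1 : V)) z.1 := fun z => (up_adj H z.1.2).symm
  have hshadow : ∀ z : Z, κ ≤ μ z.1 (shadow T (up D z.1) z.1) := by
    intro z
    have h := hadj z
    obtain ⟨γ, hγ⟩ := hZ z
    rw [hγ] at h ⊢
    rw [hμ.act_apply γ o (isOpen_shadow hT h).measurableSet, up_act H ho.mem_horo,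
      preimage_shadow]
  have hcusp : ∀ z : Z, m ≤ μ z.1 {cusp D H z.1} := by
    intro z
    obtain ⟨γ, hγ⟩ := hZ z
    rw [hγ, hμ.act_apply γ o (measurableSet_singleton_bdry hT _)]
    refine measure_mono ?_
    rintro _ rfl
    exact map_cusp H γ _
  have huniv : ∀ z : Z, μ z.1 univ = μ o univ := by
    intro z
    obtain ⟨γ, hγ⟩ := hZ z
    rw [hγ, hμ.act_apply γ o MeasurableSet.univ, preimage_univ]
  have hfiber : ∀ ξ : Bdry T, (∑' z : (fun z : Z => cusp D H z.1) ⁻¹' {ξ}, E o z.1.1) * (κ * m) ≤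
      μ o univ * μ o {ξ} := by
    intro ξ
    rcases isEmpty_or_nonempty ((fun z : Z => cusp D H z.1) ⁻¹' {ξ}) with hemp | ⟨⟨z₀, hz₀⟩⟩
    · simp
    have hz₀ : cusp D H z₀.1 = ξ := hz₀
    -- The entry point `y` of the horoball is at level 0 over the same ray, so it is itself in the
    -- orbit, and `E o z` factors as `E o y * E y z`.
    obtain ⟨y, j, hy, hconn, hgate⟩ := exists_gate_horoball H ho z₀.1.2
    obtain rfl := hconn.same_ray H (hlev z₀) hy
    obtain ⟨γ, hγ⟩ := projVertex_eq_iff.1 (ho.2.trans hy.2.symm)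
    let y' : Z := ⟨⟨y, hy.mem_horo⟩, γ, hγ⟩
    have hyξ : cusp D H y'.1 = ξ := by
      rw [← hz₀, cusp_eq_iff]
      exact hconn.symm
    have hzconn : ∀ z : (fun z : Z => cusp D H z.1) ⁻¹' {ξ}, HConn D (z₀.1 : V) z.1.1 :=
      fun z => (cusp_eq_iff H).1 (hz₀.trans (Eq.symm z.2))
    have hEE : ∀ z : (fun z : Z => cusp D H z.1) ⁻¹' {ξ}, E o z.1.1 = E o y * E y z.1.1 := by
      intro z
      have h := hgate _ (hzconn z)
      unfold Between at h
      simp only [E]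
      rw [← h, ← ENNReal.ofReal_mul (Real.exp_pos _).le, ← Real.exp_add]
      push_cast
      ring_nf
    -- Seen from `y`, the disjoint shadows behind the orbit points of the horoball have total mass
    -- at most the mass of `μ y`, which is that of `μ o`.
    have h1 : ∑' z : (fun z : Z => cusp D H z.1) ⁻¹' {ξ}, E y z.1.1 * κ ≤ μ o univ := by
      calc ∑' z : (fun z : Z => cusp D H z.1) ⁻¹' {ξ}, E y z.1.1 * κ
          ≤ ∑' z : (fun z : Z => cusp D H z.1) ⁻¹' {ξ}, μ y (shadow T (up D z.1.1) z.1.1) :=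
            ENNReal.tsum_le_tsum fun z => (mul_le_mul_right (hshadow z.1) _).trans
              (hμ.exp_mul_le hT hδ _ _ _)
        _ ≤ μ y (⋃ z : (fun z : Z => cusp D H z.1) ⁻¹' {ξ}, shadow T (up D z.1.1) z.1.1) :=
            tsum_meas_le_meas_iUnion_of_disjoint _
              (fun z => (isOpen_shadow hT (hadj z.1)).measurableSet) fun z z' hne =>
                disjoint_shadow_up H (hlev z.1) (hlev z'.1) ((hzconn z).symm.trans (hzconn z'))
                  fun h => hne (Subtype.ext (Subtype.ext (Subtype.ext h)))
        _ ≤ μ y univ := measure_mono (subset_univ _)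
        _ = μ o univ := huniv y'
    -- The mass of the atom at the cusp pays for the distance from `o` to the horoball; as cusps are
    -- distinct points, these contributions are summable over `ξ`.
    have h2 : E o y * m ≤ μ o {ξ} := by
      refine (mul_le_mul_right (hcusp y') _).trans ?_
      rw [hyξ]
      exact hμ.exp_mul_le hT hδ _ _ _
    calc (∑' z : (fun z : Z => cusp D H z.1) ⁻¹' {ξ}, E o z.1.1) * (κ * m)
        = (∑' z : (fun z : Z => cusp D H z.1) ⁻¹' {ξ}, E y z.1.1 * κ) * (E o y * m) := by
          rw [tsum_congr hEE, ENNReal.tsum_mul_left, ENNReal.tsum_mul_right]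
          ring
      _ ≤ _ := mul_le_mul' h1 h2
  have hsum : (∑' z : Z, E o z.1) * (κ * m) ≤ μ o univ * μ o univ := by
    rw [← ENNReal.tsum_fiberwise _ fun z : Z => cusp D H z.1, ← ENNReal.tsum_mul_right]
    refine (ENNReal.tsum_le_tsum hfiber).trans ?_
    rw [ENNReal.tsum_mul_left]
    gcongr
    refine (tsum_meas_le_meas_iUnion_of_disjoint _ (measurableSet_singleton_bdry hT) ?_).trans
      (measure_mono (subset_univ _))
    exact fun ξ η hne => Set.disjoint_singleton.2 hne
  have hfinite : ∑' z : Z, E o z.1 ≠ ⊤ := by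
    intro htop
    rw [htop, ENNReal.top_mul (mul_ne_zero hκ0 hatom), top_le_iff] at hsum
    exact ENNReal.mul_ne_top (measure_ne_top _ _) (measure_ne_top _ _) hsum
  -- From the orbit back to the group: fibers are cosets of the finite stabilizer of `o`.
  have hΓ : ∑' γ : Γ, E o (ρ γ o) ≠ ⊤ := by
    have hK := tsum_comp_le_of_finite_fiber
      (fun γ : Γ => (⟨⟨ρ γ o, horo_act H γ ho.mem_horo⟩, γ, rfl⟩ : Z)) (fun z => E o z.1)
      (vertexStab ρ o : Set Γ).encard fun z => by
        refine le_trans (Set.encard_le_encard fun γ hγ => ?_)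
          (encard_act_eq_le (ρ := ρ) o (z.1 : V))
        exact congrArg (fun z : Z => (z.1 : V)) hγ
    refine ne_top_of_le_ne_top (ENNReal.mul_ne_top ?_ hfinite) hK
    have : Finite (vertexStab ρ o : Set Γ) := hfin o
    rw [(Set.toFinite (vertexStab ρ o : Set Γ)).encard_eq_coe]
    simp
  have := ENNReal.summable_toReal hΓ
  refine this.congr fun γ => ?_
  exact ENNReal.toReal_ofReal (Real.exp_pos _).le

end Atoms


/-! ### Almost every geodesic is recurrent -/

section FullMeasure

variable {V : Type u} {T : SimpleGraph V} {Γ : Type w} [Group Γ] {ρ : Γ →* (T ≃g T)}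
  {D : CuspidalDecomposition ρ} {δ : ℝ} {μ : V → Measure (Bdry T)}
  (H : IsNonElementaryAction ρ)
include H

variable (D) in
/-- The ends outside of the limit set or at the cusps. -/
def nonRecEnds : Set (Bdry T) := (bdryOf T (minSubtree ρ))ᶜ ∪ ⋃ v : D.horo, {cusp D H v}

/-- There are countably many vertices, hence cusps, and by divergence none is an atom. The measures
at different base points have the same null sets, so the atom may be viewed from a level 0 vertex.
-/
lemma measure_nonRecEnds (hμ : IsPattersonSullivan ρ δ μ) (hδ : 0 ≤ δ)
    (hfin : ∀ v, Finite (vertexStab ρ v)) {x : V} (hx : ¬ PoincareConverges ρ x δ) :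
    μ x (nonRecEnds D H) = 0 := by
  have : Countable V := countable_vertices H.tree H.finite_nbrs
  have := hereditarilyLindelof_bdry (T := T)
  refine measure_union_null ?_ (measure_iUnion_null fun v => ?_)
  · rw [← hμ.support_eq x]
    exact Measure.measure_compl_support
  · by_contra hne
    obtain ⟨i, n, hv⟩ := mem_horo_iff.1 v.2
    obtain ⟨o, ho, hov⟩ := hv.exists_level_zero H
    have hcusp : cusp D H v = cusp D H ⟨o, ho.mem_horo⟩ := by
      rw [cusp_eq_iff, ← hov]
      exact (HConn.up_iterate H ho.mem_horo n).symm
    rw [hcusp] at hne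
    exact hx ((poincareConverges_of_atom H hμ hδ hfin ho
      (hμ.ne_zero_of_ne_zero H.tree hδ o hne)).change_base H.tree hδ x)

/-- With both ends in the limit set, a geodesic stays in the minimal subtree by convexity. If it
stops crossing in one direction, it remains in a horoball there and converges to its cusp. -/
lemma endpoint_mem_nonRecEnds {l : Geod T} (hl : l ∉ recSet D) :
    l.rayNeg.endpoint ∈ nonRecEnds D H ∨ l.rayPos.endpoint ∈ nonRecEnds D H := by
  by_contra hcon
  simp only [nonRecEnds, mem_union, mem_compl_iff, mem_iUnion, mem_singleton_iff, not_or,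
    not_not, not_exists] at hcon
  obtain ⟨⟨⟨s, hs, hsM⟩, hneg⟩, ⟨s', hs', hsM'⟩, hpos⟩ := hcon
  obtain ⟨a, b, hab⟩ := endpoint_eq_iff.1 hs
  obtain ⟨a', b', hab'⟩ := endpoint_eq_iff.1 hs'
  have hM : ∀ n, l.vert n ∈ minSubtree ρ := by
    intro n
    have h1 : l.vert (-((b + n.natAbs : ℕ) : ℤ)) ∈ minSubtree ρ := by
      have := hsM (a + n.natAbs)
      rwa [hab] at this
    have h2 : l.vert ((b' + n.natAbs : ℕ) : ℤ) ∈ minSubtree ρ := by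
      have := hsM' (a' + n.natAbs)
      rwa [hab'] at this
    exact min_convex ρ H.tree _ h1 _ h2 _ (Geod.btw H.tree l (by omega) (by omega))
  refine hl ⟨hM, fun N => ⟨?_, ?_⟩⟩
  · by_contra hno
    push Not at hno
    obtain ⟨v, hv⟩ := exists_cusp_eq (D := D) H (r := l.rayPos) (N := N.toNat) fun n hn => by
      have h := hno n (by omega)
      rw [Crosses, coll_ne_iff H (hM _) (hM _) (l.adj _), not_not] at h
      exact h.1
    exact hpos v hv
  · by_contra hno
    push Not at hno
    obtain ⟨v, hv⟩ := exists_cusp_eq (D := D) H (r := l.rayNeg) (N := (-N).toNat) fun n hn => by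
      have h := hno (-n) (by omega)
      rw [Crosses, coll_ne_iff H (hM _) (hM _) (l.adj _), not_not] at h
      exact h.1
    exact hneg v hv

lemma measurableSet_recQuot : MeasurableSet (recQuot D) := by
  rw [recQuot_eq H]
  refine (isClosed_minQuotGeod H).measurableSet.inter (MeasurableSet.iInter fun N => ?_)
  exact (isOpen_iUnion fun n => (isClopen_image_crosses H _).isOpen).measurableSet.inter
    (isOpen_iUnion fun n => (isClopen_image_crosses H _).isOpen).measurableSet

lemma preimage_recQuot : projGeod ρ ⁻¹' recQuot D = recSet D :=
  Set.ext fun _ => projGeod_mem_recQuot H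

lemma measurableSet_recSet : MeasurableSet (recSet D) := by
  rw [← preimage_recQuot H]
  exact (continuous_projGeod ρ).measurable (measurableSet_recQuot H)

lemma bowenMargulis_compl_recSet {x : V} [IsFiniteMeasure (μ x)]
    (h0 : μ x (nonRecEnds D H) = 0) : bowenMargulis δ μ x (recSet D)ᶜ = 0 := by
  unfold bowenMargulis
  set ν := ((μ x).prod ((μ x).prod (Measure.count : Measure ℤ))).withDensity fun p =>
      ENNReal.ofReal (Real.exp (2 * δ * commonLength x p.1 p.2.1)) with hν
  -- If the parametrization fails the conditions required by `Measure.comap`, that measure is zero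
  -- by convention and nothing remains to be proved.
  by_cases h : Function.Injective (Geod.param (G := T) x) ∧
      ∀ s, MeasurableSet s → NullMeasurableSet (Geod.param x '' s) ν
  · rw [Measure.comap_apply₀ _ _ h.1 h.2 (measurableSet_recSet H).compl.nullMeasurableSet]
    refine withDensity_absolutelyContinuous _ _ (measure_mono_null (t :=
      (nonRecEnds D H ×ˢ univ) ∪ (univ ×ˢ (nonRecEnds D H ×ˢ univ))) ?_ ?_)
    · rintro _ ⟨l, hl, rfl⟩
      rcases endpoint_mem_nonRecEnds H hl with h | h
      · exact Or.inl ⟨h, mem_univ _⟩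
      · exact Or.inr ⟨mem_univ _, h, mem_univ _⟩
    · refine measure_union_null ?_ ?_ <;> simp [Measure.prod_prod, h0]
  · rw [Measure.comap, dif_neg h]
    rfl

lemma inducedMeasure_compl_recQuot {m : Measure (Geod T)} (h0 : m (recSet D)ᶜ = 0) :
    inducedMeasure ρ m (recQuot D)ᶜ = 0 := by
  unfold inducedMeasure
  have hmeas := (measurableSet_recQuot (D := D) H).compl
  rw [Measure.sum_apply _ hmeas, ENNReal.tsum_eq_zero]
  intro q
  rw [Measure.smul_apply, Measure.map_apply (continuous_projGeod ρ).measurable hmeas,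
    preimage_compl, preimage_recQuot H, Measure.restrict_le_self.absolutelyContinuous h0, smul_zero]

end FullMeasure

lemma recQuot_subset {V : Type u} {T : SimpleGraph V} {Γ : Type w} [Group Γ]
    {ρ : Γ →* (T ≃g T)} (D : CuspidalDecomposition ρ) : recQuot D ⊆ minQuotGeod ρ :=
  image_mono fun _ hl => hl.1

end GFTree

/-! ### The theorem -/

theorem mainTheorem11 {V : Type u} (T : SimpleGraph V) (hT : T.IsTree)
    (hlf : ∀ v, (T.neighborSet v).Finite) (Γ : Subgroup (T ≃g T))
    (hinv : NoInversion Γ.subtype) (hΓ : IsGeometricallyFinite Γ.subtype) :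
    ∃ (D : CuspidalDecomposition Γ.subtype) (V' : Type u) (T' : SimpleGraph V')
      (ρ' : Γ →* (T' ≃g T')) (f : V → V'),
      T'.IsTree ∧ NoInversion ρ' ∧
      -- the quotient graph is finite
      Finite (QuotVertex ρ') ∧ Finite (QuotEdge ρ') ∧
      -- edge stabilizers are finite
      (∀ a b, T'.Adj a b → Finite ↥(vertexStab ρ' a ⊓ vertexStab ρ' b)) ∧
      -- vertex stabilizers are locally finite
      (∀ a, IsLocallyFiniteSubgroup (vertexStab ρ' a)) ∧
      -- the map is simplicial and equivariant, and collapses the horoballs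
      (∀ a b, T.Adj a b → f a = f b ∨ T'.Adj (f a) (f b)) ∧
      (∀ (γ : Γ) (v : V), f (Γ.subtype γ v) = ρ' γ (f v)) ∧
      IsHoroballCollapse D T' f ∧
      -- the geodesic transformation is a suspension on a dense Gδ of full measure
      (∃ Ω : Set (QuotGeod Γ.subtype), Ω ⊆ minQuotGeod Γ.subtype ∧
        IsGδ ((↑) ⁻¹' Ω : Set (minQuotGeod Γ.subtype)) ∧
        Dense ((↑) ⁻¹' Ω : Set (minQuotGeod Γ.subtype)) ∧
        (∀ x : V, criticalExponent Γ.subtype x ≠ 0 → criticalExponent Γ.subtype x ≠ ⊤ →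
          ¬ PoincareConverges Γ.subtype x (criticalExponent Γ.subtype x).toReal →
          ∀ μ : V → Measure (Bdry T),
            IsPattersonSullivan Γ.subtype (criticalExponent Γ.subtype x).toReal μ →
            inducedMeasure Γ.subtype
              (bowenMargulis (criticalExponent Γ.subtype x).toReal μ x) Ωᶜ = 0) ∧
        IsSuspensionOf (QuotGeod.shift Γ.subtype) Ω (QuotGeod.shift ρ')) ∧
      -- the Selberg property
      (HasSelbergProperty Γ.subtype →
        ∃ Γ' : Subgroup Γ, Γ'.FiniteIndex ∧ IsAcylindrical (ρ'.comp Γ'.subtype)) := by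
  have H : GFTree.IsNonElementaryAction Γ.subtype := ⟨hT, hlf, hinv, hΓ.1⟩
  have hfin := hΓ.2.1
  -- The collapsed tree depends on the decomposition, so it must be fixed beforehand as the one
  -- witnessing the Selberg property whenever that property holds.
  obtain ⟨D, hD⟩ : ∃ D : CuspidalDecomposition Γ.subtype, HasSelbergProperty Γ.subtype →
      ∃ Γ' : Subgroup Γ, Γ'.FiniteIndex ∧ ∀ γ ∈ Γ', IsOfFinOrder γ → γ ≠ 1 →
        ∀ v ∈ minSubtree Γ.subtype, Γ.subtype γ v = v → v ∈ D.horo := by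
    by_cases hS : HasSelbergProperty Γ.subtype
    · exact hS.imp fun D h _ => h
    · exact hΓ.2.2.elim fun D => ⟨D, fun h => absurd h hS⟩
  refine ⟨D, GFTree.CollVert D, GFTree.collTree D, GFTree.collAct D H, GFTree.coll D,
    GFTree.collTree_isTree H, GFTree.collAct_noInversion H, GFTree.finite_collQuotVertex H,
    GFTree.finite_collQuotEdge H, GFTree.finite_collEdgeStab H hfin,
    GFTree.locallyFinite_collVertexStab H hfin, fun a b => GFTree.coll_simplicial H,
    GFTree.collAct_coll H, GFTree.isHoroballCollapse H,
    ⟨GFTree.recQuot D, GFTree.recQuot_subset D, GFTree.isGδ_recQuot H, GFTree.dense_recQuot H,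
      fun x _ _ hdiv μ hμ => ?_, GFTree.isSuspensionOf_recQuot H⟩, fun hS => ?_⟩
  · have := hμ.finite x
    exact GFTree.inducedMeasure_compl_recQuot H (GFTree.bowenMargulis_compl_recSet H
      (GFTree.measure_nonRecEnds H hμ ENNReal.toReal_nonneg hfin hdiv))
  · obtain ⟨Γ', hΓ', h⟩ := hD hS
    exact ⟨Γ', hΓ', GFTree.collAct_isAcylindrical H hfin h⟩
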